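/- Let $M$ be a smooth manifold of dimension $d\ge 2$, let $E\to M$ be an exact Courant algebroid with scalar product $\langle\cdot,\cdot\rangle$, anchor $\pi$ and Dorfman bracket $[\cdot,\cdot]$, and let $\mathcal G=\langle\mathcal G^{\mathrm{end}}\cdot,\cdot\rangle$ be a semi-Riemannian generalised metric: $\mathcal G^{\mathrm{end}}$ is a smooth $\langle\cdot,\cdot\rangle$-symmetric involution of $E$ and $\mathcal G$ is non-degenerate on $T^*M\cong\ker\pi$. Let $E_\pm$ be the $\pm1$-eigenbundles of $\mathcal G^{\mathrm{end}}$, $u_\pm$ the projection of $u\in\Gamma(E)$ to $E_\pm$, $g$ the semi-Riemannian metric on $M$ with $g(\pi a,\pi b)=\pm\langle a,b\rangle$ for $a,b\in E_\pm$, and $\nabla$ its Levi-Civita connection. Let $s:TM\to E$ be the isotropic splitting of $\pi$ with image $\mathcal G^{\mathrm{end}}(\ker \pi)$, $H(X,Y,Z)=2\langle[sX,sY],sZ\rangle$ the corresponding closed three-form (so that $E\cong TM\oplus T^*M$ with $\langle X+\xi,X+\xi\rangle=\xi(X)$, the $H$-twisted Dorfman bracket and $E_\pm=\{X\pm gX\}$),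 and $H^2(X,Y)=\sum_{i,j}H(X,e_i,e_j)H(Y,e^i,e^j)$ for $g$-dual local frames $(e_i)$, $(e^i)$ of $TM$. Let $\mathrm{div}=\mathrm{div}^{\mathcal G}-\langle e,\cdot\rangle$ be a divergence operator, where $e\in\Gamma(E)$ and $\mathrm{div}^{\mathcal G}(u)=\mathrm{div}_g(\pi u)$. Let $D=D^0+S$ be the canonical generalised Levi-Civita connection of $(\mathcal G,\mathrm{div})$. Here $D^0$ is the Gualtieri--Bismut connection $D^B$ of $\mathcal G$ (given by $D^B_uv=[u',v]_\pm$ for $v\in\Gamma(E_\pm)$, where $u'\in\Gamma(E_\mp)$ and $\pi u'=\pi u$) minus a third of its torsion $T(u,v,w)=\langle D^B_uv-D^B_vu-[u,v],w\rangle+\langle D^B_wu,v\rangle$, i.e. $\langle D^0_uv,w\rangle=\langle D^B_uv,w\rangle-\frac13T(u,v,w)$. The tensor $S$ is the section of $\mathfrak{so}(E)^{\langle1\rangle}_{\mathcal G}$ (tensors $u\mapsto S_u$ with $S_u$ skew-symmetric, commuting with $\mathcal G^{\mathrm{end}}$, and with vanishing cyclic sum of $\langle S_uv,w\rangle$) that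 is orthogonal to the kernel of $S\mapsto\mathrm{tr}\,S$, $(\mathrm{tr}\,S)(v)=\mathrm{tr}(u\mapsto S_uv)$, and satisfies $\mathrm{div}^{\mathcal G}+\mathrm{tr}\,S=\mathrm{div}$. Let $$2\,\mathcal{R}m^D(a,b,v,w)=\langle R^D(v,w)b,a\rangle+\langle R^D(b,a)v,w\rangle+\mathrm{tr}_E\big(\langle Dv,w\rangle\langle Db,a\rangle\big),\qquad R^D(v,w)=D_vD_w-D_wD_v-D_{[v,w]},$$ be the generalised Riemann tensor and $\overline{\mathcal{R}c}^D(a,b)=\mathrm{tr}_E\,\mathcal{R}m^D(\cdot,a,\cdot,b)$ the full generalised Ricci tensor, both traces being taken with $\langle\cdot,\cdot\rangle$. Then for all $a,b\in\Gamma(E_\pm)$, writing $u=\pi a$, $v=\pi b$, $X=\pi e_\pm$, $$\overline{\mathcal{R}c}^D(a,b)=\mathrm{Rc}(u,v)-\tfrac1{12}H^2(u,v)\pm\frac{\mathrm{div}_g(X)}{d-1}\,g(u,v)\pm\frac{d-2}{d-1}\cdot\tfrac12\big(g(\nabla_uX,v)+g(\nabla_vX,u)\big)+\frac{3-2d}{2(d-1)^2}\,|e_\pm|^2_{\mathcal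 G}\,g(u,v)+\frac{d-2}{2(d-1)^2}\,g(X,u)\,g(X,v),$$ where $\mathrm{Rc}$ is the Ricci tensor of $g$ and $|e_\pm|^2_{\mathcal G}=\mathcal G(e_\pm,e_\pm)$. -/

import Mathlib

open Bundle Module
open scoped Manifold ContDiff

noncomputable section

namespace GenGeom

variable {V : Type*} [NormedAddCommGroup V] [NormedSpace ℝ V] [FiniteDimensional ℝ V]
  {M : Type*} [TopologicalSpace M] [ChartedSpace V M] [IsManifold 𝓘(ℝ, V) ∞ M] [T2Space M]
  {F : Type*} [NormedAddCommGroup F] [NormedSpace ℝ F] [FiniteDimensional ℝ F]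
  {E : M → Type*} [∀ x, AddCommGroup (E x)] [∀ x, Module ℝ (E x)]
  [∀ x, TopologicalSpace (E x)] [TopologicalSpace (TotalSpace F E)]
  [FiberBundle F E] [VectorBundle ℝ F E] [ContMDiffVectorBundle ∞ F E 𝓘(ℝ, V)]

/-! ### Smooth sections of a vector bundle -/

variable (V F E) in
/-- The space `Γ(E)` of smooth global sections of the vector bundle `E → M`. -/
abbrev Sec : Type _ := Cₛ^∞⟮𝓘(ℝ, V); F, E⟯

/-- The product `f u` of a smooth function and a smooth section. -/
def smulFn (f : C^∞⟮𝓘(ℝ, V), M; ℝ⟯) (u : Sec V F E) : Sec V F E :=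
  ⟨fun x ↦ f x • u x, f.contMDiff.smul_section u.contMDiff⟩

variable (V F) in
/-- Every vector of the bundle is the value of a smooth global section. -/
theorem exists_sec_eq (x : M) (p : E x) : ∃ u : Sec V F E, u x = p := by
  obtain ⟨s, hs, hsm⟩ := FiberBundle.exists_contMDiffOn_extend (k := ∞) 𝓘(ℝ, V) F p
  obtain ⟨t, hts, hto, hxt⟩ := mem_nhds_iff.1 hs
  obtain ⟨f, -, hf⟩ := (SmoothBumpFunction.nhds_basis_tsupport (I := 𝓘(ℝ, V)) x).mem_iff.1
    (hto.mem_nhds hxt)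
  refine ⟨⟨fun y ↦ f y • FiberBundle.extend F p y,
    ContMDiffOn.smul_section_of_tsupport f.contMDiff.contMDiffOn hto hf (hsm.mono hts)⟩, ?_⟩
  change f x • FiberBundle.extend F p x = p
  simp

variable (V F) in
/-- A smooth global section of `E` with the prescribed value `p` at the point `x`. -/
def extSec {x : M} (p : E x) : Sec V F E := (exists_sec_eq V F x p).choose

variable (V F) in
theorem extSec_apply {x : M} (p : E x) : extSec V F p x = p := (exists_sec_eq V F x p).choose_spec

/-! ### Courant algebroids -/

variable (V F E) in
/-- A Courant algebroid structure on the vector bundle `E → M`: a smooth non-degenerate symmetric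
scalar product `⟨·,·⟩`, an anchor `π : E → TM` and a Dorfman bracket on `Γ(E)`.
Smoothness of a fibrewise (bi)linear map is expressed by its action on smooth sections. -/
structure CourantAlgebroid where
  /-- the scalar product -/
  pairing : ∀ x, LinearMap.BilinForm ℝ (E x)
  pairing_symm : ∀ x p q, pairing x p q = pairing x q p
  pairing_nondeg : ∀ x, (pairing x).Nondegenerate
  pairing_smooth : ∀ u v : Sec V F E,
    ContMDiff 𝓘(ℝ, V) 𝓘(ℝ) ∞ fun x ↦ pairing x (u x) (v x)
  /-- the anchor -/
  anchor : ∀ x, E x →ₗ[ℝ] TangentSpace 𝓘(ℝ, V) x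
  anchor_smooth : ∀ u : Sec V F E,
    ContMDiff 𝓘(ℝ, V) 𝓘(ℝ, V).tangent ∞
      fun x ↦ (⟨x, anchor x (u x)⟩ : TangentBundle 𝓘(ℝ, V) M)
  /-- the Dorfman bracket -/
  bracket : Sec V F E →ₗ[ℝ] Sec V F E →ₗ[ℝ] Sec V F E
  jacobi : ∀ u v w : Sec V F E,
    bracket u (bracket v w) = bracket (bracket u v) w + bracket v (bracket u w)
  anchor_bracket : ∀ (u v : Sec V F E) (x : M),
    anchor x (bracket u v x) =
      VectorField.mlieBracket 𝓘(ℝ, V) (fun y ↦ anchor y (u y)) (fun y ↦ anchor y (v y)) x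
  leibniz : ∀ (u v : Sec V F E) (f : C^∞⟮𝓘(ℝ, V), M; ℝ⟯) (x : M),
    bracket u (smulFn f v) x
      = f x • bracket u v x + mvfderiv 𝓘(ℝ, V) f x (anchor x (u x)) • v x
  compat : ∀ (u v w : Sec V F E) (x : M),
    mvfderiv 𝓘(ℝ, V) (fun y ↦ pairing y (v y) (w y)) x (anchor x (u x))
      = pairing x (bracket u v x) (w x) + pairing x (v x) (bracket u w x)
  symm_part : ∀ (u v w : Sec V F E) (x : M),
    pairing x (bracket u v x + bracket v u x) (w x)
      = mvfderiv 𝓘(ℝ, V) (fun y ↦ pairing y (u y) (v y)) x (anchor x (w x))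

variable (V F E) in
/-- An exact Courant algebroid: `0 → T*M → E → TM → 0` is exact, where `T*M → E` is the dual of
the anchor under the identification `E ≅ E*` by the scalar product (injectivity of `T*M → E` is
equivalent to the surjectivity of the anchor). -/
structure ExactCourantAlgebroid extends CourantAlgebroid V F E where
  anchor_surjective : ∀ x, Function.Surjective (anchor x)
  ker_anchor : ∀ x (p : E x), anchor x p = 0 ↔
    ∃ ξ : Dual ℝ (TangentSpace 𝓘(ℝ, V) x), ∀ q, pairing x p q = ξ (anchor x q)

namespace CourantAlgebroid

variable (A : CourantAlgebroid V F E)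

/-- The vector field `π u` of a section `u`. -/
def anchorField (u : Sec V F E) : Π x : M, TangentSpace 𝓘(ℝ, V) x := fun x ↦ A.anchor x (u x)

variable (F E) in
/-- A basis of the fibre `E_x`. -/
def basis (x : M) : Basis (Fin (finrank ℝ (E x))) ℝ (E x) :=
  haveI := VectorBundle.finiteDimensional ℝ F E x
  finBasis ℝ (E x)

/-- The basis of `E_x` dual to `basis F E x` with respect to the scalar product. -/
def cobasis (x : M) : Basis (Fin (finrank ℝ (E x))) ℝ (E x) :=
  haveI := VectorBundle.finiteDimensional ℝ F E x
  (A.pairing x).dualBasis (A.pairing_nondeg x) (basis F E x)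

/-- The trace `tr_E B`, taken with the scalar product, of a map `B(·,·)` on `E_x × E_x` (bilinear in
all uses). -/
def trE (x : M) (B : E x → E x → ℝ) : ℝ := ∑ i, B (basis F E x i) (A.cobasis x i)

end CourantAlgebroid

/-- A divergence operator: an `ℝ`-linear map `Γ(E) → C^∞(M)` with
`div (f u) = f div u + π(u) f`. -/
structure DivergenceOperator (A : CourantAlgebroid V F E) where
  toFun : Sec V F E →ₗ[ℝ] C^∞⟮𝓘(ℝ, V), M; ℝ⟯
  leibniz : ∀ (f : C^∞⟮𝓘(ℝ, V), M; ℝ⟯) (u : Sec V F E) (x : M),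
    toFun (smulFn f u) x = f x * toFun u x + mvfderiv 𝓘(ℝ, V) f x (A.anchor x (u x))

/-! ### Generalised connections -/

/-- A generalised connection `D` on a Courant algebroid; `D v x p` is `D_p v` for `p ∈ E_x`. -/
structure GenConnection (A : CourantAlgebroid V F E) where
  toFun : Sec V F E → ∀ x, E x →ₗ[ℝ] E x
  smooth : ∀ u v : Sec V F E, ContMDiff 𝓘(ℝ, V) (𝓘(ℝ, V).prod 𝓘(ℝ, F)) ∞
    fun x ↦ (⟨x, toFun v x (u x)⟩ : TotalSpace F E)
  add : ∀ (v w : Sec V F E) (x : M), toFun (v + w) x = toFun v x + toFun w x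
  leibniz : ∀ (f : C^∞⟮𝓘(ℝ, V), M; ℝ⟯) (v : Sec V F E) (x : M) (p : E x),
    toFun (smulFn f v) x p = f x • toFun v x p + mvfderiv 𝓘(ℝ, V) f x (A.anchor x p) • v x
  compat : ∀ (v w : Sec V F E) (x : M) (p : E x),
    mvfderiv 𝓘(ℝ, V) (fun y ↦ A.pairing y (v y) (w y)) x (A.anchor x p)
      = A.pairing x (toFun v x p) (w x) + A.pairing x (v x) (toFun w x p)

namespace GenConnection

variable {A : CourantAlgebroid V F E} (D : GenConnection A)

/-- The section `D_u v`. -/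
def cov (u v : Sec V F E) : Sec V F E := ⟨fun x ↦ D.toFun v x (u x), D.smooth u v⟩

/-- The torsion `T(u,v,w) = ⟨D_u v - D_v u - [u,v], w⟩ + ⟨D_w u, v⟩`. -/
def torsion (u v w : Sec V F E) (x : M) : ℝ :=
  A.pairing x (D.cov u v x - D.cov v u x - A.bracket u v x) (w x)
    + A.pairing x (D.cov w u x) (v x)

/-- The naive curvature `⟨D_v D_w b - D_w D_v b - D_{[v,w]} b, a⟩`, not tensorial in general. -/
def naiveCurv (a b v w : Sec V F E) (x : M) : ℝ :=
  A.pairing x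
    (D.cov v (D.cov w b) x - D.cov w (D.cov v b) x - D.cov (A.bracket v w) b x) (a x)

/-- The generalised Riemann tensor
`2 Rm(a,b,v,w) = ⟨R(v,w)b, a⟩ + ⟨R(b,a)v, w⟩ + tr_E (⟨D v, w⟩ ⟨D b, a⟩)`, with `R` the naive
curvature `R(v,w) = D_v D_w - D_w D_v - D_{[v,w]}`. -/
def riem (a b v w : Sec V F E) (x : M) : ℝ :=
  (1 / 2) * (D.naiveCurv a b v w x + D.naiveCurv w v b a x
    + A.trE x fun p q ↦
        A.pairing x (D.toFun v x p) (w x) * A.pairing x (D.toFun b x q) (a x))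

/-- The full generalised Ricci tensor `tr_E Rm(·, a, ·, b)`; the arguments of `Rm`, which is a
tensor, are extended to sections. -/
def ricci (a b : Sec V F E) (x : M) : ℝ :=
  A.trE x fun p q ↦ D.riem (extSec V F p) a (extSec V F q) b x

end GenConnection

/-! ### Generalised metrics -/

/-- A semi-Riemannian generalised metric `𝒢 = ⟨𝒢^end ·, ·⟩`: `𝒢^end` is an involution, symmetric with
respect to the scalar product, and `𝒢` is non-degenerate on `T*M = ker π`. -/
structure GenMetric (A : CourantAlgebroid V F E) where
  /-- the endomorphism `𝒢^end` -/
  endo : ∀ x, E x →ₗ[ℝ] E x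
  smooth : ∀ u : Sec V F E, ContMDiff 𝓘(ℝ, V) (𝓘(ℝ, V).prod 𝓘(ℝ, F)) ∞
    fun x ↦ (⟨x, endo x (u x)⟩ : TotalSpace F E)
  involutive : ∀ x p, endo x (endo x p) = p
  symm : ∀ x p q, A.pairing x (endo x p) q = A.pairing x p (endo x q)
  nondeg : ∀ x (p : E x), A.anchor x p = 0 →
    (∀ q, A.anchor x q = 0 → A.pairing x (endo x p) q = 0) → p = 0

namespace GenMetric

section general

variable {A : CourantAlgebroid V F E} (G : GenMetric A)

/-- The section `𝒢^end u`. -/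
def endoSec (u : Sec V F E) : Sec V F E := ⟨fun x ↦ G.endo x (u x), G.smooth u⟩

/-- The eigenbundle `E_±` of `𝒢^end`; the sign is `ε`. -/
def eig (ε : ℤˣ) (x : M) : Submodule ℝ (E x) := End.eigenspace (G.endo x) (ε : ℤ)

/-- The projection `u_± = (u ± 𝒢^end u) / 2` of a section to `E_±`. -/
def proj (ε : ℤˣ) (u : Sec V F E) : Sec V F E :=
  (1 / 2 : ℝ) • (u + ((ε : ℤ) : ℝ) • G.endoSec u)

/-- A section of `E_±`. -/
def IsSec (ε : ℤˣ) (u : Sec V F E) : Prop := ∀ x, u x ∈ G.eig ε x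

end general

variable {A : ExactCourantAlgebroid V F E} (G : GenMetric A.toCourantAlgebroid)

theorem eq_zero_of_mem_eig (ε : ℤˣ) (x : M) {p : E x} (hp : p ∈ G.eig ε x)
    (h : A.anchor x p = 0) : p = 0 := by
  obtain ⟨ξ, hξ⟩ := (A.ker_anchor x p).1 h
  refine G.nondeg x p h fun q hq ↦ ?_
  rw [End.mem_eigenspace_iff.1 hp]
  simp [hξ, hq]

theorem anchor_bijective (ε : ℤˣ) (x : M) :
    Function.Bijective ((A.anchor x).comp (G.eig ε x).subtype) := by
  have := VectorBundle.finiteDimensional ℝ F E x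
  have hε : ((ε : ℤ) : ℝ) * ((ε : ℤ) : ℝ) = 1 := by
    rcases Int.units_eq_one_or ε with h | h <;> simp [h]
  refine ⟨(injective_iff_map_eq_zero _).2 fun p hp ↦
    Subtype.ext (G.eq_zero_of_mem_eig ε x p.2 hp), fun X ↦ ?_⟩
  obtain ⟨w, rfl⟩ := A.anchor_surjective x X
  let K := LinearMap.ker (A.anchor x)
  let B : K →ₗ[ℝ] Dual ℝ K :=
    LinearMap.domRestrict₁₂ ((A.pairing x).compl₁₂ (G.endo x) LinearMap.id) K K
  have hB : Function.Injective B := (injective_iff_map_eq_zero _).2 fun p hp ↦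
    Subtype.ext (G.nondeg x p p.2 fun q hq ↦ LinearMap.congr_fun (f := B p) hp ⟨q, hq⟩)
  have hBs : Function.Surjective B :=
    (LinearMap.injective_iff_surjective_of_finrank_eq_finrank
      (Subspace.dual_finrank_eq).symm).1 hB
  obtain ⟨η, hη⟩ := hBs ((A.pairing x (((ε : ℤ) : ℝ) • w - G.endo x w)).domRestrict K)
  have key : ((ε : ℤ) : ℝ) • (w + η : E x) - G.endo x (w + η) = 0 := by
    apply G.eq_zero_of_mem_eig (-ε) x
    · rw [eig, End.mem_eigenspace_iff]
      simp only [map_sub, map_smul, G.involutive, Units.val_neg, Int.cast_neg, smul_sub, smul_smul,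
        neg_mul, hε, neg_smul, one_smul]
      abel
    · have hann : A.pairing x (((ε : ℤ) : ℝ) • (w + η : E x) - G.endo x (w + η)) ∈
          K.dualAnnihilator := by
        rw [Submodule.mem_dualAnnihilator]
        intro q hq
        obtain ⟨ξ, hξ⟩ := (A.ker_anchor x _).1 η.2
        have h1 := hξ q
        rw [LinearMap.mem_ker.1 hq, map_zero] at h1
        have h2 := LinearMap.congr_fun hη ⟨q, hq⟩
        simp only [B, LinearMap.domRestrict₁₂_apply, LinearMap.compl₁₂_apply,
          LinearMap.domRestrict_apply, LinearMap.id_apply, map_sub, map_smul,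
          LinearMap.sub_apply, LinearMap.smul_apply] at h2
        simp only [map_sub, map_smul, map_add, LinearMap.sub_apply, LinearMap.smul_apply,
          LinearMap.add_apply, h1, h2, smul_eq_mul]
        ring
      obtain ⟨ξ, hξ⟩ := (LinearMap.range_dualMap_eq_dualAnnihilator_ker (A.anchor x)).ge hann
      exact (A.ker_anchor x _).2 ⟨ξ, fun q ↦ by rw [← hξ]; rfl⟩
  refine ⟨⟨w + η, ?_⟩, ?_⟩
  · rw [eig, End.mem_eigenspace_iff, sub_eq_zero.1 key]
  · have : A.anchor x (η : E x) = 0 := η.2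
    simp [this]

/-- The inverse `T_xM → E_±` of the isomorphism `π : E_± → TM`. -/
def lift (ε : ℤˣ) (x : M) : TangentSpace 𝓘(ℝ, V) x →ₗ[ℝ] E x :=
  (G.eig ε x).subtype ∘ₗ (LinearEquiv.ofBijective _ (G.anchor_bijective ε x)).symm.toLinearMap

/-- The semi-Riemannian metric `g` on `M` such that `π : (E_+, ⟨·,·⟩) → (TM, g)` is isometric. -/
def metric (x : M) : LinearMap.BilinForm ℝ (TangentSpace 𝓘(ℝ, V) x) :=
  (A.pairing x).compl₁₂ (G.lift 1 x) (G.lift 1 x)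

theorem lift_mem (ε : ℤˣ) (x : M) (X : TangentSpace 𝓘(ℝ, V) x) : G.lift ε x X ∈ G.eig ε x :=
  Subtype.coe_prop _

theorem anchor_lift (ε : ℤˣ) (x : M) (X : TangentSpace 𝓘(ℝ, V) x) :
    A.anchor x (G.lift ε x X) = X :=
  (LinearEquiv.ofBijective _ (G.anchor_bijective ε x)).apply_symm_apply X

theorem metric_nondeg (x : M) : (G.metric x).Nondegenerate := by
  have hs : ∀ X Y, G.metric x X Y = G.metric x Y X := fun X Y ↦ A.pairing_symm x _ _
  have hl : ∀ X, (∀ Y, G.metric x X Y = 0) → X = 0 := by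
    intro X hX
    have h0 : G.lift 1 x X = 0 := by
      refine (A.pairing_nondeg x).1 _ fun q ↦ ?_
      have hp := End.mem_eigenspace_iff.1 (G.lift_mem 1 x X)
      simp only [Units.val_one, Int.cast_one, one_smul] at hp
      have hq : (1 / 2 : ℝ) • (q + G.endo x q) ∈ G.eig 1 x := by
        rw [eig, End.mem_eigenspace_iff]
        simp [G.involutive, add_comm]
      obtain ⟨Y, hY⟩ : ∃ Y, G.lift 1 x Y = (1 / 2 : ℝ) • (q + G.endo x q) :=
        ⟨_, congrArg Subtype.val
          ((LinearEquiv.ofBijective _ (G.anchor_bijective 1 x)).symm_apply_apply ⟨_, hq⟩)⟩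
      have h1 := hX Y
      rw [metric, LinearMap.compl₁₂_apply, hY] at h1
      simp only [map_smul, map_add, ← G.symm, hp, smul_eq_mul] at h1
      linarith
    rw [← G.anchor_lift 1 x X, h0, map_zero]
  exact ⟨hl, fun Y hY ↦ hl Y fun X ↦ by rw [hs]; exact hY X⟩

/-! ### The closed three-form `H`

The maximally isotropic splitting `s : TM → E` determined by `𝒢` has image `𝒢^end (ker π)`. -/

/-- A smooth section of `s(TM) = 𝒢^end (ker π)` lying over the tangent vector `X` at `x`. -/
def splitSec {x : M} (X : TangentSpace 𝓘(ℝ, V) x) : Sec V F E :=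
  Classical.epsilon fun u : Sec V F E ↦
    (∀ y, A.anchor y (G.endo y (u y)) = 0) ∧ A.anchor x (u x) = X

/-- The three-form `H(X,Y,Z) = 2 ⟨[sX, sY], sZ⟩`. The factor `2` belongs to the convention
`⟨X + ξ, X + ξ⟩ = ξ(X)` for the scalar product on `E ≅ TM ⊕ T*M`, under which
`[sX, sY] = s[X,Y] + H(X,Y,·)` and `E_± = {X ± gX}`. -/
def threeForm (x : M) (X Y Z : TangentSpace 𝓘(ℝ, V) x) : ℝ :=
  2 * A.pairing x (A.bracket (G.splitSec X) (G.splitSec Y) x) (G.splitSec Z x)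

variable (M) in
/-- A basis of `T_xM`. -/
def tbasis (x : M) : Basis (Fin (finrank ℝ V)) ℝ (TangentSpace 𝓘(ℝ, V) x) :=
  finBasis ℝ V

/-- The basis of `T_xM` that is `g`-dual to `tbasis`. -/
def tcobasis (x : M) : Basis (Fin (finrank ℝ V)) ℝ (TangentSpace 𝓘(ℝ, V) x) :=
  haveI : FiniteDimensional ℝ (TangentSpace 𝓘(ℝ, V) x) := inferInstanceAs (FiniteDimensional ℝ V)
  (G.metric x).dualBasis (G.metric_nondeg x) (tbasis M x)

/-- The symmetric tensor `H²(X,Y) = ∑ H(X, e_i, e_j) H(Y, e^i, e^j)`. -/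
def threeFormSq (x : M) (X Y : TangentSpace 𝓘(ℝ, V) x) : ℝ :=
  ∑ i, ∑ j, G.threeForm x X (tbasis M x i) (tbasis M x j)
    * G.threeForm x Y (G.tcobasis x i) (G.tcobasis x j)

/-! ### Semi-Riemannian geometry of `g` -/

/-- `∇` is the Levi-Civita connection of `g`; `cov Y x X` is `∇_X Y` at `x`. -/
structure IsLeviCivita (cov : CovariantDerivative 𝓘(ℝ, V) V (TangentSpace 𝓘(ℝ, V) : M → Type _)) :
    Prop where
  smooth : haveI : IsManifold 𝓘(ℝ, V) 1 M := .of_le (n := ∞) (by simp)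
    CovariantDerivative.ContMDiffCovariantDerivative cov ∞
  torsion_free : ∀ (X Y : Π x : M, TangentSpace 𝓘(ℝ, V) x) (x : M),
    MDifferentiableAt 𝓘(ℝ, V) 𝓘(ℝ, V).tangent (fun y ↦ (⟨y, X y⟩ : TangentBundle 𝓘(ℝ, V) M)) x →
    MDifferentiableAt 𝓘(ℝ, V) 𝓘(ℝ, V).tangent (fun y ↦ (⟨y, Y y⟩ : TangentBundle 𝓘(ℝ, V) M)) x →
    cov Y x (X x) - cov X x (Y x) = VectorField.mlieBracket 𝓘(ℝ, V) X Y x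
  metric : ∀ (Y Z : Π x : M, TangentSpace 𝓘(ℝ, V) x) (x : M) (X : TangentSpace 𝓘(ℝ, V) x),
    MDifferentiableAt 𝓘(ℝ, V) 𝓘(ℝ, V).tangent (fun y ↦ (⟨y, Y y⟩ : TangentBundle 𝓘(ℝ, V) M)) x →
    MDifferentiableAt 𝓘(ℝ, V) 𝓘(ℝ, V).tangent (fun y ↦ (⟨y, Z y⟩ : TangentBundle 𝓘(ℝ, V) M)) x →
    mvfderiv 𝓘(ℝ, V) (fun y ↦ G.metric y (Y y) (Z y)) x X
      = G.metric x (cov Y x X) (Z x) + G.metric x (Y x) (cov Z x X)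

end GenMetric

/-- The curvature `∇_X ∇_Y Z - ∇_Y ∇_X Z - ∇_{[X,Y]} Z` of an affine connection. -/
def affineCurv (cov : CovariantDerivative 𝓘(ℝ, V) V (TangentSpace 𝓘(ℝ, V) : M → Type _))
    (X Y Z : Π x : M, TangentSpace 𝓘(ℝ, V) x) (x : M) : TangentSpace 𝓘(ℝ, V) x :=
  cov (fun y ↦ cov Z y (Y y)) x (X x) - cov (fun y ↦ cov Z y (X y)) x (Y x)
    - cov Z x (VectorField.mlieBracket 𝓘(ℝ, V) X Y x)

/-- The Ricci tensor `Rc(Y,Z) = tr (X ↦ R(X,Y)Z)`; the arguments of the tensor `R` are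
extended to vector fields that are smooth near `x`. -/
def ricciTensor (cov : CovariantDerivative 𝓘(ℝ, V) V (TangentSpace 𝓘(ℝ, V) : M → Type _))
    (x : M) (Y Z : TangentSpace 𝓘(ℝ, V) x) : ℝ :=
  ∑ i, (GenMetric.tbasis M x).coord i (affineCurv cov
    (FiberBundle.extend V (GenMetric.tbasis M x i)) (FiberBundle.extend V Y)
    (FiberBundle.extend V Z) x)

/-- The divergence `tr (∇ X)` of a vector field. -/
def divergence (cov : CovariantDerivative 𝓘(ℝ, V) V (TangentSpace 𝓘(ℝ, V) : M → Type _))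
    (X : Π x : M, TangentSpace 𝓘(ℝ, V) x) (x : M) : ℝ :=
  LinearMap.trace ℝ (TangentSpace 𝓘(ℝ, V) x) (cov X x).toLinearMap

/-! ### The canonical generalised Levi-Civita connection -/

namespace GenMetric

variable {A : CourantAlgebroid V F E} (G : GenMetric A)

/-- `D` is the Gualtieri-Bismut connection of `𝒢`: it preserves `E_±`, and for `v ∈ Γ(E_±)` one has
`D_u v = [u', v]_±`, where `u' ∈ Γ(E_∓)` is the section with `π u' = π u`. -/
def IsGualtieriBismut (D : GenConnection A) : Prop :=
  ∀ (ε : ℤˣ) (u u' v : Sec V F E), G.IsSec (-ε) u' → A.anchorField u' = A.anchorField u →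
    G.IsSec ε v → D.cov u v = G.proj ε (A.bracket u' v)

/-- `D` is the canonical generalised Levi-Civita connection `D⁰` of `𝒢` with metric divergence:
the Gualtieri-Bismut connection minus a third of its torsion. -/
def IsCanonicalMetricDiv (D : GenConnection A) : Prop :=
  ∃ D' : GenConnection A, G.IsGualtieriBismut D' ∧ ∀ (u v w : Sec V F E) (x : M),
    A.pairing x (D.cov u v x) (w x)
      = A.pairing x (D'.cov u v x) (w x) - (1 / 3) * D'.torsion u v w x

/-- `S`, with `S p q = S_p q`, lies in the generalised first prolongation `𝔰𝔬(E)^{⟨1⟩}_𝒢` at `x`: each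
`S_p` is skew-symmetric and commutes with `𝒢^end`, and the cyclic sum of `⟨S_p q, r⟩` vanishes. -/
structure IsProlongation (x : M) (S : E x →ₗ[ℝ] E x →ₗ[ℝ] E x) : Prop where
  skew : ∀ p q r, A.pairing x (S p q) r = -A.pairing x q (S p r)
  comm : ∀ p q, S p (G.endo x q) = G.endo x (S p q)
  cyclic : ∀ p q r,
    A.pairing x (S p q) r + A.pairing x (S q r) p + A.pairing x (S r p) q = 0

end GenMetric

/-- The trace `(tr S)(q) = tr (p ↦ S_p q)`. -/
def trS {x : M} (S : E x →ₗ[ℝ] E x →ₗ[ℝ] E x) (q : E x) : ℝ := LinearMap.trace ℝ (E x) (S.flip q)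

/-- The scalar product on `E_x* ⊗ End E_x` induced by the scalar product of `E_x`. -/
def CourantAlgebroid.pairS (A : CourantAlgebroid V F E) (x : M)
    (S T : E x →ₗ[ℝ] E x →ₗ[ℝ] E x) : ℝ :=
  A.trE x fun p p' ↦ A.trE x fun q q' ↦ A.pairing x (S p q) (T p' q')

/-- The divergence `div^𝒢(u) = div_g(π u)`, where `cov` is the Levi-Civita connection of `g`. -/
def metricDiv (A : CourantAlgebroid V F E)
    (cov : CovariantDerivative 𝓘(ℝ, V) V (TangentSpace 𝓘(ℝ, V) : M → Type _))
    (u : Sec V F E) (x : M) : ℝ :=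
  divergence cov (A.anchorField u) x

/-- `D` is the canonical generalised Levi-Civita connection `D^{𝒢,div} = D⁰ + S`: `S` is the section
of `𝔰𝔬(E)^{⟨1⟩}_𝒢` orthogonal to `ker tr` such that `div^𝒢 + tr S = div`. Here `cov` is the
Levi-Civita connection of `g`, which enters through `div^𝒢`. -/
def GenMetric.IsCanonical {A : CourantAlgebroid V F E} (G : GenMetric A)
    (cov : CovariantDerivative 𝓘(ℝ, V) V (TangentSpace 𝓘(ℝ, V) : M → Type _))
    (dv : DivergenceOperator A) (D : GenConnection A) : Prop :=
  ∃ D₀ : GenConnection A, G.IsCanonicalMetricDiv D₀ ∧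
    ∃ S : ∀ x, E x →ₗ[ℝ] E x →ₗ[ℝ] E x,
      (∀ x, G.IsProlongation x (S x)) ∧
      (∀ x (T : E x →ₗ[ℝ] E x →ₗ[ℝ] E x), G.IsProlongation x T → (∀ q, trS T q = 0) →
        A.pairS x (S x) T = 0) ∧
      (∀ (v : Sec V F E) (x : M) (p : E x), D.toFun v x p = D₀.toFun v x p + S x p (v x)) ∧
      (∀ (u : Sec V F E) (x : M), metricDiv A cov u x + trS (S x) (u x) = dv.toFun u x)

end GenGeom

end

open Bundle Module
open scoped Manifold ContDiff Topology

noncomputable section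

namespace GenGeom

variable {V : Type*} [NormedAddCommGroup V] [NormedSpace ℝ V] [FiniteDimensional ℝ V]
  {M : Type*} [TopologicalSpace M] [ChartedSpace V M] [IsManifold 𝓘(ℝ, V) ∞ M] [T2Space M]
  {F : Type*} [NormedAddCommGroup F] [NormedSpace ℝ F] [FiniteDimensional ℝ F]
  {E : M → Type*} [∀ x, AddCommGroup (E x)] [∀ x, Module ℝ (E x)]
  [∀ x, TopologicalSpace (E x)] [TopologicalSpace (TotalSpace F E)]
  [FiberBundle F E] [VectorBundle ℝ F E] [ContMDiffVectorBundle ∞ F E 𝓘(ℝ, V)]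


set_option linter.unusedSectionVars false

/-! ### Calculus of smooth functions and sections -/

/-! The fibre splits orthogonally as `E_+ ⊕ E_-`, and the anchor identifies each summand with `(TM,
±g)`. A connection preserving `E_±` is determined by the numbers `⟨D_p v, w⟩` with `v`, `w` of one
type and `p` of either type. For the canonical connection these are explicit (`HasForm`). With `c =
1/(d-1)` and arguments read through the anchor, they equal `±g(∇_p v, w) + H(p,v,w)/6 + c(⟨p,v⟩⟨e,w⟩
- ⟨e,v⟩⟨p,w⟩)` when `p` has the same type as `v` and `w`, and `±g(∇_p v, w) + H(p,v,w)/2` when it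
has the opposite type.

The coefficients of `H` arise as follows. The Bismut connection is `∇` with the correction `H/2`
(`pairing_bracket_eq`). Its torsion is `H` on arguments of equal type (`torsion_lft`) and zero on
mixed ones, so removing a third of it leaves `1/2 - 1/3 = 1/6` in the pure case and `1/2` in the
mixed case. The `e`-term is the tensor `S`: pairing `S` with explicit trace-free elements of the
first prolongation determines it from its trace (`IsProlongation.pairing_eq`).

The naive curvature is not a tensor, but the trace term in `Rm` repairs this (`riem_swap`,
`riem_congr`), so `Rm` at `x` may be computed on any extensions. The convenient ones have anchors
that are parallel at `x` (`exists_normal`). Only frame vectors of the same type as `a` and `b`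
contribute to the Ricci trace, because `D` preserves `E_±` (`riem_eq_zero`).

On parallel extensions `2 Rm(P,a,P,b)` (`riem_normal`) consists of two curvatures of `∇`, first
derivatives of `e_±`, and terms quadratic in `H` and `e_±`. The derivatives of `H` cancel between
the two naive curvatures, by skew-symmetry alone. Tracing the curvatures gives `Rc(u,v) + Rc(v,u)`,
and the Ricci tensor is symmetric (`ricciTensor_symm`). Tracing the quadratic terms with Parseval's
identity gives `-H²/6` and the multiples of `c²` (`sum_quadTerm`). The factor `1/2` in the
definition of `Rm` then yields the stated coefficients. -/

theorem mdiffAt_of_contMDiff {f : M → ℝ} (hf : ContMDiff 𝓘(ℝ, V) 𝓘(ℝ) ∞ f) (x : M) :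
    MDifferentiableAt 𝓘(ℝ, V) 𝓘(ℝ) f x :=
  (hf x).mdifferentiableAt (by simp)

theorem smoothFn_mdiffAt (f : C^∞⟮𝓘(ℝ, V), M; ℝ⟯) (x : M) :
    MDifferentiableAt 𝓘(ℝ, V) 𝓘(ℝ) f x :=
  mdiffAt_of_contMDiff f.contMDiff x

@[simp]
theorem smulFn_apply (f : C^∞⟮𝓘(ℝ, V), M; ℝ⟯) (u : Sec V F E) (x : M) :
    smulFn f u x = f x • u x := rfl

/-- A smooth function with prescribed differential at a point where it vanishes. -/
theorem exists_fun_mvfderiv_eq (x : M) (ξ : TangentSpace 𝓘(ℝ, V) x →L[ℝ] ℝ) :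
    ∃ f : C^∞⟮𝓘(ℝ, V), M; ℝ⟯, f x = 0 ∧ ∀ X, mvfderiv 𝓘(ℝ, V) f x X = ξ X := by
  have : IsManifold 𝓘(ℝ, V) 1 M := .of_le (n := ∞) (by simp)
  have hinv := isInvertible_mfderiv_extChartAt (I := 𝓘(ℝ, V)) (mem_extChartAt_source (I := 𝓘(ℝ, V)) x)
  obtain ⟨χ⟩ : Nonempty (SmoothBumpFunction 𝓘(ℝ, V) x) := inferInstance
  -- The covector is moved to the model space by the inverse differential of the chart, so that
  -- composing with the chart gives it back.
  let φ : V →L[ℝ] ℝ := ξ.comp (mfderiv 𝓘(ℝ, V) 𝓘(ℝ, V) (extChartAt 𝓘(ℝ, V) x) x).inverse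
  let g : M → ℝ := fun y ↦ φ (extChartAt 𝓘(ℝ, V) x y - extChartAt 𝓘(ℝ, V) x x)
  have hg : ContMDiffOn 𝓘(ℝ, V) 𝓘(ℝ) ∞ g (chartAt V x).source :=
    φ.contMDiff.comp_contMDiffOn ((contMDiffOn_extChartAt (n := ∞)).sub contMDiffOn_const)
  have hgx : g x = 0 := by simp [g]
  have hgd : MDifferentiableAt 𝓘(ℝ, V) 𝓘(ℝ) g x :=
    (hg.contMDiffAt ((chartAt V x).open_source.mem_nhds (mem_chart_source V x))).mdifferentiableAt
      (by simp)
  refine ⟨⟨fun y ↦ χ y • g y, χ.contMDiff_smul hg⟩, ?_, fun X ↦ ?_⟩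
  · change χ x • g x = 0
    simp [hgx]
  · change mvfderiv 𝓘(ℝ, V) (fun y ↦ χ y • g y) x X = ξ X
    have hχ : MDifferentiableAt 𝓘(ℝ, V) 𝓘(ℝ) χ x := χ.contMDiff.contMDiffAt.mdifferentiableAt (by simp)
    have hext : MDifferentiableAt 𝓘(ℝ, V) 𝓘(ℝ, V) (extChartAt 𝓘(ℝ, V) x) x :=
      mdifferentiableAt_extChartAt (mem_chart_source V x)
    have h1 : HasMFDerivAt 𝓘(ℝ, V) 𝓘(ℝ) g x
        (φ.comp (mfderiv 𝓘(ℝ, V) 𝓘(ℝ, V) (extChartAt 𝓘(ℝ, V) x) x)) := by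
      have h2 : HasMFDerivAt 𝓘(ℝ, V) 𝓘(ℝ) (fun y ↦ φ (extChartAt 𝓘(ℝ, V) x y)) x
          (φ.comp (mfderiv 𝓘(ℝ, V) 𝓘(ℝ, V) (extChartAt 𝓘(ℝ, V) x) x)) :=
        HasMFDerivAt.comp x (φ.hasMFDerivAt) hext.hasMFDerivAt
      have h3 := h2.sub (hasMFDerivAt_const (I := 𝓘(ℝ, V)) (I' := 𝓘(ℝ))
        (φ (extChartAt 𝓘(ℝ, V) x x)) x)
      have h4 : g = (fun y ↦ φ (extChartAt 𝓘(ℝ, V) x y)) - fun _ ↦ φ (extChartAt 𝓘(ℝ, V) x x) := by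
        funext y; simp [g]
      rw [h4]
      refine h3.congr_mfderiv ?_
      exact sub_zero (G := TangentSpace 𝓘(ℝ, V) x →L[ℝ] ℝ) _
    -- In the Leibniz rule the derivative of the bump function is multiplied by `g x = 0`.
    rw [mvfderiv_fun_smul hχ hgd, mvfderiv, h1.mfderiv]
    rw [hgx, χ.eq_one, one_smul]
    have h5 : (mfderiv 𝓘(ℝ, V) 𝓘(ℝ, V) (extChartAt 𝓘(ℝ, V) x) x).inverse
        (mfderiv 𝓘(ℝ, V) 𝓘(ℝ, V) (extChartAt 𝓘(ℝ, V) x) x X) = X :=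
      hinv.inverse_apply_self X
    change ξ ((mfderiv 𝓘(ℝ, V) 𝓘(ℝ, V) (extChartAt 𝓘(ℝ, V) x) x).inverse
        (mfderiv 𝓘(ℝ, V) 𝓘(ℝ, V) (extChartAt 𝓘(ℝ, V) x) x X)) + mvfderiv 𝓘(ℝ, V) χ x X • (0 : ℝ) = ξ X
    rw [h5, smul_zero, add_zero]

theorem exists_bump_eq (x : M) {U : Set M} (hU : U ∈ 𝓝 x) :
    ∃ χ : C^∞⟮𝓘(ℝ, V), M; ℝ⟯, χ x = 1 ∧ (∀ᶠ y in 𝓝 x, χ y = 1) ∧ tsupport χ ⊆ U := by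
  obtain ⟨f, -, hf⟩ := (SmoothBumpFunction.nhds_basis_tsupport (I := 𝓘(ℝ, V)) x).mem_iff.1 hU
  exact ⟨⟨f, f.contMDiff⟩, f.eq_one, f.eventuallyEq_one, hf⟩

theorem contMDiff_bump_mul (χ : C^∞⟮𝓘(ℝ, V), M; ℝ⟯) {U : Set M} (hU : IsOpen U)
    (hχ : tsupport χ ⊆ U) {f : M → ℝ} (hf : ContMDiffOn 𝓘(ℝ, V) 𝓘(ℝ) ∞ f U) :
    ContMDiff 𝓘(ℝ, V) 𝓘(ℝ) ∞ fun y ↦ χ y * f y :=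
  contMDiff_of_tsupport fun _ hy ↦
    have hyU := hχ (tsupport_mul_subset_left hy)
    χ.contMDiff.contMDiffAt.mul (hf.contMDiffAt (hU.mem_nhds hyU))

/-- The section `χ s` of a local section `s`, where `χ` is supported in the domain of `s`. -/
def cutSec (χ : C^∞⟮𝓘(ℝ, V), M; ℝ⟯) {U : Set M} (hU : IsOpen U) (hχ : tsupport χ ⊆ U)
    (s : ∀ y, E y) (hs : ContMDiffOn 𝓘(ℝ, V) (𝓘(ℝ, V).prod 𝓘(ℝ, F)) ∞
      (fun y ↦ (⟨y, s y⟩ : TotalSpace F E)) U) : Sec V F E :=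
  ⟨fun y ↦ χ y • s y, ContMDiffOn.smul_section_of_tsupport χ.contMDiff.contMDiffOn hU hχ hs⟩

/-- A `C^∞(M)`-linear map on sections, with values at `x`, vanishes on sections that vanish
at `x`. -/
theorem map_eq_zero_of_tensorial {W : Type*} [AddCommGroup W] [Module ℝ W] {x : M}
    (L : Sec V F E → W) (hadd : ∀ u v, L (u + v) = L u + L v)
    (hL : ∀ f u, L (smulFn f u) = f x • L u) {u : Sec V F E} (hu : u x = 0) : L u = 0 := by
  have : IsManifold 𝓘(ℝ, V) 1 M := .of_le (n := ∞) (by simp)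
  let t := trivializationAt F E x
  have hx : x ∈ t.baseSet := FiberBundle.mem_baseSet_trivializationAt F E x
  let b := finBasis ℝ F
  obtain ⟨χ, hχx, -, hχ⟩ := exists_bump_eq (V := V) x (t.open_baseSet.mem_nhds hx)
  let s : Fin (finrank ℝ F) → Sec V F E := fun i ↦ cutSec χ t.open_baseSet hχ (t.localFrame b i)
    (t.contMDiffOn_localFrame_baseSet ∞ b i)
  let c : Fin (finrank ℝ F) → C^∞⟮𝓘(ℝ, V), M; ℝ⟯ := fun i ↦
    ⟨fun y ↦ χ y * t.localFrameCoeff 𝓘(ℝ, V) b i y (u y),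
      contMDiff_bump_mul χ t.open_baseSet hχ
        (contMDiffOn_baseSet_localFrameCoeff b u.contMDiff.contMDiffOn i)⟩
  -- One factor `χ` globalises the coefficients and the other the local frame. As `χ x = 1`, the
  -- value of `L` is unchanged.
  have key : smulFn χ (smulFn χ u) = ∑ i, smulFn (c i) (s i) := by
    ext y
    have hsum : (∑ i, smulFn (c i) (s i) : Sec V F E) y = ∑ i, smulFn (c i) (s i) y :=
      congr_fun (map_sum (ContMDiffSection.coeAddHom 𝓘(ℝ, V) F ∞ E) _ _) y |>.trans
        (Finset.sum_apply _ _ _)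
    rw [hsum]
    change χ y • χ y • u y = ∑ i, (χ y * t.localFrameCoeff 𝓘(ℝ, V) b i y (u y)) •
      χ y • t.localFrame b i y
    by_cases hy : y ∈ t.baseSet
    · conv_lhs => rw [t.eq_sum_localFrameCoeff_smul (I := 𝓘(ℝ, V)) (b := b) (s := u) hy]
      simp only [Finset.smul_sum]
      refine Finset.sum_congr rfl fun i _ ↦ ?_
      module
    · have h0 : χ y = 0 := image_eq_zero_of_notMem_tsupport fun h ↦ hy (hχ h)
      simp [h0]
  let L' : Sec V F E →+ W := AddMonoidHom.mk' L hadd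
  have h1 : L (smulFn χ (smulFn χ u)) = L u := by simp [hL, hχx]
  rw [← h1, key]
  change L' _ = 0
  rw [map_sum]
  refine Finset.sum_eq_zero fun i _ ↦ ?_
  change L _ = 0
  rw [hL]
  change (χ x * t.localFrameCoeff 𝓘(ℝ, V) b i x (u x)) • _ = _
  rw [hu]; simp

theorem map_eq_of_tensorial {W : Type*} [AddCommGroup W] [Module ℝ W] {x : M}
    (L : Sec V F E → W) (hadd : ∀ u v, L (u + v) = L u + L v)
    (hL : ∀ f u, L (smulFn f u) = f x • L u) {u v : Sec V F E} (huv : u x = v x) : L u = L v := by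
  have h := hadd (u - v) v
  rw [sub_add_cancel, map_eq_zero_of_tensorial L hadd hL (u := u - v), zero_add] at h
  · exact h
  · simp [huv]



/-- The differential of a smooth function. -/
def df (f : C^∞⟮𝓘(ℝ, V), M; ℝ⟯) (x : M) : TangentSpace 𝓘(ℝ, V) x →L[ℝ] ℝ :=
  mvfderiv 𝓘(ℝ, V) f x

theorem df_add (f h : C^∞⟮𝓘(ℝ, V), M; ℝ⟯) (x : M) (X : TangentSpace 𝓘(ℝ, V) x) :
    df (f + h) x X = df f x X + df h x X := by
  change mvfderiv 𝓘(ℝ, V) (fun y ↦ f y + h y) x X = _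
  rw [mvfderiv_fun_add (smoothFn_mdiffAt f x) (smoothFn_mdiffAt h x)]
  rfl

theorem df_mul (f h : C^∞⟮𝓘(ℝ, V), M; ℝ⟯) (x : M) (X : TangentSpace 𝓘(ℝ, V) x) :
    df (f * h) x X = f x * df h x X + h x * df f x X := by
  change mvfderiv 𝓘(ℝ, V) (fun y ↦ f y * h y) x X = _
  rw [mvfderiv_fun_mul (smoothFn_mdiffAt f x) (smoothFn_mdiffAt h x)]
  rfl

theorem df_const_smul (c : ℝ) (f : C^∞⟮𝓘(ℝ, V), M; ℝ⟯) (x : M) (X : TangentSpace 𝓘(ℝ, V) x) :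
    df (c • f) x X = c * df f x X := by
  change mvfderiv 𝓘(ℝ, V) (fun y ↦ c * f y) x X = _
  rw [mvfderiv_fun_mul mdifferentiableAt_const (smoothFn_mdiffAt f x), mvfderiv_const]
  simp [df]

theorem df_neg (f : C^∞⟮𝓘(ℝ, V), M; ℝ⟯) (x : M) (X : TangentSpace 𝓘(ℝ, V) x) :
    df (-f) x X = -df f x X := by
  have := df_const_smul (-1) f x X
  simpa using this

theorem df_sub (f h : C^∞⟮𝓘(ℝ, V), M; ℝ⟯) (x : M) (X : TangentSpace 𝓘(ℝ, V) x) :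
    df (f - h) x X = df f x X - df h x X := by
  rw [sub_eq_add_neg, df_add, df_neg, ← sub_eq_add_neg]

theorem df_zero (x : M) (X : TangentSpace 𝓘(ℝ, V) x) :
    df (0 : C^∞⟮𝓘(ℝ, V), M; ℝ⟯) x X = 0 := by
  have := df_const_smul 0 (0 : C^∞⟮𝓘(ℝ, V), M; ℝ⟯) x X
  simpa using this

theorem df_eq_zero_of_forall_eq {f : C^∞⟮𝓘(ℝ, V), M; ℝ⟯} {c : ℝ} (h : ∀ y, f y = c) (x : M)
    (X : TangentSpace 𝓘(ℝ, V) x) : df f x X = 0 := by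
  have : (f : M → ℝ) = fun _ ↦ c := funext h
  rw [df, this, mvfderiv_const]; rfl

/-- The derivative of a smooth function along a smooth vector field. -/
def lieDer (X : Sec V V (TangentSpace 𝓘(ℝ, V) : M → Type _)) (f : C^∞⟮𝓘(ℝ, V), M; ℝ⟯) :
    C^∞⟮𝓘(ℝ, V), M; ℝ⟯ :=
  ⟨fun y ↦ df f y (X y), by
    have : IsManifold 𝓘(ℝ, V) 1 M := .of_le (n := ∞) (by simp)
    have h := (f.contMDiff.contMDiff_tangentMap (m := ∞) (by simp)).comp X.contMDiff
    exact contMDiff_snd_tangentBundle_modelSpace ℝ 𝓘(ℝ) |>.comp h⟩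

instance finiteDimensional_tangentSpace (x : M) :
    FiniteDimensional ℝ (TangentSpace 𝓘(ℝ, V) x) := inferInstanceAs (FiniteDimensional ℝ V)

instance t2Space_tangentSpace (x : M) : T2Space (TangentSpace 𝓘(ℝ, V) x) :=
  inferInstanceAs (T2Space V)

/-- The sign `±1` as a real number. -/
abbrev sgn (ε : ℤˣ) : ℝ := ((ε : ℤ) : ℝ)

theorem sgn_mul_self (ε : ℤˣ) : sgn ε * sgn ε = 1 := by
  rcases Int.units_eq_one_or ε with h | h <;> simp [sgn, h]

theorem sgn_neg (ε : ℤˣ) : sgn (-ε) = -sgn ε := by simp [sgn]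

/-! ### Identities of the Dorfman bracket and sections of the kernel of the anchor -/

namespace CourantAlgebroid

variable (A : CourantAlgebroid V F E)

/-- The smooth function `⟨u, v⟩`. -/
def pair (u v : Sec V F E) : C^∞⟮𝓘(ℝ, V), M; ℝ⟯ :=
  ⟨fun y ↦ A.pairing y (u y) (v y), A.pairing_smooth u v⟩

@[simp]
theorem pair_apply (u v : Sec V F E) (x : M) : A.pair u v x = A.pairing x (u x) (v x) := rfl

/-- The smooth vector field `π u`. -/
def tan (u : Sec V F E) : Sec V V (TangentSpace 𝓘(ℝ, V) : M → Type _) :=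
  ⟨A.anchorField u, A.anchor_smooth u⟩

@[simp]
theorem tan_apply (u : Sec V F E) (x : M) : A.tan u x = A.anchor x (u x) := rfl

theorem bracket_smulFn (u v : Sec V F E) (f : C^∞⟮𝓘(ℝ, V), M; ℝ⟯) :
    A.bracket u (smulFn f v) = smulFn f (A.bracket u v) + smulFn (lieDer (A.tan u) f) v := by
  ext x
  exact A.leibniz u v f x

theorem df_pair (u v w : Sec V F E) (x : M) :
    df (A.pair v w) x (A.anchor x (u x))
      = A.pairing x (A.bracket u v x) (w x) + A.pairing x (v x) (A.bracket u w x) :=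
  A.compat u v w x

theorem pairing_bracket_add (u v w : Sec V F E) (x : M) :
    A.pairing x (A.bracket u v x) (w x) + A.pairing x (A.bracket v u x) (w x)
      = df (A.pair u v) x (A.anchor x (w x)) := by
  have h := A.symm_part u v w x
  rw [map_add, LinearMap.add_apply] at h
  exact h

theorem eq_of_pairing_eq {x : M} {p q : E x} (h : ∀ r, A.pairing x p r = A.pairing x q r) :
    p = q := by
  refine sub_eq_zero.1 ((A.pairing_nondeg x).1 _ fun r ↦ ?_)
  simp [h]

/-- The Leibniz rule holds in the second slot; the symmetric part of the bracket carries it to the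
first. The additional term `⟨u,v⟩ df` is what later produces sections of `ker π`. -/
theorem pairing_bracket_smulFn_left (u v : Sec V F E) (f : C^∞⟮𝓘(ℝ, V), M; ℝ⟯) (x : M)
    (w : E x) :
    A.pairing x (A.bracket (smulFn f u) v x) w
      = f x * A.pairing x (A.bracket u v x) w
        - df f x (A.anchor x (v x)) * A.pairing x (u x) w
        + A.pairing x (u x) (v x) * df f x (A.anchor x w) := by
  obtain ⟨w, rfl⟩ := exists_sec_eq V F x w
  have h1 := A.pairing_bracket_add (smulFn f u) v w x
  have h2 := A.pairing_bracket_add u v w x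
  have h3 : A.pair (smulFn f u) v = f * A.pair u v := by
    ext y; simp
  rw [h3, df_mul, A.bracket_smulFn] at h1
  simp only [ContMDiffSection.coe_add, Pi.add_apply, smulFn_apply, map_add, map_smul,
    LinearMap.add_apply, LinearMap.smul_apply, smul_eq_mul, pair_apply] at h1
  have h4 : lieDer (A.tan v) f x = df f x (A.anchor x (v x)) := rfl
  rw [h4] at h1
  linear_combination h1 - f x * h2

/-- Anchored derivations satisfy `π([u,v]) f = π(u) π(v) f - π(v) π(u) f`. -/
theorem df_anchor_bracket (u v : Sec V F E) (f : C^∞⟮𝓘(ℝ, V), M; ℝ⟯) (x : M) :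
    df f x (A.anchor x (A.bracket u v x))
      = df (lieDer (A.tan v) f) x (A.anchor x (u x))
        - df (lieDer (A.tan u) f) x (A.anchor x (v x)) := by
  -- In a non-zero fibre, the Jacobi identity for `u`, `v`, `f w` is compared with `f` times that
  -- for `u`, `v`, `w`; the difference is a multiple of `w`. Over a zero fibre the anchor is zero.
  by_cases hE : ∃ p : E x, p ≠ 0
  · obtain ⟨p, hp⟩ := hE
    obtain ⟨w, rfl⟩ := exists_sec_eq V F x p
    have h := congr_fun (congrArg (fun s : Sec V F E ↦ (s : ∀ y, E y)) (A.jacobi u v (smulFn f w))) x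
    simp only [A.bracket_smulFn, map_add, ContMDiffSection.coe_add, Pi.add_apply, smulFn_apply,
      A.jacobi u v w] at h
    have h1 : lieDer (A.tan (A.bracket u v)) f x = df f x (A.anchor x (A.bracket u v x)) := rfl
    have h2 : lieDer (A.tan u) (lieDer (A.tan v) f) x
      = df (lieDer (A.tan v) f) x (A.anchor x (u x)) := rfl
    have h3 : lieDer (A.tan v) (lieDer (A.tan u) f) x
      = df (lieDer (A.tan u) f) x (A.anchor x (v x)) := rfl
    rw [h1, h2, h3] at h
    have h4 : (df f x (A.anchor x (A.bracket u v x))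
      - (df (lieDer (A.tan v) f) x (A.anchor x (u x))
        - df (lieDer (A.tan u) f) x (A.anchor x (v x)))) • w x = 0 := by
      rw [← sub_eq_zero] at h
      rw [← neg_eq_zero, ← h]
      module
    exact sub_eq_zero.1 ((smul_eq_zero.1 h4).resolve_right hp)
  · push Not at hE
    have h0 : ∀ p : E x, A.anchor x p = 0 := fun p ↦ by rw [hE p, map_zero]
    simp [h0]

end CourantAlgebroid

namespace ExactCourantAlgebroid

variable (A : ExactCourantAlgebroid V F E)

theorem pairing_eq_zero_of_anchor_eq_zero {x : M} {p q : E x} (hp : A.anchor x p = 0)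
    (hq : A.anchor x q = 0) : A.pairing x p q = 0 := by
  obtain ⟨ξ, hξ⟩ := (A.ker_anchor x p).1 hp
  simp [hξ, hq]

theorem pairing_congr_of_anchor_eq {x : M} {p q r : E x} (hp : A.anchor x p = 0)
    (h : A.anchor x q = A.anchor x r) : A.pairing x p q = A.pairing x p r := by
  obtain ⟨ξ, hξ⟩ := (A.ker_anchor x p).1 hp
  simp [hξ, h]

/-- Every vector of `ker π` extends to a smooth section of `ker π`. -/
theorem exists_ker_sec {x : M} {p : E x} (hp : A.anchor x p = 0) :
    ∃ r : Sec V F E, (∀ y, A.anchor y (r y) = 0) ∧ r x = p := by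
  by_cases h0 : p = 0
  · exact ⟨0, fun y ↦ by simp, by simp [h0]⟩
  obtain ⟨ξ, hξ⟩ := (A.ker_anchor x p).1 hp
  obtain ⟨q, hq⟩ : ∃ q, A.pairing x p q ≠ 0 := by
    by_contra! h
    exact h0 ((A.pairing_nondeg x).1 p h)
  obtain ⟨u, hu⟩ := exists_sec_eq V F x p
  -- The rescaling makes `⟨u, v⟩ = 1` at `x`.
  obtain ⟨v, hv⟩ := exists_sec_eq V F x ((A.pairing x p q)⁻¹ • q)
  obtain ⟨f, -, hf⟩ := exists_fun_mvfderiv_eq x (LinearMap.toContinuousLinearMap ξ)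
  -- The failure of the symmetrised bracket to be linear over functions is the section dual to
  -- `⟨u,v⟩ df`. It lies in `ker π` everywhere and is smooth because brackets are.
  let r : Sec V F E := A.bracket (smulFn f u) v + A.bracket v (smulFn f u)
    - smulFn f (A.bracket u v + A.bracket v u)
  have hr : ∀ (y : M) (w : E y),
      A.pairing y (r y) w = A.pairing y (u y) (v y) * df f y (A.anchor y w) := by
    intro y w
    have h1 := A.pairing_bracket_smulFn_left u v f y w
    have h2 : lieDer (A.tan v) f y = df f y (A.anchor y (v y)) := rfl
    simp only [r, A.bracket_smulFn, ContMDiffSection.coe_add, ContMDiffSection.coe_sub,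
      Pi.add_apply, Pi.sub_apply, smulFn_apply, map_add, map_sub, map_smul, LinearMap.add_apply,
      LinearMap.sub_apply, LinearMap.smul_apply, smul_eq_mul, h1, h2]
    ring
  refine ⟨r, fun y ↦ ?_, ?_⟩
  · rw [A.ker_anchor]
    exact ⟨A.pairing y (u y) (v y) • (df f y).toLinearMap, fun q ↦ by rw [hr]; rfl⟩
  · refine A.eq_of_pairing_eq fun w ↦ ?_
    rw [hr, hu, hv, map_smul, smul_eq_mul, inv_mul_cancel₀ hq, one_mul, hξ]
    exact hf _

end ExactCourantAlgebroid



/-! ### Eigenbundles, the induced metric and split sections -/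

namespace GenMetric

section general

variable {A : CourantAlgebroid V F E} (G : GenMetric A)

theorem mem_eig_iff {ε : ℤˣ} {x : M} {p : E x} : p ∈ G.eig ε x ↔ G.endo x p = sgn ε • p :=
  End.mem_eigenspace_iff

theorem pairing_eq_zero_of_mem_eig {ε : ℤˣ} {x : M} {p q : E x} (hp : p ∈ G.eig ε x)
    (hq : q ∈ G.eig (-ε) x) : A.pairing x p q = 0 := by
  rw [G.mem_eig_iff] at hp hq
  have h := G.symm x p q
  rw [hp, hq, sgn_neg] at h
  simp only [map_smul, LinearMap.smul_apply, smul_eq_mul] at h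
  have := sgn_mul_self ε
  linear_combination (sgn ε / 2) * h - A.pairing x p q * this

/-- The projection of a vector to `E_±`. -/
def projAt (ε : ℤˣ) (x : M) : E x →ₗ[ℝ] E x :=
  (1 / 2 : ℝ) • (LinearMap.id + sgn ε • G.endo x)

theorem projAt_apply (ε : ℤˣ) (x : M) (p : E x) :
    G.projAt ε x p = (1 / 2 : ℝ) • (p + sgn ε • G.endo x p) := rfl

theorem proj_apply (ε : ℤˣ) (u : Sec V F E) (x : M) : G.proj ε u x = G.projAt ε x (u x) := rfl

theorem projAt_mem (ε : ℤˣ) (x : M) (p : E x) : G.projAt ε x p ∈ G.eig ε x := by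
  rw [G.mem_eig_iff, projAt_apply]
  simp only [map_smul, map_add, G.involutive, smul_add, smul_smul]
  have h : sgn ε * (1 / 2 * sgn ε) = 1 / 2 := by
    have := sgn_mul_self ε; linear_combination this / 2
  rw [h, mul_comm (sgn ε), add_comm]

theorem projAt_of_mem {ε : ℤˣ} {x : M} {p : E x} (hp : p ∈ G.eig ε x) : G.projAt ε x p = p := by
  rw [G.mem_eig_iff] at hp
  rw [projAt_apply, hp, smul_smul, sgn_mul_self]
  module

theorem projAt_neg_of_mem {ε : ℤˣ} {x : M} {p : E x} (hp : p ∈ G.eig ε x) :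
    G.projAt (-ε) x p = 0 := by
  rw [G.mem_eig_iff] at hp
  rw [projAt_apply, hp, smul_smul, sgn_neg, neg_mul, sgn_mul_self]
  module

theorem projAt_add_projAt_neg (ε : ℤˣ) (x : M) (p : E x) :
    G.projAt ε x p + G.projAt (-ε) x p = p := by
  rw [projAt_apply, projAt_apply, sgn_neg]
  module

theorem pairing_projAt_left {ε : ℤˣ} {x : M} (p : E x) {q : E x} (hq : q ∈ G.eig ε x) :
    A.pairing x (G.projAt ε x p) q = A.pairing x p q := by
  conv_rhs => rw [← G.projAt_add_projAt_neg ε x p]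
  rw [map_add, LinearMap.add_apply, A.pairing_symm x (G.projAt (-ε) x p),
    G.pairing_eq_zero_of_mem_eig hq (G.projAt_mem (-ε) x p), add_zero]

theorem isSec_proj (ε : ℤˣ) (u : Sec V F E) : G.IsSec ε (G.proj ε u) :=
  fun x ↦ G.projAt_mem ε x (u x)

/-- Every vector of `E_±` extends to a section of `E_±`. -/
theorem exists_isSec_eq {ε : ℤˣ} {x : M} {p : E x} (hp : p ∈ G.eig ε x) :
    ∃ u : Sec V F E, G.IsSec ε u ∧ u x = p := by
  obtain ⟨u, hu⟩ := exists_sec_eq V F x p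
  exact ⟨G.proj ε u, G.isSec_proj ε u, by rw [proj_apply, hu, G.projAt_of_mem hp]⟩

theorem pair_eq_zero_of_isSec {ε : ℤˣ} {u v : Sec V F E} (hu : G.IsSec ε u)
    (hv : G.IsSec (-ε) v) : ∀ y, A.pair u v y = 0 :=
  fun y ↦ G.pairing_eq_zero_of_mem_eig (hu y) (hv y)

/-- A section of the isotropic complement `𝒢^end (ker π)` of `ker π`. -/
def IsSplit (s : Sec V F E) : Prop := ∀ y, A.anchor y (G.endo y (s y)) = 0

/-- The section `s ± 𝒢^end s`. -/
def lft (ε : ℤˣ) (s : Sec V F E) : Sec V F E := s + sgn ε • G.endoSec s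

theorem lft_apply (ε : ℤˣ) (s : Sec V F E) (x : M) :
    G.lft ε s x = s x + sgn ε • G.endo x (s x) := rfl

theorem isSec_lft (ε : ℤˣ) (s : Sec V F E) : G.IsSec ε (G.lft ε s) := by
  intro x
  have := G.projAt_mem ε x ((2 : ℝ) • s x)
  rw [projAt_apply, map_smul] at this
  convert this using 1
  rw [lft_apply]
  module

theorem anchor_lft {s : Sec V F E} (hs : G.IsSplit s) (ε : ℤˣ) (x : M) :
    A.anchor x (G.lft ε s x) = A.anchor x (s x) := by
  rw [lft_apply, map_add, map_smul, hs x, smul_zero, add_zero]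

theorem IsSplit.add {s t : Sec V F E} (hs : G.IsSplit s) (ht : G.IsSplit t) :
    G.IsSplit (s + t) := fun y ↦ by
  simp [hs y, ht y]

theorem IsSplit.smulFn (f : C^∞⟮𝓘(ℝ, V), M; ℝ⟯) {s : Sec V F E} (hs : G.IsSplit s) :
    G.IsSplit (smulFn f s) := fun y ↦ by
  simp [hs y]

end general

variable {A : ExactCourantAlgebroid V F E} (G : GenMetric A.toCourantAlgebroid)

theorem eq_of_mem_eig {ε : ℤˣ} {x : M} {p q : E x} (hp : p ∈ G.eig ε x) (hq : q ∈ G.eig ε x)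
    (h : A.anchor x p = A.anchor x q) : p = q :=
  sub_eq_zero.1 (G.eq_zero_of_mem_eig ε x (Submodule.sub_mem _ hp hq) (by rw [map_sub, h, sub_self]))

theorem lift_anchor {ε : ℤˣ} {x : M} {p : E x} (hp : p ∈ G.eig ε x) :
    G.lift ε x (A.anchor x p) = p :=
  G.eq_of_mem_eig (G.lift_mem ε x _) hp (G.anchor_lift ε x _)

/-- For the negative sign: the two lifts of a tangent vector differ by an element of the isotropic
subspace `ker π`, and the cross terms vanish because `E_+` and `E_-` are orthogonal. -/
theorem pairing_lift (ε : ℤˣ) (x : M) (X Y : TangentSpace 𝓘(ℝ, V) x) :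
    A.pairing x (G.lift ε x X) (G.lift ε x Y) = sgn ε * G.metric x X Y := by
  rcases Int.units_eq_one_or ε with rfl | rfl
  · simp [metric, sgn]
  · have h := A.pairing_eq_zero_of_anchor_eq_zero
      (p := G.lift 1 x X - G.lift (-1) x X) (q := G.lift 1 x Y - G.lift (-1) x Y)
      (by simp [anchor_lift]) (by simp [anchor_lift])
    have h1 := G.pairing_eq_zero_of_mem_eig (G.lift_mem 1 x X) (G.lift_mem (-1) x Y)
    have h2 := G.pairing_eq_zero_of_mem_eig (G.lift_mem 1 x Y) (G.lift_mem (-1) x X)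
    rw [A.pairing_symm] at h2
    simp only [map_sub, LinearMap.sub_apply, h1, h2] at h
    simp only [sgn, metric, LinearMap.compl₁₂_apply, Units.val_neg, Units.val_one, Int.cast_neg,
      Int.cast_one]
    linarith

theorem metric_symm (x : M) (X Y : TangentSpace 𝓘(ℝ, V) x) :
    G.metric x X Y = G.metric x Y X := A.pairing_symm x _ _

theorem pairing_eq_metric {ε : ℤˣ} {x : M} {p q : E x} (hp : p ∈ G.eig ε x)
    (hq : q ∈ G.eig ε x) :
    A.pairing x p q = sgn ε * G.metric x (A.anchor x p) (A.anchor x q) := by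
  rw [← pairing_lift, G.lift_anchor hp, G.lift_anchor hq]

theorem metric_eq_pairing {ε : ℤˣ} {x : M} {p q : E x} (hp : p ∈ G.eig ε x)
    (hq : q ∈ G.eig ε x) :
    G.metric x (A.anchor x p) (A.anchor x q) = sgn ε * A.pairing x p q := by
  rw [G.pairing_eq_metric hp hq, ← mul_assoc, sgn_mul_self, one_mul]

/-- Every tangent vector is the anchor of a split section. -/
theorem exists_split_anchor_eq (x : M) (X : TangentSpace 𝓘(ℝ, V) x) :
    ∃ s : Sec V F E, G.IsSplit s ∧ A.anchor x (s x) = X := by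
  have h1 := G.mem_eig_iff.1 (G.lift_mem 1 x X)
  have h2 := G.mem_eig_iff.1 (G.lift_mem (-1) x X)
  simp only [sgn_neg, sgn, Units.val_one, Int.cast_one, one_smul, neg_smul] at h1 h2
  -- `𝒢^end` turns half the difference of the two lifts into half their sum, which still lies over
  -- `X`.
  obtain ⟨r, hr, hrx⟩ := A.exists_ker_sec (x := x)
    (p := (1 / 2 : ℝ) • (G.lift 1 x X - G.lift (-1) x X)) (by simp [anchor_lift])
  refine ⟨G.endoSec r, fun y ↦ ?_, ?_⟩
  · change A.anchor y (G.endo y (G.endo y (r y))) = 0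
    rw [G.involutive, hr]
  · change A.anchor x (G.endo x (r x)) = X
    rw [hrx, map_smul, map_sub, h1, h2, map_smul, map_sub, map_neg, anchor_lift, anchor_lift]
    module

/-- Every vector of `E_±` is the value of the lift of a split section. -/
theorem exists_split_lft_eq {ε : ℤˣ} {x : M} {p : E x} (hp : p ∈ G.eig ε x) :
    ∃ s : Sec V F E, G.IsSplit s ∧ G.lft ε s x = p := by
  obtain ⟨s, hs, hsx⟩ := G.exists_split_anchor_eq x (A.anchor x p)
  exact ⟨s, hs, G.eq_of_mem_eig (G.isSec_lft ε s x) hp (by rw [anchor_lft G hs, hsx])⟩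

theorem lft_eq_lift {s : Sec V F E} (hs : G.IsSplit s) (ε : ℤˣ) (x : M) :
    G.lft ε s x = G.lift ε x (A.anchor x (s x)) := by
  rw [← anchor_lft G hs ε, G.lift_anchor (G.isSec_lft ε s x)]

/-! ### The three-form -/

theorem splitSec_spec {x : M} (X : TangentSpace 𝓘(ℝ, V) x) :
    G.IsSplit (G.splitSec X) ∧ A.anchor x (G.splitSec X x) = X :=
  Classical.epsilon_spec (G.exists_split_anchor_eq x X)

theorem isSplit_pairing {s t : Sec V F E} (hs : G.IsSplit s) (ht : G.IsSplit t) (y : M) :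
    A.pairing y (s y) (t y) = 0 := by
  have := A.pairing_eq_zero_of_anchor_eq_zero (hs y) (ht y)
  rwa [G.symm, G.involutive] at this

/-- The anchor fixes both lifts `s ± 𝒢^end s`, hence their sum `2s`. -/
theorem isSplit_eq {s t : Sec V F E} (hs : G.IsSplit s) (ht : G.IsSplit t) {x : M}
    (h : A.anchor x (s x) = A.anchor x (t x)) : s x = t x := by
  have h1 := G.lft_eq_lift hs 1 x
  have h2 := G.lft_eq_lift hs (-1) x
  have h3 := G.lft_eq_lift ht 1 x
  have h4 := G.lft_eq_lift ht (-1) x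
  rw [h, ← h3] at h1
  rw [h, ← h4] at h2
  simp only [lft_apply, sgn_neg] at h1 h2
  have h5 : (2 : ℝ) • s x = (2 : ℝ) • t x := by
    calc (2 : ℝ) • s x = (s x + sgn 1 • G.endo x (s x)) + (s x + -sgn 1 • G.endo x (s x)) := by
          module
      _ = (2 : ℝ) • t x := by rw [h1, h2]; module
  exact smul_right_injective (E x) two_ne_zero h5

theorem pairing_bracket_swap_left {s t : Sec V F E} (hs : G.IsSplit s) (ht : G.IsSplit t)
    (x : M) (w : E x) :
    A.pairing x (A.bracket s t x) w = -A.pairing x (A.bracket t s x) w := by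
  obtain ⟨w, rfl⟩ := exists_sec_eq V F x w
  have h := A.pairing_bracket_add s t w x
  rw [df_eq_zero_of_forall_eq (fun y ↦ G.isSplit_pairing hs ht y)] at h
  linarith

theorem pairing_bracket_swap_right {s t r : Sec V F E} (ht : G.IsSplit t) (hr : G.IsSplit r)
    (x : M) :
    A.pairing x (A.bracket s t x) (r x) = -A.pairing x (A.bracket s r x) (t x) := by
  have h := A.df_pair s t r x
  rw [df_eq_zero_of_forall_eq (fun y ↦ G.isSplit_pairing ht hr y), A.pairing_symm x (t x)] at h
  linarith

/-- The expression `⟨[s,t], r⟩` depends on `r` only through its value at `x`. Split sections pair to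
zero, so no derivative terms obstruct its skew-symmetry in adjacent slots. Each argument can thus be
moved to the last slot, exchanged there for another section with the same anchor at `x`, and moved
back. -/
theorem threeForm_eq {s t r : Sec V F E} (hs : G.IsSplit s) (ht : G.IsSplit t) (hr : G.IsSplit r)
    (x : M) :
    G.threeForm x (A.anchor x (s x)) (A.anchor x (t x)) (A.anchor x (r x))
      = 2 * A.pairing x (A.bracket s t x) (r x) := by
  have congr3 : ∀ {a b c c' : Sec V F E}, G.IsSplit c → G.IsSplit c' →
      A.anchor x (c x) = A.anchor x (c' x) →
      A.pairing x (A.bracket a b x) (c x) = A.pairing x (A.bracket a b x) (c' x) := by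
    intro a b c c' hc hc' h
    rw [G.isSplit_eq hc hc' h]
  obtain ⟨hs', hsx⟩ := G.splitSec_spec (A.anchor x (s x))
  obtain ⟨ht', htx⟩ := G.splitSec_spec (A.anchor x (t x))
  obtain ⟨hr', hrx⟩ := G.splitSec_spec (A.anchor x (r x))
  rw [threeForm]
  congr 1
  linear_combination congr3 (a := G.splitSec (A.anchor x (s x)))
      (b := G.splitSec (A.anchor x (t x))) hr' hr hrx
    + G.pairing_bracket_swap_right (s := G.splitSec (A.anchor x (s x))) ht' hr x
    - congr3 (a := G.splitSec (A.anchor x (s x))) (b := r) ht' ht htx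
    - G.pairing_bracket_swap_left hs' hr x (t x)
    + G.pairing_bracket_swap_right (s := r) hs' ht x
    - congr3 (a := r) (b := t) hs' hs hsx
    - G.pairing_bracket_swap_right (s := r) hs ht x
    + G.pairing_bracket_swap_left hs hr x (t x)
    - G.pairing_bracket_swap_right (s := s) ht hr x

theorem threeForm_swap_left (x : M) (X Y Z : TangentSpace 𝓘(ℝ, V) x) :
    G.threeForm x X Y Z = -G.threeForm x Y X Z := by
  obtain ⟨s, hs, rfl⟩ := G.exists_split_anchor_eq x X
  obtain ⟨t, ht, rfl⟩ := G.exists_split_anchor_eq x Y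
  obtain ⟨r, hr, rfl⟩ := G.exists_split_anchor_eq x Z
  rw [G.threeForm_eq hs ht hr, G.threeForm_eq ht hs hr, G.pairing_bracket_swap_left hs ht]
  ring

theorem threeForm_swap_right (x : M) (X Y Z : TangentSpace 𝓘(ℝ, V) x) :
    G.threeForm x X Y Z = -G.threeForm x X Z Y := by
  obtain ⟨s, hs, rfl⟩ := G.exists_split_anchor_eq x X
  obtain ⟨t, ht, rfl⟩ := G.exists_split_anchor_eq x Y
  obtain ⟨r, hr, rfl⟩ := G.exists_split_anchor_eq x Z
  rw [G.threeForm_eq hs ht hr, G.threeForm_eq hs hr ht, G.pairing_bracket_swap_right ht hr]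
  ring

theorem threeForm_self_left (x : M) (X Y : TangentSpace 𝓘(ℝ, V) x) : G.threeForm x X X Y = 0 := by
  linarith [G.threeForm_swap_left x X X Y]

theorem threeForm_self_right (x : M) (X Y : TangentSpace 𝓘(ℝ, V) x) :
    G.threeForm x X Y Y = 0 := by
  linarith [G.threeForm_swap_right x X Y Y]

theorem threeForm_rotate (x : M) (X Y Z : TangentSpace 𝓘(ℝ, V) x) :
    G.threeForm x X Y Z = G.threeForm x Y Z X := by
  rw [threeForm_swap_left, threeForm_swap_right, neg_neg]

/-- The linear form `H(X, Y, ·)`. -/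
def threeFormRight (x : M) (X Y : TangentSpace 𝓘(ℝ, V) x) : TangentSpace 𝓘(ℝ, V) x →ₗ[ℝ] ℝ where
  toFun Z := G.threeForm x X Y Z
  map_add' Z W := by
    obtain ⟨s, hs, rfl⟩ := G.exists_split_anchor_eq x X
    obtain ⟨t, ht, rfl⟩ := G.exists_split_anchor_eq x Y
    obtain ⟨r, hr, rfl⟩ := G.exists_split_anchor_eq x Z
    obtain ⟨q, hq, rfl⟩ := G.exists_split_anchor_eq x W
    have h := G.threeForm_eq hs ht (hr.add G hq) x
    rw [G.threeForm_eq hs ht hr, G.threeForm_eq hs ht hq, ← map_add]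
    rw [ContMDiffSection.coe_add, Pi.add_apply] at h
    rw [h, map_add]
    ring
  map_smul' c Z := by
    obtain ⟨s, hs, rfl⟩ := G.exists_split_anchor_eq x X
    obtain ⟨t, ht, rfl⟩ := G.exists_split_anchor_eq x Y
    obtain ⟨r, hr, rfl⟩ := G.exists_split_anchor_eq x Z
    have h := G.threeForm_eq hs ht (hr.smulFn G (ContMDiffMap.const c)) x
    rw [smulFn_apply] at h
    rw [G.threeForm_eq hs ht hr, ← map_smul]
    change G.threeForm x _ _ (A.anchor x (c • r x)) = c • _
    rw [show c • r x = (ContMDiffMap.const c : C^∞⟮𝓘(ℝ, V), M; ℝ⟯) x • r x from rfl, h, map_smul]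
    simp only [smul_eq_mul]
    change _ * (c * _) = _
    ring

theorem threeFormRight_apply (x : M) (X Y Z : TangentSpace 𝓘(ℝ, V) x) :
    G.threeFormRight x X Y Z = G.threeForm x X Y Z := rfl

end GenMetric



/-! ### Brackets of lifted sections in terms of `∇` and `H` -/

namespace CourantAlgebroid

variable (A : CourantAlgebroid V F E)

theorem anchor_bracket_eq_zero_left {u : Sec V F E} (hu : ∀ y, A.anchor y (u y) = 0)
    (v : Sec V F E) (x : M) : A.anchor x (A.bracket u v x) = 0 := by
  rw [A.anchor_bracket, show (fun y ↦ A.anchor y (u y)) = 0 from funext hu,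
    VectorField.mlieBracket_zero_left]
  rfl

theorem anchor_bracket_eq_zero_right {v : Sec V F E} (hv : ∀ y, A.anchor y (v y) = 0)
    (u : Sec V F E) (x : M) : A.anchor x (A.bracket u v x) = 0 := by
  rw [A.anchor_bracket, show (fun y ↦ A.anchor y (v y)) = 0 from funext hv,
    VectorField.mlieBracket_zero_right]
  rfl

end CourantAlgebroid

namespace GenMetric

section general

variable {A : CourantAlgebroid V F E} (G : GenMetric A)

theorem pairing_projAt_right {ε : ℤˣ} {x : M} {p : E x} (hp : p ∈ G.eig ε x) (q : E x) :
    A.pairing x p (G.projAt ε x q) = A.pairing x p q := by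
  rw [A.pairing_symm, G.pairing_projAt_left _ hp, A.pairing_symm]

theorem mem_eig_of_pairing_eq_zero {ε : ℤˣ} {x : M} {p : E x}
    (h : ∀ w ∈ G.eig (-ε) x, A.pairing x p w = 0) : p ∈ G.eig ε x := by
  have h0 : G.projAt (-ε) x p = 0 := by
    refine (A.pairing_nondeg x).1 _ fun w ↦ ?_
    rw [← G.pairing_projAt_right (G.projAt_mem _ _ _), G.pairing_projAt_left _ (G.projAt_mem _ _ _),
      h _ (G.projAt_mem _ _ _)]
  rw [← G.projAt_add_projAt_neg ε x p, h0, add_zero]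
  exact G.projAt_mem _ _ _

theorem eq_or_eq_neg (δ ε : ℤˣ) : δ = ε ∨ δ = -ε := by
  rcases Int.units_eq_one_or ε with rfl | rfl <;>
  rcases Int.units_eq_one_or δ with rfl | rfl <;> simp

/-- The symmetric part of the bracket is the differential of `⟨u,v⟩`, which vanishes identically on
sections of opposite type. -/
theorem pairing_bracket_swap_of_isSec {ε : ℤˣ} {u v : Sec V F E} (hu : G.IsSec (-ε) u)
    (hv : G.IsSec ε v) (x : M) (w : E x) :
    A.pairing x (A.bracket u v x) w = -A.pairing x (A.bracket v u x) w := by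
  obtain ⟨w, rfl⟩ := exists_sec_eq V F x w
  have h := A.pairing_bracket_add v u w x
  rw [df_eq_zero_of_forall_eq (G.pair_eq_zero_of_isSec hv hu)] at h
  linarith

theorem pairing_bracket_of_isSec {ε : ℤˣ} {v w : Sec V F E} (u : Sec V F E)
    (hv : G.IsSec ε v) (hw : G.IsSec (-ε) w) (x : M) :
    A.pairing x (A.bracket u v x) (w x) = -A.pairing x (v x) (A.bracket u w x) := by
  have h := A.df_pair u v w x
  rw [df_eq_zero_of_forall_eq (G.pair_eq_zero_of_isSec hv hw)] at h
  linarith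

end general

variable {A : ExactCourantAlgebroid V F E} (G : GenMetric A.toCourantAlgebroid)
  {cov : CovariantDerivative 𝓘(ℝ, V) V (TangentSpace 𝓘(ℝ, V) : M → Type _)}

/-- On split sections `𝒢^end` is the map `X ↦ gX`; the factor `1/2` is the convention `⟨X+ξ, X+ξ⟩ =
ξ(X)`. This lets `g` and its derivatives be read off from pairings of smooth sections. -/
theorem pairing_endo_of_isSplit {s : Sec V F E} (hs : G.IsSplit s) (x : M) (q : E x) :
    A.pairing x (G.endo x (s x)) q = (1 / 2) * G.metric x (A.anchor x (s x)) (A.anchor x q) := by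
  obtain ⟨t, ht, htx⟩ := G.exists_split_anchor_eq x (A.anchor x q)
  rw [A.pairing_congr_of_anchor_eq (hs x) htx.symm, ← htx]
  have h := G.pairing_eq_metric (G.isSec_lft 1 s x) (G.isSec_lft 1 t x)
  rw [G.anchor_lft hs, G.anchor_lft ht] at h
  have h1 := G.isSplit_pairing hs ht x
  have h2 := A.pairing_eq_zero_of_anchor_eq_zero (hs x) (ht x)
  have h3 := G.symm x (s x) (t x)
  simp only [lft_apply, sgn, Units.val_one, Int.cast_one, one_smul, map_add,
    LinearMap.add_apply, h1, h2, ← h3] at h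
  linarith

/-- The Levi-Civita connection on anchored fields is torsion-free. -/
theorem IsLeviCivita.torsion {G : GenMetric A.toCourantAlgebroid} (h : G.IsLeviCivita cov)
    (u v : Sec V F E) (x : M) :
    A.anchor x (A.bracket u v x)
      = cov (A.anchorField v) x (A.anchor x (u x)) - cov (A.anchorField u) x (A.anchor x (v x)) := by
  rw [A.anchor_bracket]
  exact (h.torsion_free _ _ x (A.tan u).mdifferentiableAt (A.tan v).mdifferentiableAt).symm

theorem IsLeviCivita.df_eq {G : GenMetric A.toCourantAlgebroid} (h : G.IsLeviCivita cov)
    {f : C^∞⟮𝓘(ℝ, V), M; ℝ⟯} {c : ℝ} (hc : c ≠ 0)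
    {Y Z : Sec V V (TangentSpace 𝓘(ℝ, V) : M → Type _)}
    (hf : ∀ y, f y = c * G.metric y (Y y) (Z y)) (x : M) (X : TangentSpace 𝓘(ℝ, V) x) :
    df f x X = c * (G.metric x (cov Y x X) (Z x) + G.metric x (Y x) (cov Z x X)) := by
  rw [← h.metric Y Z x X Y.mdifferentiableAt Z.mdifferentiableAt]
  have h1 := df_const_smul c⁻¹ f x X
  have h2 : (c⁻¹ • f : C^∞⟮𝓘(ℝ, V), M; ℝ⟯) = fun y ↦ G.metric y (Y y) (Z y) := by
    funext y
    change c⁻¹ * f y = _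
    rw [hf, ← mul_assoc, inv_mul_cancel₀ hc, one_mul]
  rw [← h2]
  change _ = c * df _ x X
  rw [h1, ← mul_assoc, mul_inv_cancel₀ hc, one_mul]

theorem IsLeviCivita.df_pair {G : GenMetric A.toCourantAlgebroid} (h : G.IsLeviCivita cov)
    {ε : ℤˣ} {v w : Sec V F E} (hv : G.IsSec ε v) (hw : G.IsSec ε w) (x : M)
    (X : TangentSpace 𝓘(ℝ, V) x) :
    df (A.pair v w) x X = sgn ε * (G.metric x (cov (A.anchorField v) x X) (A.anchor x (w x))
      + G.metric x (A.anchor x (v x)) (cov (A.anchorField w) x X)) :=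
  h.df_eq (Y := A.tan v) (Z := A.tan w)
    (by rcases Int.units_eq_one_or ε with rfl | rfl <;> simp [sgn])
    (fun y ↦ G.pairing_eq_metric (hv y) (hw y)) x X

theorem IsLeviCivita.df_pair_endo {G : GenMetric A.toCourantAlgebroid} (h : G.IsLeviCivita cov)
    {s : Sec V F E} (hs : G.IsSplit s) (w : Sec V F E) (x : M) (X : TangentSpace 𝓘(ℝ, V) x) :
    df (A.pair (G.endoSec s) w) x X
      = (1 / 2) * (G.metric x (cov (A.anchorField s) x X) (A.anchor x (w x))
        + G.metric x (A.anchor x (s x)) (cov (A.anchorField w) x X)) :=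
  h.df_eq (Y := A.tan s) (Z := A.tan w) (by norm_num)
    (fun y ↦ G.pairing_endo_of_isSplit hs y (w y)) x X

/-- A one-form `ξ` acts by `[ξ, v] = -ι_v dξ`. For `ξ = gS` the exterior derivative is the skew part
of `∇S`, as `∇` is metric and torsion-free. -/
theorem pairing_bracket_endo_left {G : GenMetric A.toCourantAlgebroid} (h : G.IsLeviCivita cov)
    {s : Sec V F E} (hs : G.IsSplit s) (v w : Sec V F E) (x : M) :
    A.pairing x (A.bracket (G.endoSec s) v x) (w x)
      = (1 / 2) * (G.metric x (cov (A.anchorField s) x (A.anchor x (w x))) (A.anchor x (v x))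
        - G.metric x (cov (A.anchorField s) x (A.anchor x (v x))) (A.anchor x (w x))) := by
  have h1 := A.pairing_bracket_add (G.endoSec s) v w x
  have h2 := A.df_pair v (G.endoSec s) w x
  have h3 := G.pairing_endo_of_isSplit hs x (A.bracket v w x)
  rw [h.df_pair_endo hs] at h1 h2
  rw [h.torsion, map_sub] at h3
  change A.pairing x (G.endoSec s x) _ = _ at h3
  rw [h3] at h2
  linarith

/-- Here the bracket with a one-form is its Lie derivative along `π u`, rewritten through `∇`. -/
theorem pairing_bracket_endo_right {G : GenMetric A.toCourantAlgebroid} (h : G.IsLeviCivita cov)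
    {t : Sec V F E} (ht : G.IsSplit t) (u w : Sec V F E) (x : M) :
    A.pairing x (A.bracket u (G.endoSec t) x) (w x)
      = (1 / 2) * (G.metric x (cov (A.anchorField t) x (A.anchor x (u x))) (A.anchor x (w x))
        + G.metric x (A.anchor x (t x)) (cov (A.anchorField u) x (A.anchor x (w x)))) := by
  have h2 := A.df_pair u (G.endoSec t) w x
  have h3 := G.pairing_endo_of_isSplit ht x (A.bracket u w x)
  rw [h.df_pair_endo ht] at h2
  rw [h.torsion, map_sub] at h3
  change A.pairing x (G.endoSec t x) _ = _ at h3
  rw [h3] at h2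
  linarith

theorem anchorField_lft {s : Sec V F E} (hs : G.IsSplit s) (ε : ℤˣ) :
    A.anchorField (G.lft ε s) = A.anchorField s :=
  funext fun y ↦ G.anchor_lft hs ε y

/-- Each lift is a split section plus or minus a one-form. Of the eight resulting terms, those with
at least two one-forms vanish. The term with none is `H/2`, and the three with exactly one add up to
the Levi-Civita term. -/
theorem pairing_bracket_lft {G : GenMetric A.toCourantAlgebroid} (h : G.IsLeviCivita cov)
    (ε : ℤˣ) {s t r : Sec V F E} (hs : G.IsSplit s) (ht : G.IsSplit t) (hr : G.IsSplit r) (x : M) :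
    A.pairing x (A.bracket (G.lft (-ε) s) (G.lft ε t) x) (G.lft ε r x)
      = sgn ε * G.metric x (cov (A.anchorField t) x (A.anchor x (s x))) (A.anchor x (r x))
        + (1 / 2) * G.threeForm x (A.anchor x (s x)) (A.anchor x (t x)) (A.anchor x (r x)) := by
  have hs' : ∀ y, A.anchor y (G.endoSec s y) = 0 := hs
  have ht' : ∀ y, A.anchor y (G.endoSec t y) = 0 := ht
  have hr' : ∀ y, A.anchor y (G.endoSec r y) = 0 := hr
  have e1 := A.pairing_eq_zero_of_anchor_eq_zero
    (A.anchor_bracket_eq_zero_left hs' t x) (hr' x)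
  have e2 := A.pairing_eq_zero_of_anchor_eq_zero
    (A.anchor_bracket_eq_zero_right ht' s x) (hr' x)
  have e3 : ∀ q : Sec V F E,
      A.pairing x (A.bracket (G.endoSec s) (G.endoSec t) x) (q x) = 0 := by
    intro q
    have h1 := A.df_pair (G.endoSec s) (G.endoSec t) q x
    rw [hs' x, map_zero, A.pairing_eq_zero_of_anchor_eq_zero (ht' x)
      (A.anchor_bracket_eq_zero_left hs' q x)] at h1
    linarith
  have e4 := pairing_bracket_endo_left h hs t r x
  have e5 := pairing_bracket_endo_right h ht s r x
  have e6 := G.pairing_endo_of_isSplit hr x (A.bracket s t x)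
  rw [h.torsion, map_sub] at e6
  change A.pairing x (G.endoSec r x) _ = _ at e6
  rw [A.pairing_symm] at e6
  have e7 := G.threeForm_eq hs ht hr x
  rw [e7]
  have hε := sgn_mul_self ε
  have m1 := G.metric_symm x (A.anchor x (r x)) (cov (A.anchorField t) x (A.anchor x (s x)))
  have m2 := G.metric_symm x (A.anchor x (r x)) (cov (A.anchorField s) x (A.anchor x (t x)))
  have m3 := G.metric_symm x (A.anchor x (t x)) (cov (A.anchorField s) x (A.anchor x (r x)))
  rw [m1, m2] at e6
  rw [m3] at e5
  simp only [lft, map_add, map_smul, LinearMap.add_apply, LinearMap.smul_apply,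
    ContMDiffSection.coe_add, ContMDiffSection.coe_smul, Pi.add_apply, Pi.smul_apply, smul_eq_mul,
    sgn_neg, neg_smul, e1, e2, e3, e4, e5, e6, LinearMap.neg_apply, map_neg,
    ContMDiffSection.coe_neg, Pi.neg_apply]
  ring

/-- The Bismut connection: `⟨[u, v], w⟩ = ± g(∇_U V, W) + H(U, V, W) / 2` for `u ∈ Γ(E_∓)` and
`v, w ∈ Γ(E_±)`. -/
theorem pairing_bracket_eq {G : GenMetric A.toCourantAlgebroid} (h : G.IsLeviCivita cov)
    {ε : ℤˣ} {u v : Sec V F E} (hu : G.IsSec (-ε) u) (hv : G.IsSec ε v) {x : M} {w : E x}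
    (hw : w ∈ G.eig ε x) :
    A.pairing x (A.bracket u v x) w
      = sgn ε * G.metric x (cov (A.anchorField v) x (A.anchor x (u x))) (A.anchor x w)
        + (1 / 2) * G.threeForm x (A.anchor x (u x)) (A.anchor x (v x)) (A.anchor x w) := by
  obtain ⟨s, hs, hsu⟩ := G.exists_split_lft_eq (hu x)
  obtain ⟨t, ht, htv⟩ := G.exists_split_lft_eq (hv x)
  obtain ⟨r, hr, rfl⟩ := G.exists_split_lft_eq hw
  -- The part of `⟨[u,v],w⟩` not accounted for by `∇` is skew in `v`, `w`, both connections being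
  -- metric; this moves `v` to the slot where only its value at `x` matters.
  have swap : ∀ {u v w : Sec V F E}, G.IsSec (-ε) u → G.IsSec ε v → G.IsSec ε w →
      A.pairing x (A.bracket u v x) (w x)
        - sgn ε * G.metric x (cov (A.anchorField v) x (A.anchor x (u x))) (A.anchor x (w x))
      = -(A.pairing x (A.bracket u w x) (v x)
        - sgn ε * G.metric x (cov (A.anchorField w) x (A.anchor x (u x))) (A.anchor x (v x))) := by
    intro u v w hu hv hw
    have h1 := A.df_pair u v w x
    rw [h.df_pair hv hw, A.pairing_symm x (v x), G.metric_symm x (A.anchor x (v x))] at h1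
    linarith
  have left : ∀ {u u' v w : Sec V F E}, G.IsSec (-ε) u → G.IsSec (-ε) u' → G.IsSec ε v →
      G.IsSec ε w → u x = u' x →
      A.pairing x (A.bracket u v x) (w x) = A.pairing x (A.bracket u' v x) (w x) := by
    -- Moving `u` out of the bracket shows that only its value at `x` counts.
    have key : ∀ {u v w : Sec V F E}, G.IsSec (-ε) u → G.IsSec ε v → G.IsSec ε w →
        A.pairing x (A.bracket u v x) (w x) = A.pairing x (u x) (A.bracket v w x) := by
      intro u v w hu hv hw
      have h1 := G.pairing_bracket_of_isSec v hu (by rwa [neg_neg]) x (w := w)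
      rw [G.pairing_bracket_swap_of_isSec hu hv, h1, neg_neg]
    intro u u' v w hu hu' hv hw huu
    rw [key hu hv hw, key hu' hv hw, huu]
  have hS := G.isSec_lft (-ε) s
  have hT := G.isSec_lft ε t
  have hR := G.isSec_lft ε r
  have h1 := swap hu hv hR
  rw [left hu hS hR hv hsu.symm, ← htv, ← hsu] at h1
  have h2 := pairing_bracket_lft h ε hs hr ht x
  rw [h2, anchorField_lft G hr, anchor_lft G hs, anchor_lft G ht, anchor_lft G hr] at h1
  rw [← hsu, ← htv, anchor_lft G hs, anchor_lft G ht, anchor_lft G hr]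
  have h3 := G.threeForm_swap_right x (A.anchor x (s x)) (A.anchor x (t x)) (A.anchor x (r x))
  linarith

/-! ### The connections `D^B` and `D⁰` -/

theorem IsGualtieriBismut.mem {G : GenMetric A.toCourantAlgebroid}
    {D : GenConnection A.toCourantAlgebroid} (hD : G.IsGualtieriBismut D) {ε : ℤˣ}
    {v : Sec V F E} (hv : G.IsSec ε v) (x : M) (p : E x) : D.toFun v x p ∈ G.eig ε x := by
  have h1 : ∀ δ, ∀ q ∈ G.eig δ x, D.toFun v x q ∈ G.eig ε x := by
    intro δ q hq
    obtain ⟨s, hs, rfl⟩ := G.exists_split_lft_eq hq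
    have h2 := hD ε (G.lft δ s) (G.lft (-ε) s) v (G.isSec_lft _ s)
      (by rw [anchorField_lft G hs, anchorField_lft G hs]) hv
    have h3 : D.toFun v x (G.lft δ s x) = D.cov (G.lft δ s) v x := rfl
    rw [h3, h2]
    exact G.isSec_proj _ _ x
  rw [← G.projAt_add_projAt_neg ε x p, map_add]
  exact Submodule.add_mem _ (h1 _ _ (G.projAt_mem _ _ _)) (h1 _ _ (G.projAt_mem _ _ _))

/-- `D^B_u` depends only on `π u`, so one formula serves for `p` of either type: the lift of a split
section to one eigenbundle is traded for its lift to `E_∓`. -/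
theorem IsGualtieriBismut.pairing {G : GenMetric A.toCourantAlgebroid} (h : G.IsLeviCivita cov)
    {D : GenConnection A.toCourantAlgebroid} (hD : G.IsGualtieriBismut D) {ε : ℤˣ}
    {v : Sec V F E} (hv : G.IsSec ε v) {x : M} (p : E x) {w : E x} (hw : w ∈ G.eig ε x) :
    A.pairing x (D.toFun v x p) w
      = sgn ε * G.metric x (cov (A.anchorField v) x (A.anchor x p)) (A.anchor x w)
        + (1 / 2) * G.threeForm x (A.anchor x p) (A.anchor x (v x)) (A.anchor x w) := by
  have h1 : ∀ δ, ∀ q ∈ G.eig δ x, A.pairing x (D.toFun v x q) w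
      = sgn ε * G.metric x (cov (A.anchorField v) x (A.anchor x q)) (A.anchor x w)
        + (1 / 2) * G.threeForm x (A.anchor x q) (A.anchor x (v x)) (A.anchor x w) := by
    intro δ q hq
    obtain ⟨s, hs, rfl⟩ := G.exists_split_lft_eq hq
    have h2 := hD ε (G.lft δ s) (G.lft (-ε) s) v (G.isSec_lft _ s)
      (by rw [anchorField_lft G hs, anchorField_lft G hs]) hv
    have h3 : D.toFun v x (G.lft δ s x) = D.cov (G.lft δ s) v x := rfl
    rw [h3, h2, proj_apply, G.pairing_projAt_left _ hw,
      pairing_bracket_eq h (G.isSec_lft (-ε) s) hv hw, anchor_lft G hs, anchor_lft G hs]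
  -- Rotating `H` exposes its linearity in the direction slot, so that the two eigencomponents of
  -- `p` may be added.
  have h3 : ∀ q, G.threeForm x q (A.anchor x (v x)) (A.anchor x w)
      = G.threeFormRight x (A.anchor x (v x)) (A.anchor x w) q := fun q ↦ G.threeForm_rotate _ _ _ _
  simp only [h3] at h1 ⊢
  rw [← G.projAt_add_projAt_neg ε x p]
  simp only [map_add, LinearMap.add_apply]
  rw [h1 _ _ (G.projAt_mem _ _ _), h1 _ _ (G.projAt_mem _ _ _)]
  ring

/-- With mixed arguments, the mixed derivative is by definition a component of the bracket in the
torsion, and the remaining derivatives vanish by orthogonality. The two lemmas that follow treat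
other placements of the signs. -/
theorem IsGualtieriBismut.torsion_eq_zero {G : GenMetric A.toCourantAlgebroid}
    {D : GenConnection A.toCourantAlgebroid} (hD : G.IsGualtieriBismut D) {ε : ℤˣ}
    {u v w : Sec V F E} (hu : G.IsSec (-ε) u) (hv : G.IsSec ε v) (hw : G.IsSec ε w) (x : M) :
    D.torsion u v w x = 0 := by
  have hv' : G.IsSec (-(-ε)) v := by rwa [neg_neg]
  have h1 := G.pairing_eq_zero_of_mem_eig (hw x) (hD.mem hu x (v x))
  have h2 := G.pairing_eq_zero_of_mem_eig (hv x) (hD.mem hu x (w x))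
  rw [A.pairing_symm] at h1 h2
  have h3 := hD ε u u v hu rfl hv
  rw [GenConnection.torsion]
  change A.pairing x (D.cov v u x) (w x) = 0 at h1
  change A.pairing x (D.cov w u x) (v x) = 0 at h2
  rw [map_sub, map_sub, LinearMap.sub_apply, LinearMap.sub_apply, h1, h2, h3, proj_apply,
    G.pairing_projAt_left _ (hw x)]
  ring

theorem IsGualtieriBismut.torsion_eq_zero_right {G : GenMetric A.toCourantAlgebroid}
    {D : GenConnection A.toCourantAlgebroid} (hD : G.IsGualtieriBismut D) {ε : ℤˣ}
    {u v w : Sec V F E} (hu : G.IsSec ε u) (hv : G.IsSec ε v) (hw : G.IsSec (-ε) w) (x : M) :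
    D.torsion u v w x = 0 := by
  have h1 : A.pairing x (D.cov u v x) (w x) = 0 :=
    G.pairing_eq_zero_of_mem_eig (hD.mem hv x (u x)) (hw x)
  have h2 : A.pairing x (D.cov v u x) (w x) = 0 :=
    G.pairing_eq_zero_of_mem_eig (hD.mem hu x (v x)) (hw x)
  have h3 := hD ε w w u hw rfl hu
  have h4 := G.pairing_bracket_of_isSec u hv hw x
  have h5 := G.pairing_bracket_swap_of_isSec hw hu x (v x)
  rw [A.pairing_symm] at h4
  rw [GenConnection.torsion, map_sub, map_sub, LinearMap.sub_apply, LinearMap.sub_apply, h1, h2, h3,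
    proj_apply, G.pairing_projAt_left _ (hv x), A.pairing_symm x (A.bracket u v x)]
  rw [A.pairing_symm x (v x)] at h4
  linarith

theorem IsGualtieriBismut.torsion_eq_zero_middle {G : GenMetric A.toCourantAlgebroid}
    {D : GenConnection A.toCourantAlgebroid} (hD : G.IsGualtieriBismut D) {ε : ℤˣ}
    {u v w : Sec V F E} (hu : G.IsSec (-ε) u) (hv : G.IsSec ε v) (hw : G.IsSec (-ε) w) (x : M) :
    D.torsion u v w x = 0 := by
  have hv' : G.IsSec (-(-ε)) v := by rwa [neg_neg]
  have h1 : A.pairing x (D.cov u v x) (w x) = 0 :=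
    G.pairing_eq_zero_of_mem_eig (hD.mem hv x (u x)) (hw x)
  have h2 : A.pairing x (D.cov w u x) (v x) = 0 :=
    G.pairing_eq_zero_of_mem_eig (hD.mem hu x (w x)) (hv' x)
  have h3 := hD (-ε) v v u hv' rfl hu
  have h4 := G.pairing_bracket_swap_of_isSec hu hv x (w x)
  rw [GenConnection.torsion, map_sub, map_sub, LinearMap.sub_apply, LinearMap.sub_apply, h1, h2, h3,
    proj_apply, G.pairing_projAt_left _ (hw x)]
  linarith

/-- The bracket of two sections of `E_±` is reduced to a mixed one by writing the lift as the
opposite lift plus a one-form. The `∇`-terms then cancel, and the contributions of `H` are `1/2 +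
1/2 - 1/2 + 1/2 = 1`. -/
theorem IsGualtieriBismut.torsion_lft {G : GenMetric A.toCourantAlgebroid}
    (h : G.IsLeviCivita cov)
    {D : GenConnection A.toCourantAlgebroid} (hD : G.IsGualtieriBismut D) {ε : ℤˣ}
    {s v w : Sec V F E} (hs : G.IsSplit s) (hv : G.IsSec ε v) (hw : G.IsSec ε w) (x : M) :
    D.torsion (G.lft ε s) v w x
      = G.threeForm x (A.anchor x (s x)) (A.anchor x (v x)) (A.anchor x (w x)) := by
  have hu := G.isSec_lft ε s
  have e1 : A.pairing x (D.cov (G.lft ε s) v x) (w x) = _ := hD.pairing h hv (G.lft ε s x) (hw x)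
  have e2 : A.pairing x (D.cov v (G.lft ε s) x) (w x) = _ := hD.pairing h hu (v x) (hw x)
  have e3 : A.pairing x (D.cov w (G.lft ε s) x) (v x) = _ := hD.pairing h hu (w x) (hv x)
  have e4 := pairing_bracket_eq h (G.isSec_lft (-ε) s) hv (hw x)
  have e5 := pairing_bracket_endo_left h hs v w x
  have e6 : G.lft ε s = G.lft (-ε) s + (2 * sgn ε) • G.endoSec s := by
    simp only [lft, sgn_neg]
    module
  have e7 : A.pairing x (A.bracket (G.lft ε s) v x) (w x)
      = A.pairing x (A.bracket (G.lft (-ε) s) v x) (w x)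
        + 2 * sgn ε * A.pairing x (A.bracket (G.endoSec s) v x) (w x) := by
    rw [e6]
    simp
  rw [GenConnection.torsion, map_sub, map_sub, LinearMap.sub_apply, LinearMap.sub_apply, e7, e1, e2,
    e3, e4, e5]
  simp only [anchorField_lft G hs, anchor_lft G hs]
  have h1 := G.threeForm_rotate x (A.anchor x (s x)) (A.anchor x (v x)) (A.anchor x (w x))
  have h2 := G.threeForm_rotate x (A.anchor x (w x)) (A.anchor x (s x)) (A.anchor x (v x))
  have h3 := G.threeForm_swap_left x (A.anchor x (v x)) (A.anchor x (s x)) (A.anchor x (w x))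
  linear_combination (-1 / 2) * h3 + (1 / 2) * h2

theorem IsCanonicalMetricDiv.mem {G : GenMetric A.toCourantAlgebroid}
    {D : GenConnection A.toCourantAlgebroid} (hD : G.IsCanonicalMetricDiv D) {ε : ℤˣ}
    {v : Sec V F E} (hv : G.IsSec ε v) (x : M) (p : E x) : D.toFun v x p ∈ G.eig ε x := by
  obtain ⟨D', hD', h⟩ := hD
  have key : ∀ δ, ∀ q ∈ G.eig δ x, ∀ w ∈ G.eig (-ε) x, A.pairing x (D.toFun v x q) w = 0 := by
    intro δ q hq w hw
    obtain ⟨u, hu, rfl⟩ := G.exists_isSec_eq hq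
    obtain ⟨w, hw0, rfl⟩ := G.exists_isSec_eq hw
    have h1 : A.pairing x (D.toFun v x (u x)) (w x) = _ := h u v w x
    have h2 : A.pairing x (D'.cov u v x) (w x) = 0 :=
      G.pairing_eq_zero_of_mem_eig (hD'.mem hv x (u x)) hw
    have h3 : D'.torsion u v w x = 0 := by
      rcases eq_or_eq_neg δ ε with rfl | rfl
      · exact hD'.torsion_eq_zero_right hu hv hw0 x
      · exact hD'.torsion_eq_zero_middle hu hv hw0 x
    rw [h1, h2, h3]; ring
  refine G.mem_eig_of_pairing_eq_zero fun w hw ↦ ?_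
  rw [← G.projAt_add_projAt_neg ε x p, map_add, map_add, LinearMap.add_apply,
    key _ _ (G.projAt_mem _ _ _) w hw, key _ _ (G.projAt_mem _ _ _) w hw, add_zero]

/-- The coefficient `1/6` is `1/2 - 1/3`; in the mixed case below there is no torsion to remove and
`1/2` persists. -/
theorem IsCanonicalMetricDiv.pairing_of_mem {G : GenMetric A.toCourantAlgebroid}
    (h : G.IsLeviCivita cov)
    {D : GenConnection A.toCourantAlgebroid} (hD : G.IsCanonicalMetricDiv D) {ε : ℤˣ}
    {v : Sec V F E} (hv : G.IsSec ε v) {x : M} {p w : E x} (hp : p ∈ G.eig ε x)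
    (hw : w ∈ G.eig ε x) :
    A.pairing x (D.toFun v x p) w
      = sgn ε * G.metric x (cov (A.anchorField v) x (A.anchor x p)) (A.anchor x w)
        + (1 / 6) * G.threeForm x (A.anchor x p) (A.anchor x (v x)) (A.anchor x w) := by
  obtain ⟨D', hD', h'⟩ := hD
  obtain ⟨s, hs, rfl⟩ := G.exists_split_lft_eq hp
  obtain ⟨w, hw0, rfl⟩ := G.exists_isSec_eq hw
  have h1 : A.pairing x (D.toFun v x (G.lft ε s x)) (w x) = _ := h' (G.lft ε s) v w x
  have h2 : A.pairing x (D'.cov (G.lft ε s) v x) (w x) = _ := hD'.pairing h hv _ hw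
  rw [h1, h2, hD'.torsion_lft h hs hv hw0, anchor_lft G hs]
  ring

theorem IsCanonicalMetricDiv.pairing_of_mem_neg {G : GenMetric A.toCourantAlgebroid}
    (h : G.IsLeviCivita cov)
    {D : GenConnection A.toCourantAlgebroid} (hD : G.IsCanonicalMetricDiv D) {ε : ℤˣ}
    {v : Sec V F E} (hv : G.IsSec ε v) {x : M} {p w : E x} (hp : p ∈ G.eig (-ε) x)
    (hw : w ∈ G.eig ε x) :
    A.pairing x (D.toFun v x p) w
      = sgn ε * G.metric x (cov (A.anchorField v) x (A.anchor x p)) (A.anchor x w)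
        + (1 / 2) * G.threeForm x (A.anchor x p) (A.anchor x (v x)) (A.anchor x w) := by
  obtain ⟨D', hD', h'⟩ := hD
  obtain ⟨u, hu, rfl⟩ := G.exists_isSec_eq hp
  obtain ⟨w, hw0, rfl⟩ := G.exists_isSec_eq hw
  have h1 : A.pairing x (D.toFun v x (u x)) (w x) = _ := h' u v w x
  have h2 : A.pairing x (D'.cov u v x) (w x) = _ := hD'.pairing h hv _ hw
  rw [h1, h2, hD'.torsion_eq_zero hu hv hw0]
  ring

end GenMetric



/-! ### Traces over the fibres, orthogonal frames and the tensor `S` -/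

namespace CourantAlgebroid

variable (A : CourantAlgebroid V F E)

theorem pairing_cobasis_basis (x : M) (i j : Fin (finrank ℝ (E x))) :
    A.pairing x (A.cobasis x i) (basis F E x j) = if j = i then 1 else 0 := by
  have := VectorBundle.finiteDimensional ℝ F E x
  exact LinearMap.BilinForm.apply_dualBasis_left (hB := A.pairing_nondeg x) (b := basis F E x) i j

theorem pairing_cobasis (x : M) (i : Fin (finrank ℝ (E x))) (v : E x) :
    A.pairing x (A.cobasis x i) v = (basis F E x).repr v i := by
  have h := congrArg (A.pairing x (A.cobasis x i)) ((basis F E x).sum_repr v)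
  rw [← h]
  simp only [map_sum, map_smul, A.pairing_cobasis_basis, smul_eq_mul, mul_ite, mul_one, mul_zero]
  simp

theorem sum_pairing_cobasis_smul (x : M) (v : E x) :
    ∑ i, A.pairing x v (A.cobasis x i) • basis F E x i = v := by
  conv_rhs => rw [← (basis F E x).sum_repr v]
  refine Finset.sum_congr rfl fun i _ ↦ ?_
  rw [A.pairing_symm, A.pairing_cobasis]

theorem sum_pairing_basis_smul (x : M) (v : E x) :
    ∑ i, A.pairing x v (basis F E x i) • A.cobasis x i = v := by
  refine A.eq_of_pairing_eq fun r ↦ ?_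
  conv_rhs => rw [← A.sum_pairing_cobasis_smul x r]
  simp only [map_sum, map_smul, LinearMap.sum_apply, LinearMap.smul_apply, smul_eq_mul]
  refine Finset.sum_congr rfl fun i _ ↦ ?_
  rw [A.pairing_symm x (A.cobasis x i)]
  ring

theorem trE_mul_pairing {x : M} (f : E x →ₗ[ℝ] ℝ) (v : E x) :
    A.trE x (fun p q ↦ f p * A.pairing x v q) = f v := by
  conv_rhs => rw [← A.sum_pairing_cobasis_smul x v]
  rw [trE, map_sum]
  refine Finset.sum_congr rfl fun i _ ↦ ?_
  rw [map_smul, smul_eq_mul, mul_comm]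

theorem trE_pairing_mul {x : M} (f : E x →ₗ[ℝ] ℝ) (v : E x) :
    A.trE x (fun p q ↦ A.pairing x v p * f q) = f v := by
  conv_rhs => rw [← A.sum_pairing_basis_smul x v]
  rw [trE, map_sum]
  refine Finset.sum_congr rfl fun i _ ↦ ?_
  rw [map_smul, smul_eq_mul]

theorem trE_add {x : M} (B C : E x → E x → ℝ) :
    A.trE x (fun p q ↦ B p q + C p q) = A.trE x B + A.trE x C := Finset.sum_add_distrib

theorem trE_sub {x : M} (B C : E x → E x → ℝ) :
    A.trE x (fun p q ↦ B p q - C p q) = A.trE x B - A.trE x C := Finset.sum_sub_distrib _ _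

theorem trE_mul_left {x : M} (c : ℝ) (B : E x → E x → ℝ) :
    A.trE x (fun p q ↦ c * B p q) = c * A.trE x B := (Finset.mul_sum _ _ _).symm

theorem trS_eq {x : M} (S : E x →ₗ[ℝ] E x →ₗ[ℝ] E x) (q : E x) :
    trS S q = A.trE x fun p p' ↦ A.pairing x (S p q) p' := by
  rw [trS, LinearMap.trace_eq_matrix_trace ℝ (basis F E x), Matrix.trace, trE]
  refine Finset.sum_congr rfl fun i _ ↦ ?_
  rw [Matrix.diag_apply, LinearMap.toMatrix_apply, LinearMap.flip_apply, A.pairing_symm,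
    A.pairing_cobasis]

/-- The trace of a bilinear form in terms of a tight family. -/
theorem trE_eq_sum {x : M} {ι : Type*} [Fintype ι] (p : ι → E x) (c : ι → ℝ)
    (hp : ∀ v, ∑ j, (c j * A.pairing x v (p j)) • p j = v) (B : E x →ₗ[ℝ] E x →ₗ[ℝ] ℝ) :
    A.trE x (fun p q ↦ B p q) = ∑ j, c j * B (p j) (p j) := by
  have h1 : ∀ i, B (basis F E x i) (A.cobasis x i)
      = ∑ j, c j * (A.pairing x (p j) (basis F E x i) * B (p j) (A.cobasis x i)) := by
    intro i
    conv_lhs => rw [← hp (basis F E x i)]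
    simp only [map_sum, map_smul, LinearMap.sum_apply, LinearMap.smul_apply, smul_eq_mul]
    refine Finset.sum_congr rfl fun j _ ↦ ?_
    rw [A.pairing_symm x (p j)]; ring
  simp only [trE, h1]
  rw [Finset.sum_comm]
  refine Finset.sum_congr rfl fun j _ ↦ ?_
  rw [← Finset.mul_sum]
  congr 1
  exact A.trE_pairing_mul (B (p j)) (p j)

end CourantAlgebroid

namespace GenMetric

variable {A : ExactCourantAlgebroid V F E} (G : GenMetric A.toCourantAlgebroid)

/-- An orthogonal basis of `(T_xM, g)`. -/
structure Frame (x : M) where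
  /-- the basis -/
  e : Basis (Fin (finrank ℝ V)) ℝ (TangentSpace 𝓘(ℝ, V) x)
  /-- the squares of the basis vectors -/
  η : Fin (finrank ℝ V) → ℝ
  ne_zero : ∀ i, η i ≠ 0
  metric_eq : ∀ i j, G.metric x (e i) (e j) = if i = j then η i else 0

theorem nonempty_frame (x : M) : Nonempty (G.Frame x) := by
  obtain ⟨v, hv⟩ := LinearMap.BilinForm.exists_orthogonal_basis (B := G.metric x)
    ⟨fun X Y ↦ G.metric_symm x X Y⟩
  have hfin : finrank ℝ (TangentSpace 𝓘(ℝ, V) x) = finrank ℝ V := rfl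
  refine ⟨⟨v, fun i ↦ G.metric x (v i) (v i), fun i ↦ ?_, fun i j ↦ ?_⟩⟩
  · have := LinearMap.IsOrthoᵢ.not_isOrtho_basis_self_of_separatingLeft hv (G.metric_nondeg x).1 i
    exact this
  · split_ifs with h
    · subst h
      rfl
    · exact hv h

namespace Frame

variable {G} {x : M} (f : G.Frame x)

theorem metric_apply_e (X : TangentSpace 𝓘(ℝ, V) x) (i : Fin (finrank ℝ V)) :
    G.metric x X (f.e i) = f.e.repr X i * f.η i := by
  have h := congrArg (fun Y ↦ G.metric x Y (f.e i)) (f.e.sum_repr X)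
  simp only [map_sum, map_smul, LinearMap.sum_apply, LinearMap.smul_apply, f.metric_eq,
    smul_eq_mul, mul_ite, mul_zero, Finset.sum_ite_eq', Finset.mem_univ, if_true] at h
  exact h.symm

theorem sum_metric_smul (X : TangentSpace 𝓘(ℝ, V) x) :
    ∑ j, ((f.η j)⁻¹ * G.metric x X (f.e j)) • f.e j = X := by
  conv_rhs => rw [← f.e.sum_repr X]
  refine Finset.sum_congr rfl fun i _ ↦ ?_
  rw [f.metric_apply_e, mul_left_comm, inv_mul_cancel₀ (f.ne_zero i), mul_one]

/-- Parseval's identity. -/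
theorem sum_metric_mul_metric (X Y : TangentSpace 𝓘(ℝ, V) x) :
    ∑ j, (f.η j)⁻¹ * (G.metric x X (f.e j) * G.metric x Y (f.e j)) = G.metric x X Y := by
  conv_rhs => rw [← f.sum_metric_smul Y]
  simp only [map_sum, map_smul, smul_eq_mul]
  exact Finset.sum_congr rfl fun j _ ↦ by ring

theorem sum_metric_mul (L : TangentSpace 𝓘(ℝ, V) x →ₗ[ℝ] ℝ) (X : TangentSpace 𝓘(ℝ, V) x) :
    ∑ j, (f.η j)⁻¹ * (G.metric x X (f.e j) * L (f.e j)) = L X := by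
  conv_rhs => rw [← f.sum_metric_smul X]
  simp only [map_sum, map_smul, smul_eq_mul]
  exact Finset.sum_congr rfl fun j _ ↦ by ring

/-- The basis vectors, lifted to `E_±`. -/
def p (ε : ℤˣ) (i : Fin (finrank ℝ V)) : E x := G.lift ε x (f.e i)

theorem p_mem (ε : ℤˣ) (i : Fin (finrank ℝ V)) : f.p ε i ∈ G.eig ε x := G.lift_mem ε x _

theorem anchor_p (ε : ℤˣ) (i : Fin (finrank ℝ V)) : A.anchor x (f.p ε i) = f.e i :=
  G.anchor_lift ε x _

/-- The inverse squares of the vectors `p ε i`. -/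
def N (ε : ℤˣ) (i : Fin (finrank ℝ V)) : ℝ := sgn ε * (f.η i)⁻¹

theorem N_neg (ε : ℤˣ) (i : Fin (finrank ℝ V)) : f.N (-ε) i = -f.N ε i := by
  rw [N, N, sgn_neg, neg_mul]

theorem pairing_p (ε : ℤˣ) (i j : Fin (finrank ℝ V)) :
    A.pairing x (f.p ε i) (f.p ε j) = if i = j then sgn ε * f.η i else 0 := by
  rw [p, p, pairing_lift, f.metric_eq]
  split_ifs <;> simp

theorem N_mul_pairing (ε : ℤˣ) (i : Fin (finrank ℝ V)) :
    f.N ε i * A.pairing x (f.p ε i) (f.p ε i) = 1 := by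
  rw [pairing_p, if_pos rfl, N]
  have h1 := sgn_mul_self ε
  have h2 := inv_mul_cancel₀ (f.ne_zero i)
  linear_combination h1 * ((f.η i)⁻¹ * f.η i) + h2

theorem sum_pairing_smul_of_mem {ε : ℤˣ} {v : E x} (hv : v ∈ G.eig ε x) :
    ∑ j, (f.N ε j * A.pairing x v (f.p ε j)) • f.p ε j = v := by
  refine G.eq_of_mem_eig (Submodule.sum_mem _ fun j _ ↦ Submodule.smul_mem _ _ (f.p_mem ε j)) hv ?_
  conv_rhs => rw [← f.sum_metric_smul (A.anchor x v)]
  rw [map_sum]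
  refine Finset.sum_congr rfl fun j _ ↦ ?_
  rw [map_smul, anchor_p, G.pairing_eq_metric hv (f.p_mem ε j), anchor_p, N]
  congr 1
  have h1 := sgn_mul_self ε
  linear_combination h1 * ((f.η j)⁻¹ * G.metric x (A.anchor x v) (f.e j))

theorem pairing_projAt_p (ε : ℤˣ) (v : E x) (j : Fin (finrank ℝ V)) :
    A.pairing x (G.projAt ε x v) (f.p ε j) = A.pairing x v (f.p ε j) :=
  G.pairing_projAt_left v (f.p_mem ε j)

/-- The lifts of a `g`-orthogonal basis to both eigenbundles form an orthogonal basis of the fibre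
with opposite squares, hence the minus sign. -/
theorem sum_pairing_smul (ε : ℤˣ) (v : E x) :
    ∑ j, (f.N ε j * A.pairing x v (f.p ε j)) • f.p ε j
      - ∑ j, (f.N ε j * A.pairing x v (f.p (-ε) j)) • f.p (-ε) j = v := by
  conv_rhs => rw [← G.projAt_add_projAt_neg ε x v,
    ← f.sum_pairing_smul_of_mem (G.projAt_mem ε x v),
    ← f.sum_pairing_smul_of_mem (G.projAt_mem (-ε) x v)]
  rw [sub_eq_add_neg, ← Finset.sum_neg_distrib]
  simp only [pairing_projAt_p, N_neg, neg_mul, neg_smul]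

theorem trE_eq (ε : ℤˣ) (B : E x →ₗ[ℝ] E x →ₗ[ℝ] ℝ) :
    A.trE x (fun p q ↦ B p q) = ∑ j, f.N ε j * B (f.p ε j) (f.p ε j)
      - ∑ j, f.N ε j * B (f.p (-ε) j) (f.p (-ε) j) := by
  rw [A.trE_eq_sum (ι := Fin (finrank ℝ V) ⊕ Fin (finrank ℝ V))
    (Sum.elim (f.p ε) (f.p (-ε))) (Sum.elim (f.N ε) (fun j ↦ -f.N ε j))]
  · simp [sub_eq_add_neg]
  · intro v
    conv_rhs => rw [← f.sum_pairing_smul ε v]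
    simp [sub_eq_add_neg]

end Frame

theorem trE_projAt (ε : ℤˣ) (x : M) :
    A.trE x (fun p q ↦ A.pairing x (G.projAt ε x p) q) = finrank ℝ V := by
  obtain ⟨f⟩ := G.nonempty_frame x
  have h := f.trE_eq ε (LinearMap.comp (M₃ := E x →ₗ[ℝ] ℝ) (A.pairing x) (G.projAt ε x))
  simp only [LinearMap.comp_apply] at h
  rw [h]
  have h1 : ∀ j, G.projAt ε x (f.p (-ε) j) = 0 := fun j ↦ by
    have := G.projAt_neg_of_mem (f.p_mem (-ε) j)
    rwa [neg_neg] at this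
  simp [h1, G.projAt_of_mem (f.p_mem ε _), f.N_mul_pairing]

/-! ### The first prolongation -/

section prolongation

variable {G} {x : M} {S : E x →ₗ[ℝ] E x →ₗ[ℝ] E x}

theorem IsProlongation.mem (hS : G.IsProlongation x S) {ε : ℤˣ} (p : E x) {q : E x}
    (hq : q ∈ G.eig ε x) : S p q ∈ G.eig ε x := by
  rw [mem_eig_iff] at hq ⊢
  rw [← hS.comm, hq, map_smul]

/-- In the cyclic identity with one argument of the opposite type, the other two terms vanish by
orthogonality. Mixed components of `D` therefore do not feel the divergence. -/
theorem IsProlongation.eq_zero (hS : G.IsProlongation x S) {ε : ℤˣ} {p q : E x}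
    (hp : p ∈ G.eig (-ε) x) (hq : q ∈ G.eig ε x) : S p q = 0 := by
  refine A.eq_of_pairing_eq fun r ↦ ?_
  rw [← G.pairing_projAt_right (hS.mem p hq)]
  have hr := G.projAt_mem ε x r
  have h1 := hS.cyclic p q (G.projAt ε x r)
  have h2 := G.pairing_eq_zero_of_mem_eig (hS.mem q hr) hp
  have h3 := G.pairing_eq_zero_of_mem_eig hq (hS.mem (G.projAt ε x r) hp)
  rw [A.pairing_symm] at h3
  rw [map_zero, LinearMap.zero_apply]
  linarith

variable (G) in
/-- The tensor `p, q ↦ ⟨a, p⟩ (⟨a, q⟩ b - ⟨b, q⟩ a) + c (⟨p_±, q⟩ w - ⟨w, q⟩ p_±)`, which lies in the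
first prolongation for `a, b, w ∈ E_±`. -/
def testTensor (ε : ℤˣ) (a b w : E x) (c : ℝ) : E x →ₗ[ℝ] E x →ₗ[ℝ] E x :=
  LinearMap.mk₂ ℝ (fun p q ↦ A.pairing x a p • (A.pairing x a q • b - A.pairing x b q • a)
      + c • (A.pairing x (G.projAt ε x p) q • w - A.pairing x w q • G.projAt ε x p))
    (fun p p' q ↦ by simp only [map_add, LinearMap.add_apply]; module)
    (fun r p q ↦ by simp only [map_smul, LinearMap.smul_apply, smul_eq_mul]; module)
    (fun p q q' ↦ by simp only [map_add]; module)
    (fun r p q ↦ by simp only [map_smul, smul_eq_mul]; module)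

theorem testTensor_apply (ε : ℤˣ) (a b w : E x) (c : ℝ) (p q : E x) :
    testTensor G ε a b w c p q = A.pairing x a p • (A.pairing x a q • b - A.pairing x b q • a)
      + c • (A.pairing x (G.projAt ε x p) q • w - A.pairing x w q • G.projAt ε x p) := rfl

theorem pairing_testTensor (ε : ℤˣ) (a b w : E x) (c : ℝ) (p q r : E x) :
    A.pairing x r (testTensor G ε a b w c p q)
      = A.pairing x a p * (A.pairing x a q * A.pairing x r b - A.pairing x b q * A.pairing x r a)
      + c * (A.pairing x (G.projAt ε x p) q * A.pairing x r w
        - A.pairing x w q * A.pairing x r (G.projAt ε x p)) := by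
  simp only [testTensor_apply, map_add, map_sub, map_smul, smul_eq_mul]

theorem pairing_projAt_comm (ε : ℤˣ) (p q : E x) :
    A.pairing x (G.projAt ε x p) q = A.pairing x (G.projAt ε x q) p := by
  rw [← G.pairing_projAt_right (G.projAt_mem ε x p), G.pairing_projAt_left _ (G.projAt_mem ε x q),
    A.pairing_symm]

theorem isProlongation_testTensor {ε : ℤˣ} {a b w : E x} (ha : a ∈ G.eig ε x)
    (hb : b ∈ G.eig ε x) (hw : w ∈ G.eig ε x) (c : ℝ) :
    G.IsProlongation x (testTensor G ε a b w c) where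
  skew p q r := by
    rw [A.pairing_symm, pairing_testTensor, pairing_testTensor]
    rw [A.pairing_symm x r b, A.pairing_symm x r a, A.pairing_symm x r w,
      A.pairing_symm x r (G.projAt ε x p), A.pairing_symm x q b, A.pairing_symm x q a,
      A.pairing_symm x q w, A.pairing_symm x q (G.projAt ε x p)]
    ring
  comm p q := by
    have h : ∀ v ∈ G.eig ε x, A.pairing x v (G.endo x q) = sgn ε * A.pairing x v q := by
      intro v hv
      rw [← G.symm, G.mem_eig_iff.1 hv, map_smul, LinearMap.smul_apply, smul_eq_mul]
    have h2 := G.mem_eig_iff.1 (G.projAt_mem ε x p)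
    rw [G.mem_eig_iff] at *
    rw [testTensor_apply, testTensor_apply, h a (G.mem_eig_iff.2 ha), h b (G.mem_eig_iff.2 hb),
      h w (G.mem_eig_iff.2 hw), h _ (G.projAt_mem ε x p)]
    simp only [map_add, map_sub, map_smul, ha, hb, hw, h2]
    module
  cyclic p q r := by
    rw [A.pairing_symm x (testTensor G ε a b w c p q) r,
      A.pairing_symm x (testTensor G ε a b w c q r) p,
      A.pairing_symm x (testTensor G ε a b w c r p) q, pairing_testTensor, pairing_testTensor,
      pairing_testTensor, A.pairing_symm x p (G.projAt ε x q),  A.pairing_symm x r b, A.pairing_symm x r a,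
      A.pairing_symm x r w, A.pairing_symm x p b, A.pairing_symm x p a, A.pairing_symm x p w,
      A.pairing_symm x q b, A.pairing_symm x q a, A.pairing_symm x q w,
      A.pairing_symm x r (G.projAt ε x p),
      A.pairing_symm x q (G.projAt ε x r), pairing_projAt_comm ε q p,
      pairing_projAt_comm ε r q, pairing_projAt_comm ε r p]
    ring

theorem trS_testTensor {ε : ℤˣ} {a b w : E x} (hw : w ∈ G.eig ε x) (c : ℝ) (q : E x) :
    trS (testTensor G ε a b w c) q
      = A.pairing x a b * A.pairing x a q - A.pairing x a a * A.pairing x b q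
        + c * (1 - finrank ℝ V) * A.pairing x w q := by
  have h : ∀ p p', A.pairing x (testTensor G ε a b w c p q) p'
      = (A.pairing x a q * (A.pairing x a p * A.pairing x b p')
        - A.pairing x b q * (A.pairing x a p * A.pairing x a p'))
      + (c * (A.pairing x (G.projAt ε x q) p * A.pairing x w p')
        - c * A.pairing x w q * A.pairing x (G.projAt ε x p) p') := by
    intro p p'
    rw [A.pairing_symm, pairing_testTensor, A.pairing_symm x p', A.pairing_symm x p',
      A.pairing_symm x p', A.pairing_symm x p', pairing_projAt_comm ε p q]
    ring
  rw [A.trS_eq]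
  simp only [h]
  rw [A.trE_add, A.trE_sub, A.trE_sub]
  simp only [A.trE_mul_left]
  rw [A.trE_mul_pairing, A.trE_mul_pairing, A.trE_mul_pairing, trE_projAt,
    G.pairing_projAt_left _ hw, A.pairing_symm x q]
  ring

/-- Pairing with a test tensor picks out the component `⟨S_a a, b⟩` up to a trace. Vectors `w` that
make the test tensor trace-free turn the orthogonality of `S` into a formula for this component. -/
theorem pairS_testTensor (hS : G.IsProlongation x S) {ε : ℤˣ} {a b w : E x}
    (hw : w ∈ G.eig ε x) (c : ℝ) :
    A.pairS x S (testTensor G ε a b w c) = 2 * A.pairing x (S a a) b - 2 * c * trS S w := by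
  have h : ∀ p p' : E x, (A.trE x fun q q' ↦
      A.pairing x (S p q) (testTensor G ε a b w c p' q'))
      = 2 * (A.pairing x (S p a) b * A.pairing x a p') - 2 * c * A.pairing x (S p w) p' := by
    intro p p'
    have h1 : ∀ q q', A.pairing x (S p q) (testTensor G ε a b w c p' q')
        = (A.pairing x a p' * (A.pairing x (S p q) b * A.pairing x a q')
          - A.pairing x a p' * (A.pairing x (S p q) a * A.pairing x b q'))
        + (c * (A.pairing x (S p q) w * A.pairing x (G.projAt ε x p') q')
          - c * (A.pairing x (S p q) (G.projAt ε x p') * A.pairing x w q')) := by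
      intro q q'
      rw [pairing_testTensor]
      ring
    have h2 : ∀ r v : E x, A.trE x (fun q q' ↦ A.pairing x (S p q) r * A.pairing x v q')
        = A.pairing x (S p v) r := fun r v ↦
      A.trE_mul_pairing (((A.pairing x).flip r).comp (S p)) v
    simp only [h1]
    rw [A.trE_add, A.trE_sub, A.trE_sub]
    simp only [A.trE_mul_left, h2]
    have h3 := hS.skew p b a
    have h4 := hS.skew p (G.projAt ε x p') w
    rw [A.pairing_symm x b] at h3
    rw [A.pairing_symm x (G.projAt ε x p')] at h4
    rw [h3, h4, G.pairing_projAt_right (hS.mem p hw)]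
    ring
  rw [CourantAlgebroid.pairS]
  simp only [h]
  rw [A.trE_sub, A.trE_mul_left, A.trE_mul_left, A.trS_eq]
  congr 2
  exact A.trE_mul_pairing (((A.pairing x).flip b).comp (S.flip a)) a

/-- An element of the first prolongation that is orthogonal to the kernel of the trace is
determined by its trace. -/
theorem IsProlongation.pairing_eq (hS : G.IsProlongation x S)
    (hort : ∀ T : E x →ₗ[ℝ] E x →ₗ[ℝ] E x, G.IsProlongation x T → (∀ q, trS T q = 0) →
      A.pairS x S T = 0)
    {e : E x} (he : ∀ q, trS S q = -A.pairing x e q) (hd : 2 ≤ finrank ℝ V) {ε : ℤˣ} {p q r : E x}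
    (hp : p ∈ G.eig ε x) (hq : q ∈ G.eig ε x) (hr : r ∈ G.eig ε x) :
    A.pairing x (S p q) r = ((finrank ℝ V : ℝ) - 1)⁻¹
      * (A.pairing x p q * A.pairing x e r - A.pairing x e q * A.pairing x p r) := by
  set c : ℝ := ((finrank ℝ V : ℝ) - 1)⁻¹ with hc
  have hd1 : (finrank ℝ V : ℝ) - 1 ≠ 0 := by
    have : (2 : ℝ) ≤ finrank ℝ V := by exact_mod_cast hd
    linarith
  have hcd : c * (1 - finrank ℝ V) = -1 := by
    rw [hc]; field_simp; ring
  have diag : ∀ {a b : E x}, a ∈ G.eig ε x → b ∈ G.eig ε x →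
      A.pairing x (S a a) b
        = c * (A.pairing x a a * A.pairing x e b - A.pairing x e a * A.pairing x a b) := by
    intro a b ha hb
    -- By `trS_testTensor` and `c (1 - d) = -1`, this is the vector for which the trace cancels.
    set w : E x := A.pairing x a b • a - A.pairing x a a • b with hwdef
    have hw : w ∈ G.eig ε x :=
      Submodule.sub_mem _ (Submodule.smul_mem _ _ ha) (Submodule.smul_mem _ _ hb)
    have h1 := hort (testTensor G ε a b w c) (isProlongation_testTensor ha hb hw c) (by
      intro q
      rw [trS_testTensor hw, hcd, hwdef]
      simp only [map_sub, map_smul, LinearMap.sub_apply, LinearMap.smul_apply, smul_eq_mul]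
      ring)
    rw [pairS_testTensor hS hw, he, hwdef] at h1
    simp only [map_sub, map_smul, smul_eq_mul] at h1
    linear_combination h1 / 2
  -- Polarisation of `diag` in the repeated argument.
  have skew12 : ∀ {a a' b : E x}, a ∈ G.eig ε x → a' ∈ G.eig ε x → b ∈ G.eig ε x →
      A.pairing x (S a a') b + A.pairing x (S a' a) b
        = c * (2 * A.pairing x a a' * A.pairing x e b - A.pairing x e a * A.pairing x a' b
          - A.pairing x e a' * A.pairing x a b) := by
    intro a a' b ha ha' hb
    have h1 := diag (Submodule.add_mem _ ha ha') hb
    have h2 := diag ha hb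
    have h3 := diag ha' hb
    simp only [map_add, LinearMap.add_apply, A.pairing_symm x a' a] at h1
    linear_combination h1 - h2 - h3
  have h1 := hS.cyclic p q r
  have h2 := skew12 hp hq hr
  have h3 := skew12 hq hr hp
  have h4 := skew12 hr hp hq
  have h5 := hS.skew p q r
  have h6 := hS.skew q r p
  have h7 := hS.skew r p q
  rw [A.pairing_symm x q] at h5
  rw [A.pairing_symm x r] at h6
  rw [A.pairing_symm x p] at h7
  simp only [A.pairing_symm x q p, A.pairing_symm x r p, A.pairing_symm x r q] at *
  -- The cyclic identity and skew-symmetry in the last two slots recover `S` from its symmetrisation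
  -- in the first two.
  linear_combination (1 / 3) * (h1 + h2 - h4 + h5 - h6)

end prolongation

end GenMetric



/-! ### Symmetries and tensoriality of the generalised Riemann tensor -/

namespace CourantAlgebroid

variable (A : CourantAlgebroid V F E)

theorem exists_pairing_eq (x : M) (f : E x →ₗ[ℝ] ℝ) : ∃ v, A.pairing x v = f := by
  have := VectorBundle.finiteDimensional ℝ F E x
  exact ((A.pairing x).toDual (A.pairing_nondeg x)).surjective f

theorem trE_mul_comm {x : M} (f g : E x →ₗ[ℝ] ℝ) :
    A.trE x (fun p q ↦ f p * g q) = A.trE x (fun p q ↦ g p * f q) := by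
  obtain ⟨v, rfl⟩ := A.exists_pairing_eq x g
  rw [A.trE_mul_pairing, A.trE_pairing_mul]

end CourantAlgebroid

namespace GenConnection

variable {A : CourantAlgebroid V F E} (D : GenConnection A)

theorem cov_apply (u v : Sec V F E) (x : M) : D.cov u v x = D.toFun v x (u x) := rfl

theorem cov_add_left (u u' v : Sec V F E) : D.cov (u + u') v = D.cov u v + D.cov u' v := by
  ext x
  exact map_add (D.toFun v x) (u x) (u' x)

theorem cov_add_right (u v v' : Sec V F E) : D.cov u (v + v') = D.cov u v + D.cov u v' := by
  ext x
  exact LinearMap.congr_fun (D.add v v' x) (u x)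

theorem cov_smulFn_left (f : C^∞⟮𝓘(ℝ, V), M; ℝ⟯) (u v : Sec V F E) :
    D.cov (smulFn f u) v = smulFn f (D.cov u v) := by
  ext x
  exact map_smul (D.toFun v x) (f x) (u x)

theorem cov_smulFn_right (f : C^∞⟮𝓘(ℝ, V), M; ℝ⟯) (u v : Sec V F E) :
    D.cov u (smulFn f v) = smulFn f (D.cov u v) + smulFn (lieDer (A.tan u) f) v := by
  ext x
  exact D.leibniz f v x (u x)

theorem df_pair (v w : Sec V F E) (x : M) (p : E x) :
    df (A.pair v w) x (A.anchor x p)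
      = A.pairing x (D.toFun v x p) (w x) + A.pairing x (v x) (D.toFun w x p) :=
  D.compat v w x p

theorem lieDer_pair (u v w : Sec V F E) :
    lieDer (A.tan u) (A.pair v w) = A.pair (D.cov u v) w + A.pair v (D.cov u w) := by
  ext x
  exact D.compat v w x (u x)

theorem naiveCurv_add_one (a a' b v w : Sec V F E) (x : M) :
    D.naiveCurv (a + a') b v w x = D.naiveCurv a b v w x + D.naiveCurv a' b v w x :=
  map_add (A.pairing x _) (a x) (a' x)

theorem naiveCurv_smulFn_one (f : C^∞⟮𝓘(ℝ, V), M; ℝ⟯) (a b v w : Sec V F E) (x : M) :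
    D.naiveCurv (smulFn f a) b v w x = f x * D.naiveCurv a b v w x :=
  map_smul (A.pairing x _) (f x) (a x)

theorem naiveCurv_add_four (a b v w w' : Sec V F E) (x : M) :
    D.naiveCurv a b v (w + w') x = D.naiveCurv a b v w x + D.naiveCurv a b v w' x := by
  simp only [naiveCurv, map_add, cov_add_left, cov_add_right]
  simp only [ContMDiffSection.coe_add, Pi.add_apply, map_add, map_sub, LinearMap.add_apply,
    LinearMap.sub_apply]
  ring

/-- The derivative of `f` along `v` from `D_v D_{fw}` cancels that from `D_{[v,fw]}`. The third slot
behaves differently, since `[fv, w]` contains an additional `⟨v,w⟩ df`. -/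
theorem naiveCurv_smulFn_four (f : C^∞⟮𝓘(ℝ, V), M; ℝ⟯) (a b v w : Sec V F E) (x : M) :
    D.naiveCurv a b v (smulFn f w) x = f x * D.naiveCurv a b v w x := by
  simp only [naiveCurv, A.bracket_smulFn, cov_add_left, cov_smulFn_left, cov_smulFn_right]
  simp only [ContMDiffSection.coe_add, Pi.add_apply, map_add, map_sub, LinearMap.add_apply,
    LinearMap.sub_apply, smulFn_apply, map_smul, LinearMap.smul_apply, smul_eq_mul]
  ring

/-- The naive curvature operators are skew-symmetric. -/
theorem naiveCurv_swap (a b v w : Sec V F E) (x : M) :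
    D.naiveCurv a b v w x = -D.naiveCurv b a v w x := by
  -- Both sides of the commutator formula for the function `⟨b,a⟩` are expanded by metric
  -- compatibility; the products of first derivatives cancel.
  have h := A.df_anchor_bracket v w (A.pair b a) x
  rw [D.df_pair, D.lieDer_pair, D.lieDer_pair, df_add, df_add, D.df_pair, D.df_pair, D.df_pair,
    D.df_pair] at h
  simp only [naiveCurv, cov_apply, map_sub, LinearMap.sub_apply] at h ⊢
  simp only [A.pairing_symm x _ (b x), A.pairing_symm x (D.toFun b x _) (D.toFun a x _)] at h ⊢
  linarith

theorem riem_add_one (a a' b v w : Sec V F E) (x : M) :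
    D.riem (a + a') b v w x = D.riem a b v w x + D.riem a' b v w x := by
  have h : A.trE x (fun p q ↦ A.pairing x (D.toFun v x p) (w x)
      * A.pairing x (D.toFun b x q) ((a + a') x))
      = A.trE x (fun p q ↦ A.pairing x (D.toFun v x p) (w x) * A.pairing x (D.toFun b x q) (a x))
      + A.trE x (fun p q ↦ A.pairing x (D.toFun v x p) (w x)
        * A.pairing x (D.toFun b x q) (a' x)) := by
    rw [← A.trE_add]
    congr 1
    funext p q
    rw [ContMDiffSection.coe_add, Pi.add_apply, map_add]
    ring
  rw [riem, h, naiveCurv_add_one, naiveCurv_add_four, riem, riem]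
  ring

theorem riem_smulFn_one (f : C^∞⟮𝓘(ℝ, V), M; ℝ⟯) (a b v w : Sec V F E) (x : M) :
    D.riem (smulFn f a) b v w x = f x * D.riem a b v w x := by
  have h : A.trE x (fun p q ↦ A.pairing x (D.toFun v x p) (w x)
      * A.pairing x (D.toFun b x q) (smulFn f a x))
      = f x * A.trE x (fun p q ↦ A.pairing x (D.toFun v x p) (w x)
        * A.pairing x (D.toFun b x q) (a x)) := by
    rw [← A.trE_mul_left]
    congr 1
    funext p q
    rw [smulFn_apply, map_smul, smul_eq_mul]
    ring
  rw [riem, h, naiveCurv_smulFn_one, naiveCurv_smulFn_four, riem]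
  ring

theorem riem_symm (a b v w : Sec V F E) (x : M) : D.riem a b v w x = D.riem w v b a x := by
  rw [riem, riem, add_comm (D.naiveCurv a b v w x)]
  congr 2
  exact A.trE_mul_comm (((A.pairing x).flip (w x)).comp (D.toFun v x))
    (((A.pairing x).flip (a x)).comp (D.toFun b x))

/-- The bracket fails to be skew by `r`, the gradient of `⟨a,b⟩`, so one naive curvature fails to be
skew by `-⟨D_r v, w⟩`. The trace term compensates: `⟨Db,a⟩ + ⟨Da,b⟩` is the differential of `⟨a,b⟩`,
and contracting it with `⟨Dv,w⟩` gives `⟨D_r v, w⟩`. -/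
theorem riem_swap (a b v w : Sec V F E) (x : M) : D.riem a b v w x = -D.riem b a v w x := by
  set r : E x := A.bracket a b x + A.bracket b a x with hr
  have h1 : D.naiveCurv w v b a x + D.naiveCurv w v a b x
      = -A.pairing x (D.toFun v x r) (w x) := by
    rw [hr]
    simp only [naiveCurv, cov_apply, map_add, map_sub, LinearMap.sub_apply, LinearMap.add_apply]
    ring
  have h2 : A.trE x (fun p q ↦ A.pairing x (D.toFun v x p) (w x) * A.pairing x (D.toFun b x q) (a x))
      + A.trE x (fun p q ↦ A.pairing x (D.toFun v x p) (w x) * A.pairing x (D.toFun a x q) (b x))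
      = A.pairing x (D.toFun v x r) (w x) := by
    rw [← A.trE_add]
    refine Eq.trans ?_ (A.trE_mul_pairing (((A.pairing x).flip (w x)).comp (D.toFun v x)) r)
    congr 1
    funext p q
    obtain ⟨s, rfl⟩ := exists_sec_eq V F x q
    rw [hr, map_add, LinearMap.add_apply, A.pairing_bracket_add, D.df_pair,
      A.pairing_symm x (a x)]
    change _ = A.pairing x (D.toFun v x p) (w x) * _
    ring
  have h3 := D.naiveCurv_swap a b v w x
  rw [riem, riem]
  linarith

theorem riem_congr_one {a a' : Sec V F E} (b v w : Sec V F E) {x : M} (h : a x = a' x) :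
    D.riem a b v w x = D.riem a' b v w x :=
  map_eq_of_tensorial (fun u ↦ D.riem u b v w x) (fun u v' ↦ D.riem_add_one u v' b v w x)
    (fun f u ↦ D.riem_smulFn_one f u b v w x) h

/-- The generalised Riemann tensor is a tensor. -/
theorem riem_congr {a a' b b' v v' w w' : Sec V F E} {x : M} (ha : a x = a' x) (hb : b x = b' x)
    (hv : v x = v' x) (hw : w x = w' x) : D.riem a b v w x = D.riem a' b' v' w' x := by
  -- The symmetries bring each slot in turn to the first one, where tensoriality is visible.
  rw [D.riem_congr_one b v w ha, D.riem_swap, D.riem_congr_one a' v w hb, ← D.riem_swap,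
    D.riem_symm, D.riem_congr_one v b' a' hw, D.riem_swap, D.riem_congr_one w' b' a' hv,
    ← D.riem_swap, ← D.riem_symm]

theorem riem_add_three (a b v v' w : Sec V F E) (x : M) :
    D.riem a b (v + v') w x = D.riem a b v w x + D.riem a b v' w x := by
  simp only [D.riem_symm a b, D.riem_swap w, riem_add_one, neg_add]

theorem riem_smulFn_three (f : C^∞⟮𝓘(ℝ, V), M; ℝ⟯) (a b v w : Sec V F E) (x : M) :
    D.riem a b (smulFn f v) w x = f x * D.riem a b v w x := by
  simp only [D.riem_symm a b, D.riem_swap w, riem_smulFn_one, mul_neg]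

/-- The bilinear form `Rm(·, a, ·, b)`. -/
def riemForm (a b : Sec V F E) (x : M) : E x →ₗ[ℝ] E x →ₗ[ℝ] ℝ :=
  LinearMap.mk₂ ℝ (fun p q ↦ D.riem (extSec V F p) a (extSec V F q) b x)
    (fun p p' q ↦ by
      rw [← riem_add_one]
      exact D.riem_congr_one _ _ _ (by simp [extSec_apply]))
    (fun r p q ↦ by
      refine Eq.trans ?_ (D.riem_smulFn_one (ContMDiffMap.const r) _ _ _ _ _)
      exact D.riem_congr_one _ _ _ (by simp [extSec_apply]; rfl))
    (fun p q q' ↦ by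
      rw [← riem_add_three]
      exact D.riem_congr rfl rfl (by simp [extSec_apply]) rfl)
    (fun r p q ↦ by
      refine Eq.trans ?_ (D.riem_smulFn_three (ContMDiffMap.const r) _ _ _ _ _)
      exact D.riem_congr rfl rfl (by simp [extSec_apply]; rfl) rfl)

theorem ricci_eq (a b : Sec V F E) (x : M) :
    D.ricci a b x = A.trE x fun p q ↦ D.riemForm a b x p q := rfl

end GenConnection

/-! ### The canonical connection in terms of `∇`, `H` and `e` -/

namespace GenMetric

variable {A : ExactCourantAlgebroid V F E} (G : GenMetric A.toCourantAlgebroid)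
  (cov : CovariantDerivative 𝓘(ℝ, V) V (TangentSpace 𝓘(ℝ, V) : M → Type _))

/-- An explicit form of the canonical generalised Levi-Civita connections in terms of `∇`, `H`
and `e`. -/
structure HasForm (D : GenConnection A.toCourantAlgebroid) (e : Sec V F E) (c : ℝ) : Prop where
  mem : ∀ {ε : ℤˣ} {v : Sec V F E}, G.IsSec ε v → ∀ (x : M) (p : E x), D.toFun v x p ∈ G.eig ε x
  pairing_of_mem : ∀ {ε : ℤˣ} {v : Sec V F E}, G.IsSec ε v → ∀ {x : M} {p w : E x},
    p ∈ G.eig ε x → w ∈ G.eig ε x →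
    A.pairing x (D.toFun v x p) w
      = sgn ε * G.metric x (cov (A.anchorField v) x (A.anchor x p)) (A.anchor x w)
        + (1 / 6) * G.threeForm x (A.anchor x p) (A.anchor x (v x)) (A.anchor x w)
        + c * (A.pairing x p (v x) * A.pairing x (e x) w
          - A.pairing x (e x) (v x) * A.pairing x p w)
  pairing_of_mem_neg : ∀ {ε : ℤˣ} {v : Sec V F E}, G.IsSec ε v → ∀ {x : M} {p w : E x},
    p ∈ G.eig (-ε) x → w ∈ G.eig ε x →
    A.pairing x (D.toFun v x p) w
      = sgn ε * G.metric x (cov (A.anchorField v) x (A.anchor x p)) (A.anchor x w)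
        + (1 / 2) * G.threeForm x (A.anchor x p) (A.anchor x (v x)) (A.anchor x w)

variable {G cov}

theorem IsCanonical.hasForm (h : G.IsLeviCivita cov) {dv : DivergenceOperator A.toCourantAlgebroid}
    {e : Sec V F E} (he : ∀ (u : Sec V F E) (x : M),
      dv.toFun u x = metricDiv A.toCourantAlgebroid cov u x - A.pairing x (e x) (u x))
    {D : GenConnection A.toCourantAlgebroid} (hD : G.IsCanonical cov dv D)
    (hd : 2 ≤ finrank ℝ V) : G.HasForm cov D e ((finrank ℝ V : ℝ) - 1)⁻¹ := by
  obtain ⟨D₀, hD₀, S, hS, hort, hDS, hdiv⟩ := hD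
  have htr : ∀ x q, trS (S x) q = -A.pairing x (e x) q := by
    intro x q
    obtain ⟨u, rfl⟩ := exists_sec_eq V F x q
    have h1 := hdiv u x
    rw [he] at h1
    linarith
  refine ⟨fun hv x p ↦ ?_, fun hv x p w hp hw ↦ ?_, fun hv x p w hp hw ↦ ?_⟩
  · rw [hDS]
    exact Submodule.add_mem _ (hD₀.mem hv x p) ((hS x).mem p (hv x))
  · rw [hDS, map_add, LinearMap.add_apply, hD₀.pairing_of_mem h hv hp hw,
      (hS x).pairing_eq (hort x) (htr x) hd hp (hv x) hw]
  · rw [hDS, map_add, LinearMap.add_apply, hD₀.pairing_of_mem_neg h hv hp hw,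
      (hS x).eq_zero hp (hv x), map_zero, LinearMap.zero_apply, add_zero]

variable {D : GenConnection A.toCourantAlgebroid}

theorem naiveCurv_eq_zero (hD : ∀ {ε : ℤˣ} {v : Sec V F E}, G.IsSec ε v →
      ∀ (x : M) (p : E x), D.toFun v x p ∈ G.eig ε x)
    {ε : ℤˣ} {a b : Sec V F E} (ha : G.IsSec (-ε) a) (hb : G.IsSec ε b) (v w : Sec V F E) (x : M) :
    D.naiveCurv a b v w x = 0 := by
  refine G.pairing_eq_zero_of_mem_eig (Submodule.sub_mem _ (Submodule.sub_mem _ ?_ ?_) ?_) (ha x)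
  · exact hD (fun y ↦ hD hb y (w y)) x (v x)
  · exact hD (fun y ↦ hD hb y (v y)) x (w x)
  · exact hD hb x _

/-- All three summands of `Rm` pair derivatives in one eigenbundle with vectors of the other. Hence
half of the Ricci trace drops out. -/
theorem riem_eq_zero (hD : ∀ {ε : ℤˣ} {v : Sec V F E}, G.IsSec ε v →
      ∀ (x : M) (p : E x), D.toFun v x p ∈ G.eig ε x)
    {ε : ℤˣ} {p a q b : Sec V F E} (hp : G.IsSec (-ε) p) (ha : G.IsSec ε a) (hq : G.IsSec (-ε) q)
    (hb : G.IsSec ε b) (x : M) : D.riem p a q b x = 0 := by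
  have h1 : ∀ r, A.pairing x (D.toFun a x r) (p x) = 0 := fun r ↦
    G.pairing_eq_zero_of_mem_eig (hD ha x r) (hp x)
  have hb' : G.IsSec (-(-ε)) b := by rwa [neg_neg]
  rw [GenConnection.riem, naiveCurv_eq_zero hD hp ha, naiveCurv_eq_zero hD hb' hq]
  simp [h1, CourantAlgebroid.trE]

/-- The Ricci tensor of a connection that preserves `E_±`, in an orthogonal frame. -/
theorem ricci_eq_sum (hD : ∀ {ε : ℤˣ} {v : Sec V F E}, G.IsSec ε v →
      ∀ (x : M) (p : E x), D.toFun v x p ∈ G.eig ε x) {x : M} (f : G.Frame x)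
    {ε : ℤˣ} {a b a' b' : Sec V F E} (ha : G.IsSec ε a) (hb : G.IsSec ε b)
    (haa : a x = a' x) (hbb : b x = b' x) (P : Fin (finrank ℝ V) → Sec V F E)
    (hP : ∀ j, P j x = f.p ε j) :
    D.ricci a b x = ∑ j, f.N ε j * D.riem (P j) a' (P j) b' x := by
  rw [D.ricci_eq, f.trE_eq ε]
  have h0 : ∀ j, D.riemForm a b x (f.p (-ε) j) (f.p (-ε) j) = 0 := by
    intro j
    obtain ⟨u, hu, hux⟩ := G.exists_isSec_eq (f.p_mem (-ε) j)
    rw [← riem_eq_zero hD hu ha hu hb x]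
    exact D.riem_congr ((extSec_apply V F _).trans hux.symm) rfl
      ((extSec_apply V F _).trans hux.symm) rfl
  simp only [h0, mul_zero, Finset.sum_const_zero, sub_zero]
  refine Finset.sum_congr rfl fun j _ ↦ ?_
  congr 1
  exact D.riem_congr ((extSec_apply V F _).trans (hP j).symm) haa
    ((extSec_apply V F _).trans (hP j).symm) hbb

end GenMetric


/-! ### The Levi-Civita connection on smooth vector fields -/

variable (V M) in
/-- The space of smooth vector fields. -/
abbrev VField : Type _ := Sec V V (TangentSpace 𝓘(ℝ, V) : M → Type _)

namespace GenMetric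

variable {A : ExactCourantAlgebroid V F E} {G : GenMetric A.toCourantAlgebroid}
  {cov : CovariantDerivative 𝓘(ℝ, V) V (TangentSpace 𝓘(ℝ, V) : M → Type _)}

theorem cov_add (Y Z : VField V M) (x : M) : cov (Y + Z : VField V M) x = cov Y x + cov Z x :=
  cov.isCovariantDerivativeOnUniv.add Y.mdifferentiableAt Z.mdifferentiableAt

theorem cov_smulFn (f : C^∞⟮𝓘(ℝ, V), M; ℝ⟯) (Y : VField V M) (x : M)
    (X : TangentSpace 𝓘(ℝ, V) x) :
    cov (smulFn f Y) x X = f x • cov Y x X + df f x X • Y x := by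
  have h := cov.isCovariantDerivativeOnUniv.leibniz (σ := Y) (g := f) (x := x)
    Y.mdifferentiableAt (smoothFn_mdiffAt f x)
  exact congrArg (fun L ↦ L X) h

theorem cov_neg (Y : VField V M) (x : M) : cov (-Y : VField V M) x = -cov Y x := by
  have h0 : cov (0 : VField V M) x = 0 := congr_fun cov.zero x
  have h := cov_add (cov := cov) (-Y) Y x
  rw [neg_add_cancel, h0] at h
  exact eq_neg_of_add_eq_zero_left h.symm

theorem cov_sub (Y Z : VField V M) (x : M) : cov (Y - Z : VField V M) x = cov Y x - cov Z x := by
  rw [sub_eq_add_neg, cov_add, cov_neg, ← sub_eq_add_neg]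

/-- The vector field `∇_X Y`. -/
def IsLeviCivita.nabla (h : G.IsLeviCivita cov) (X Y : VField V M) : VField V M :=
  ⟨fun x ↦ cov Y x (X x), by
    have : IsManifold 𝓘(ℝ, V) 1 M := .of_le (n := ∞) (by simp)
    have h1 := h.smooth.contMDiff.contMDiff (σ := Y) Y.contMDiff.contMDiffOn
    rw [contMDiffOn_univ] at h1
    exact h1.clm_bundle_apply X.contMDiff⟩

namespace IsLeviCivita

theorem nabla_apply (h : G.IsLeviCivita cov) (X Y : VField V M) (x : M) : h.nabla X Y x = cov Y x (X x) := rfl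

theorem nabla_add_left (h : G.IsLeviCivita cov) (X X' Y : VField V M) :
    h.nabla (X + X') Y = h.nabla X Y + h.nabla X' Y := by
  ext x
  exact map_add (cov Y x) (X x) (X' x)

theorem nabla_smulFn_left (h : G.IsLeviCivita cov) (f : C^∞⟮𝓘(ℝ, V), M; ℝ⟯) (X Y : VField V M) :
    h.nabla (smulFn f X) Y = smulFn f (h.nabla X Y) := by
  ext x
  exact map_smul (cov Y x) (f x) (X x)

theorem nabla_add_right (h : G.IsLeviCivita cov) (X Y Y' : VField V M) :
    h.nabla X (Y + Y') = h.nabla X Y + h.nabla X Y' := by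
  ext x
  exact congrArg (fun L ↦ L (X x)) (cov_add (cov := cov) Y Y' x)

theorem nabla_smulFn_right (h : G.IsLeviCivita cov) (f : C^∞⟮𝓘(ℝ, V), M; ℝ⟯) (X Y : VField V M) :
    h.nabla X (smulFn f Y) = smulFn f (h.nabla X Y) + smulFn (lieDer X f) Y := by
  ext x
  exact cov_smulFn f Y x (X x)

theorem affineCurv_eq (h : G.IsLeviCivita cov) (X Y Z : VField V M) (x : M) :
    affineCurv cov X Y Z x = cov (h.nabla Y Z) x (X x) - cov (h.nabla X Z) x (Y x)
      - cov Z x (cov Y x (X x) - cov X x (Y x)) := by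
  rw [h.torsion_free X Y x X.mdifferentiableAt Y.mdifferentiableAt]
  rfl

/-- The torsion-free connection computes commutators of vector fields. -/
theorem df_commutator (h : G.IsLeviCivita cov) (X Y : VField V M) (f : C^∞⟮𝓘(ℝ, V), M; ℝ⟯) (x : M) :
    df f x (cov Y x (X x) - cov X x (Y x))
      = df (lieDer Y f) x (X x) - df (lieDer X f) x (Y x) := by
  let C : VField V M → VField V M → ℝ := fun X Y ↦
    df f x (cov Y x (X x) - cov X x (Y x)) - (df (lieDer Y f) x (X x) - df (lieDer X f) x (Y x))
  have hanti : ∀ X Y, C X Y = -C Y X := fun X Y ↦ by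
    simp only [C, map_sub]
    ring
  have hadd : ∀ Y X X', C (X + X') Y = C X Y + C X' Y := fun Y X X' ↦ by
    have h1 : lieDer (X + X') f = lieDer X f + lieDer X' f := by
      ext y
      exact map_add (df f y) (X y) (X' y)
    have h2 : (X + X') x = X x + X' x := rfl
    simp only [C, h1, df_add, cov_add, h2, map_add, map_sub, add_apply]
    ring
  have hsmul : ∀ Y (k : C^∞⟮𝓘(ℝ, V), M; ℝ⟯) X, C (smulFn k X) Y = k x • C X Y := fun Y k X ↦ by
    have h1 : lieDer (smulFn k X) f = k * lieDer X f := by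
      ext y
      exact map_smul (df f y) (k y) (X y)
    have h2 : lieDer X f x = df f x (X x) := rfl
    simp only [C, h1, df_mul, cov_smulFn, smulFn_apply, map_add, map_sub, map_smul, smul_eq_mul, h2]
    ring
  obtain ⟨p, hp⟩ := A.anchor_surjective x (X x)
  obtain ⟨q, hq⟩ := A.anchor_surjective x (Y x)
  obtain ⟨u, rfl⟩ := exists_sec_eq V F x p
  obtain ⟨v, rfl⟩ := exists_sec_eq V F x q
  -- The defect `C` is skew and linear over functions, so `X` and `Y` may be replaced by anchors of
  -- sections, for which the formula comes from the Courant Jacobi identity.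
  have h1 : C X Y = C (A.tan u) (A.tan v) := by
    rw [map_eq_of_tensorial (fun X ↦ C X Y) (hadd Y) (hsmul Y) (u := X) (v := A.tan u) hp.symm,
      hanti, map_eq_of_tensorial (fun Y ↦ C Y (A.tan u)) (hadd _) (hsmul _) (u := Y)
        (v := A.tan v) hq.symm, ← hanti]
  have h2 : C (A.tan u) (A.tan v) = 0 := by
    have h3 := A.df_anchor_bracket u v f x
    rw [h.torsion] at h3
    exact sub_eq_zero.2 h3
  exact sub_eq_zero.1 (h1.trans h2)

theorem affineCurv_swap (h : G.IsLeviCivita cov) (X Y Z : VField V M) (x : M) :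
    affineCurv cov X Y Z x = -affineCurv cov Y X Z x := by
  rw [h.affineCurv_eq, h.affineCurv_eq, map_sub, map_sub]
  abel

theorem affineCurv_add_left (h : G.IsLeviCivita cov) (X X' Y Z : VField V M) (x : M) :
    affineCurv cov (X + X' : VField V M) Y Z x
      = affineCurv cov X Y Z x + affineCurv cov X' Y Z x := by
  have h2 : (X + X') x = X x + X' x := rfl
  simp only [h.affineCurv_eq, h.nabla_add_left, cov_add, h2, map_add, map_sub,
    add_apply]
  abel

theorem affineCurv_smulFn_left (h : G.IsLeviCivita cov) (f : C^∞⟮𝓘(ℝ, V), M; ℝ⟯) (X Y Z : VField V M) (x : M) :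
    affineCurv cov (smulFn f X) Y Z x = f x • affineCurv cov X Y Z x := by
  simp only [h.affineCurv_eq, h.nabla_smulFn_left, cov_smulFn, smulFn_apply, map_smul, map_sub,
    map_add, h.nabla_apply]
  module

theorem affineCurv_add_right (h : G.IsLeviCivita cov) (X Y Z Z' : VField V M) (x : M) :
    affineCurv cov X Y (Z + Z' : VField V M) x
      = affineCurv cov X Y Z x + affineCurv cov X Y Z' x := by
  simp only [h.affineCurv_eq, h.nabla_add_right, cov_add, add_apply]
  abel

theorem affineCurv_smulFn_right (h : G.IsLeviCivita cov) (f : C^∞⟮𝓘(ℝ, V), M; ℝ⟯) (X Y Z : VField V M) (x : M) :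
    affineCurv cov X Y (smulFn f Z) x = f x • affineCurv cov X Y Z x := by
  have h1 := h.df_commutator X Y f x
  have h2 : ∀ X, lieDer X f x = df f x (X x) := fun X ↦ rfl
  simp only [h.affineCurv_eq, h.nabla_smulFn_right, cov_add, cov_smulFn, h1, h.nabla_apply,
    add_apply, h2]
  module

/-- The curvature of `∇` is a tensor. -/
theorem affineCurv_congr (h : G.IsLeviCivita cov) {X X' Y Y' Z Z' : VField V M} {x : M} (hX : X x = X' x)
    (hY : Y x = Y' x) (hZ : Z x = Z' x) :
    affineCurv cov X Y Z x = affineCurv cov X' Y' Z' x := by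
  rw [map_eq_of_tensorial (fun X : VField V M ↦ affineCurv cov X Y Z x)
      (fun X X' ↦ h.affineCurv_add_left X X' Y Z x)
      (fun f X ↦ h.affineCurv_smulFn_left f X Y Z x) hX,
    h.affineCurv_swap,
    map_eq_of_tensorial (fun Y : VField V M ↦ affineCurv cov Y X' Z x)
      (fun Y Y' ↦ h.affineCurv_add_left Y Y' X' Z x)
      (fun f Y ↦ h.affineCurv_smulFn_left f Y X' Z x) hY,
    ← h.affineCurv_swap]
  exact map_eq_of_tensorial (fun Z : VField V M ↦ affineCurv cov X' Y' Z x)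
      (fun Z Z' ↦ h.affineCurv_add_right X' Y' Z Z' x)
      (fun f Z ↦ h.affineCurv_smulFn_right f X' Y' Z x) hZ

/-- The algebraic Bianchi identity. -/
theorem bianchi (h : G.IsLeviCivita cov) (X Y Z : VField V M) (x : M) :
    affineCurv cov X Y Z x + affineCurv cov Y Z X x + affineCurv cov Z X Y x = 0 := by
  obtain ⟨p, hp⟩ := A.anchor_surjective x (X x)
  obtain ⟨q, hq⟩ := A.anchor_surjective x (Y x)
  obtain ⟨r, hr⟩ := A.anchor_surjective x (Z x)
  obtain ⟨u, rfl⟩ := exists_sec_eq V F x p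
  obtain ⟨v, rfl⟩ := exists_sec_eq V F x q
  obtain ⟨w, rfl⟩ := exists_sec_eq V F x r
  have hX : X x = A.tan u x := hp.symm
  have hY : Y x = A.tan v x := hq.symm
  have hZ : Z x = A.tan w x := hr.symm
  rw [h.affineCurv_congr hX hY hZ, h.affineCurv_congr hY hZ hX, h.affineCurv_congr hZ hX hY]
  have hbr : ∀ u v : Sec V F E,
      A.tan (A.bracket u v) = h.nabla (A.tan u) (A.tan v) - h.nabla (A.tan v) (A.tan u) :=
    fun u v ↦ by
      ext y
      exact h.torsion u v y
  have hbr' : ∀ u v w : Sec V F E, A.anchor x (A.bracket u (A.bracket v w) x)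
      = cov (h.nabla (A.tan v) (A.tan w)) x (A.tan u x)
        - cov (h.nabla (A.tan w) (A.tan v)) x (A.tan u x)
        - cov (A.tan u) x (cov (A.tan w) x (A.tan v x) - cov (A.tan v) x (A.tan w x)) :=
    fun u v w ↦ by
      have h1 := h.torsion u (A.bracket v w) x
      have h2 : A.anchor x (A.bracket v w x) = _ := h.torsion v w x
      rw [h2] at h1
      change _ = cov (A.tan (A.bracket v w)) x _ - _ at h1
      rw [hbr, cov_sub] at h1
      exact h1
  have hsw : A.anchor x (A.bracket (A.bracket u v) w x)
      = -A.anchor x (A.bracket w (A.bracket u v) x) := by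
    rw [A.anchor_bracket, A.anchor_bracket, VectorField.mlieBracket_swap_apply]
  -- The anchor of the Courant Jacobi identity is the Jacobi identity for commutators of `∇`, and
  -- that is the Bianchi identity written out.
  have hj := congrArg (fun s : Sec V F E ↦ A.anchor x (s x)) (A.jacobi u v w)
  have h0 : A.anchor x ((A.bracket (A.bracket u v) w + A.bracket v (A.bracket u w)) x)
      = A.anchor x (A.bracket (A.bracket u v) w x) + A.anchor x (A.bracket v (A.bracket u w) x) :=
    map_add _ _ _
  simp only [h0, hsw, hbr'] at hj
  rw [h.affineCurv_eq, h.affineCurv_eq, h.affineCurv_eq]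
  simp only [map_sub] at hj ⊢
  rw [← sub_eq_zero] at hj
  rw [← hj]
  abel

/-- The curvature depends only on germs of vector fields. -/
theorem affineCurv_congr_of_eventuallyEq (h : G.IsLeviCivita cov) {X Y Z : Π x : M, TangentSpace 𝓘(ℝ, V) x}
    {X' Y' Z' : VField V M} {x : M} (hX : ∀ᶠ y in 𝓝 x, X y = X' y)
    (hY : ∀ᶠ y in 𝓝 x, Y y = Y' y) (hZ : ∀ᶠ y in 𝓝 x, Z y = Z' y) :
    affineCurv cov X Y Z x = affineCurv cov X' Y' Z' x := by
  have hcov : ∀ {U : Π x : M, TangentSpace 𝓘(ℝ, V) x} {U' : VField V M} {y : M},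
      (∀ᶠ z in 𝓝 y, U z = U' z) → cov U y = cov U' y := by
    intro U U' y hU
    refine cov.isCovariantDerivativeOnUniv.congr_of_eventuallyEq ?_ U'.mdifferentiableAt
      Filter.univ_mem hU
    refine U'.mdifferentiableAt.congr_of_eventuallyEq ?_
    filter_upwards [hU] with z hz
    rw [hz]
  have h1 : ∀ {W : Π x : M, TangentSpace 𝓘(ℝ, V) x} {W' : VField V M},
      (∀ᶠ y in 𝓝 x, W y = W' y) →
      cov (fun y ↦ cov Z y (W y)) x = cov (h.nabla W' Z') x := by
    intro W W' hW
    refine hcov ?_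
    filter_upwards [hW, eventually_eventually_nhds.2 hZ] with y hy hzy
    rw [hcov hzy, hy, h.nabla_apply]
  have h2 : VectorField.mlieBracket 𝓘(ℝ, V) X Y x = VectorField.mlieBracket 𝓘(ℝ, V) X' Y' x :=
    Filter.EventuallyEq.mlieBracket_vectorField_eq hX hY
  rw [affineCurv, h1 hX, h1 hY, h2, hcov hZ, hX.self_of_nhds, hY.self_of_nhds]
  rfl

end IsLeviCivita

/-- The local extension of a tangent vector agrees with a smooth vector field near the point. -/
theorem exists_eventuallyEq_extend {x : M} (X : TangentSpace 𝓘(ℝ, V) x) :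
    ∃ X' : VField V M, (∀ᶠ y in 𝓝 x, FiberBundle.extend V X y = X' y) ∧ X' x = X := by
  obtain ⟨s, hs, hsm⟩ := FiberBundle.exists_contMDiffOn_extend (k := ∞) 𝓘(ℝ, V) V X
  obtain ⟨t, hts, hto, hxt⟩ := mem_nhds_iff.1 hs
  obtain ⟨χ, hχx, hχ1, hχ⟩ := exists_bump_eq (V := V) x (hto.mem_nhds hxt)
  have key : ∀ᶠ y in 𝓝 x, FiberBundle.extend V X y
      = cutSec χ hto hχ (FiberBundle.extend V X) (hsm.mono hts) y := by
    filter_upwards [hχ1] with y hy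
    change _ = χ y • FiberBundle.extend V X y
    rw [hy, one_smul]
  exact ⟨_, key, by rw [← key.self_of_nhds]; simp⟩

end GenMetric


namespace GenMetric

variable {A : ExactCourantAlgebroid V F E} {G : GenMetric A.toCourantAlgebroid}
  {cov : CovariantDerivative 𝓘(ℝ, V) V (TangentSpace 𝓘(ℝ, V) : M → Type _)}

/-! ### Traces and the Ricci tensor in an orthogonal frame -/

theorem Frame.trace_eq {x : M} (f : G.Frame x)
    (T : TangentSpace 𝓘(ℝ, V) x →ₗ[ℝ] TangentSpace 𝓘(ℝ, V) x) :
    LinearMap.trace ℝ (TangentSpace 𝓘(ℝ, V) x) T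
      = ∑ j, (f.η j)⁻¹ * G.metric x (T (f.e j)) (f.e j) := by
  rw [LinearMap.trace_eq_matrix_trace ℝ f.e, Matrix.trace]
  refine Finset.sum_congr rfl fun i _ ↦ ?_
  rw [Matrix.diag_apply, LinearMap.toMatrix_apply, f.metric_apply_e, mul_left_comm,
    inv_mul_cancel₀ (f.ne_zero i), mul_one]

theorem Frame.divergence_eq {x : M} (f : G.Frame x) (X : Π x : M, TangentSpace 𝓘(ℝ, V) x) :
    divergence cov X x = ∑ j, (f.η j)⁻¹ * G.metric x (cov X x (f.e j)) (f.e j) :=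
  f.trace_eq _

/-- The endomorphism `X ↦ R(X, Y) Z` of the tangent space. -/
def IsLeviCivita.curvEnd (h : G.IsLeviCivita cov) (x : M) (Y Z : VField V M) :
    TangentSpace 𝓘(ℝ, V) x →ₗ[ℝ] TangentSpace 𝓘(ℝ, V) x where
  toFun X := affineCurv cov (extSec V V X : VField V M) Y Z x
  map_add' X X' := by
    rw [← h.affineCurv_add_left]
    exact h.affineCurv_congr (by simp [extSec_apply]) rfl rfl
  map_smul' r X := by
    refine Eq.trans ?_ (h.affineCurv_smulFn_left (ContMDiffMap.const r) _ _ _ _)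
    exact h.affineCurv_congr (by simp [extSec_apply]; rfl) rfl rfl

theorem IsLeviCivita.curvEnd_apply (h : G.IsLeviCivita cov) {x : M} (X Y Z : VField V M) :
    h.curvEnd x Y Z (X x) = affineCurv cov X Y Z x :=
  h.affineCurv_congr (extSec_apply V V _) rfl rfl

/-- The local extensions in the definition are first replaced by global fields with the same germs;
the trace of the resulting endomorphism does not depend on the basis. -/
theorem IsLeviCivita.ricciTensor_eq (h : G.IsLeviCivita cov) {x : M} (f : G.Frame x)
    (Y Z : VField V M) (X : Fin (finrank ℝ V) → VField V M) (hX : ∀ j, X j x = f.e j) :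
    ricciTensor cov x (Y x) (Z x)
      = ∑ j, (f.η j)⁻¹ * G.metric x (affineCurv cov (X j) Y Z x) (f.e j) := by
  have h1 : ricciTensor cov x (Y x) (Z x)
      = LinearMap.trace ℝ (TangentSpace 𝓘(ℝ, V) x) (h.curvEnd x Y Z) := by
    rw [LinearMap.trace_eq_matrix_trace ℝ (tbasis M x), Matrix.trace, ricciTensor]
    refine Finset.sum_congr rfl fun i _ ↦ ?_
    rw [Matrix.diag_apply, LinearMap.toMatrix_apply, Basis.coord_apply]
    obtain ⟨X', hX', hX'x⟩ := exists_eventuallyEq_extend (V := V) (tbasis M x i)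
    obtain ⟨Y', hY', hY'x⟩ := exists_eventuallyEq_extend (V := V) (Y x)
    obtain ⟨Z', hZ', hZ'x⟩ := exists_eventuallyEq_extend (V := V) (Z x)
    rw [h.affineCurv_congr_of_eventuallyEq hX' hY' hZ']
    rw [h.affineCurv_congr (X' := X') rfl hY'x hZ'x, ← h.curvEnd_apply, hX'x]
  rw [h1, f.trace_eq]
  refine Finset.sum_congr rfl fun j _ ↦ ?_
  rw [← hX, h.curvEnd_apply]

/-! ### Normal sections -/

theorem tan_add (u v : Sec V F E) : A.tan (u + v) = A.tan u + A.tan v := by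
  ext x
  exact map_add (A.anchor x) (u x) (v x)

theorem tan_smulFn (f : C^∞⟮𝓘(ℝ, V), M; ℝ⟯) (u : Sec V F E) :
    A.tan (smulFn f u) = smulFn f (A.tan u) := by
  ext x
  exact map_smul (A.anchor x) (f x) (u x)

/-- A sum of terms `f_j t_j` works, where `t_j` lies over the basis vector `b j`, `f_j` vanishes at
`x` and its differential there is the `j`-th component of `L`. -/
theorem exists_split_cov_eq (cov : CovariantDerivative 𝓘(ℝ, V) V (TangentSpace 𝓘(ℝ, V) : M → Type _))
    (x : M) (L : TangentSpace 𝓘(ℝ, V) x →L[ℝ] TangentSpace 𝓘(ℝ, V) x) :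
    ∃ s : Sec V F E, G.IsSplit s ∧ A.anchor x (s x) = 0 ∧ cov (A.tan s) x = L := by
  classical
  let b := tbasis (V := V) M x
  have key : ∀ S : Finset (Fin (finrank ℝ V)), ∃ s : Sec V F E, G.IsSplit s ∧
      A.anchor x (s x) = 0 ∧ ∀ X, cov (A.tan s) x X = ∑ j ∈ S, b.repr (L X) j • b j := by
    intro S
    induction S using Finset.induction_on with
    | empty =>
      refine ⟨0, fun y ↦ by simp, by simp, fun X ↦ ?_⟩
      have h0 : A.tan (0 : Sec V F E) = 0 := by
        ext y
        exact map_zero (A.anchor y)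
      have h1 : cov (0 : VField V M) x = 0 := congr_fun cov.zero x
      rw [h0, h1]
      simp
    | insert j S hj ih =>
      obtain ⟨s, hs, hsx, hcov⟩ := ih
      obtain ⟨t, ht, htx⟩ := G.exists_split_anchor_eq x (b j)
      obtain ⟨f, hfx, hf⟩ := exists_fun_mvfderiv_eq (V := V) x
        (LinearMap.toContinuousLinearMap ((b.coord j).comp L.toLinearMap))
      refine ⟨s + smulFn f t, hs.add G (ht.smulFn G f), ?_, fun X ↦ ?_⟩
      · have h1 : (s + smulFn f t) x = s x + f x • t x := rfl
        rw [h1, hfx, zero_smul, add_zero, hsx]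
      · have h2 : df f x X = b.repr (L X) j := hf X
        rw [tan_add, tan_smulFn, cov_add, add_apply, hcov, cov_smulFn, hfx, h2,
          zero_smul, zero_add, A.tan_apply, htx, Finset.sum_insert hj, add_comm]
  obtain ⟨s, hs, hsx, hcov⟩ := key Finset.univ
  refine ⟨s, hs, hsx, ?_⟩
  ext X
  rw [hcov]
  exact b.sum_repr (L X)

variable (G cov) in
/-- A section of `s(TM)` whose anchor is parallel at `x`. -/
structure IsNormal (x : M) (s : Sec V F E) : Prop where
  split : G.IsSplit s
  cov_eq : cov (A.tan s) x = 0

variable (G cov) in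
-- Any split extension is corrected by a split section that vanishes at `x` and carries the opposite
-- covariant derivative there.
theorem exists_normal (x : M) (X : TangentSpace 𝓘(ℝ, V) x) :
    ∃ s : Sec V F E, G.IsNormal cov x s ∧ A.anchor x (s x) = X := by
  obtain ⟨s, hs, hsx⟩ := G.exists_split_anchor_eq x X
  obtain ⟨t, ht, htx, hcov⟩ := exists_split_cov_eq (G := G) cov x (-cov (A.tan s) x)
  refine ⟨s + t, ⟨hs.add G ht, ?_⟩, ?_⟩
  · rw [tan_add, cov_add, hcov, add_neg_cancel]
  · have h1 : (s + t) x = s x + t x := rfl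
    rw [h1, map_add, hsx, htx, add_zero]

theorem metric_ext {x : M} {X Y : TangentSpace 𝓘(ℝ, V) x}
    (hXY : ∀ Z, G.metric x X Z = G.metric x Y Z) : X = Y := by
  refine sub_eq_zero.1 ((G.metric_nondeg x).1 _ fun Z ↦ ?_)
  simp [hXY]

namespace IsLeviCivita

/-- The vector field `∇_S T` is the anchor of a smooth section. -/
theorem exists_sec_nabla (h : G.IsLeviCivita cov) {s t : Sec V F E} (hs : G.IsSplit s)
    (ht : G.IsSplit t) : ∃ n : Sec V F E, A.tan n = h.nabla (A.tan s) (A.tan t) := by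
  -- The two mixed brackets represent `∇_S T` with corrections by `H` of opposite signs, so their
  -- average has none.
  refine ⟨(1 / 2 : ℝ) • (G.proj 1 (A.bracket (G.lft (-1) s) (G.lft 1 t))
    + G.proj (-1) (A.bracket (G.lft 1 s) (G.lft (-1) t))), ?_⟩
  ext y
  change A.anchor y ((1 / 2 : ℝ) • (_ + _)) = cov (A.anchorField t) y (A.anchor y (s y))
  refine metric_ext (G := G) fun W ↦ ?_
  obtain ⟨r, hr, rfl⟩ := G.exists_split_anchor_eq y W
  have key : ∀ ε : ℤˣ, G.metric y (A.anchor y (G.proj ε (A.bracket (G.lft (-ε) s) (G.lft ε t)) y))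
      (A.anchor y (r y)) = G.metric y (cov (A.anchorField t) y (A.anchor y (s y)))
        (A.anchor y (r y)) + sgn ε * ((1 / 2) * G.threeForm y (A.anchor y (s y))
          (A.anchor y (t y)) (A.anchor y (r y))) := by
    intro ε
    have h1 := G.metric_eq_pairing (G.isSec_proj ε (A.bracket (G.lft (-ε) s) (G.lft ε t)) y)
      (G.isSec_lft ε r y)
    rw [G.anchor_lft hr, proj_apply, G.pairing_projAt_left _ (G.isSec_lft ε r y),
      pairing_bracket_lft h ε hs ht hr] at h1
    rw [proj_apply, h1]
    linear_combination G.metric y (cov (A.anchorField t) y (A.anchor y (s y)))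
      (A.anchor y (r y)) * sgn_mul_self ε
  have h1 := key 1
  have h2 := key (-1)
  rw [neg_neg] at h2
  simp only [map_smul, map_add, LinearMap.smul_apply, LinearMap.add_apply, smul_eq_mul]
  rw [h1, h2]
  simp [sgn]
  ring

/-- The derivative of the function `g(∇_S T, R)`. -/
theorem exists_fun_metric_nabla (h : G.IsLeviCivita cov) {s t r : Sec V F E} (hs : G.IsSplit s)
    (ht : G.IsSplit t) (hr : G.IsSplit r) :
    ∃ φ : C^∞⟮𝓘(ℝ, V), M; ℝ⟯,
      (∀ y, φ y = G.metric y (cov (A.tan t) y (A.tan s y)) (A.tan r y)) ∧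
      ∀ x X, df φ x X = G.metric x (cov (h.nabla (A.tan s) (A.tan t)) x X) (A.tan r x)
        + G.metric x (cov (A.tan t) x (A.tan s x)) (cov (A.tan r) x X) := by
  obtain ⟨n, hn⟩ := h.exists_sec_nabla hs ht
  have hn' : ∀ y, A.anchor y (n y) = cov (A.tan t) y (A.tan s y) := fun y ↦
    congrArg (fun Z : VField V M ↦ Z y) hn
  have hφ : ∀ y, ((2 : ℝ) • A.pair (G.endoSec r) n : C^∞⟮𝓘(ℝ, V), M; ℝ⟯) y
      = G.metric y (cov (A.tan t) y (A.tan s y)) (A.tan r y) := by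
    intro y
    change 2 * A.pairing y (G.endo y (r y)) (n y) = _
    rw [G.pairing_endo_of_isSplit hr, hn', G.metric_symm]
    simp
  refine ⟨_, hφ, fun x X ↦ ?_⟩
  have h1 := h.df_eq (one_ne_zero) (Y := h.nabla (A.tan s) (A.tan t)) (Z := A.tan r)
    (fun y ↦ (hφ y).trans (one_mul _).symm) x X
  rw [h1, one_mul]
  rfl

/-- For fields parallel at `x` the two curvature components add up to the commutator of `S` and `T`
applied to the function `g(R,W)`, and this commutator vanishes at `x`. -/
theorem metric_affineCurv_swap (h : G.IsLeviCivita cov) (X Y Z W : VField V M) (x : M) :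
    G.metric x (affineCurv cov X Y Z x) (W x) = -G.metric x (affineCurv cov X Y W x) (Z x) := by
  obtain ⟨s, hs, hsx⟩ := G.exists_normal cov x (X x)
  obtain ⟨t, ht, htx⟩ := G.exists_normal cov x (Y x)
  obtain ⟨r, hr, hrx⟩ := G.exists_normal cov x (Z x)
  obtain ⟨w, hw, hwx⟩ := G.exists_normal cov x (W x)
  have key : ∀ r w : Sec V F E, G.IsNormal cov x r → G.IsNormal cov x w →
      ∃ φ ψ : C^∞⟮𝓘(ℝ, V), M; ℝ⟯,
      (∀ y, φ y = G.metric y (cov (A.tan r) y (A.tan t y)) (A.tan w y)) ∧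
      (∀ y, ψ y = G.metric y (cov (A.tan r) y (A.tan s y)) (A.tan w y)) ∧
      G.metric x (affineCurv cov (A.tan s) (A.tan t) (A.tan r) x) (A.tan w x)
        = df φ x (A.tan s x) - df ψ x (A.tan t x) := by
    intro r w hr hw
    obtain ⟨φ, hφ, hφ'⟩ := h.exists_fun_metric_nabla ht.split hr.split hw.split
    obtain ⟨ψ, hψ, hψ'⟩ := h.exists_fun_metric_nabla hs.split hr.split hw.split
    refine ⟨φ, ψ, hφ, hψ, ?_⟩
    rw [hφ', hψ', h.affineCurv_eq, hr.cov_eq, hw.cov_eq]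
    simp
  have hsk : G.metric x (affineCurv cov (A.tan s) (A.tan t) (A.tan r) x) (A.tan w x)
      = -G.metric x (affineCurv cov (A.tan s) (A.tan t) (A.tan w) x) (A.tan r x) := by
    obtain ⟨φ, ψ, hφ, hψ, e1⟩ := key r w hr hw
    obtain ⟨φ', ψ', hφ', hψ', e2⟩ := key w r hw hr
    let k : C^∞⟮𝓘(ℝ, V), M; ℝ⟯ := (2 : ℝ) • A.pair (G.endoSec r) w
    have hk : ∀ y, k y = 1 * G.metric y (A.tan r y) (A.tan w y) := fun y ↦ by
      change 2 * A.pairing y (G.endo y (r y)) (w y) = _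
      rw [G.pairing_endo_of_isSplit hr.split]
      simp
    have hkd := fun y ↦ h.df_eq one_ne_zero hk y
    have h1 : lieDer (A.tan t) k = φ + φ' := by
      ext y
      change df k y (A.tan t y) = φ y + φ' y
      rw [hkd, hφ, hφ', one_mul, G.metric_symm y (A.tan r y)]
    have h2 : lieDer (A.tan s) k = ψ + ψ' := by
      ext y
      change df k y (A.tan s y) = ψ y + ψ' y
      rw [hkd, hψ, hψ', one_mul, G.metric_symm y (A.tan r y)]
    have h3 := h.df_commutator (A.tan s) (A.tan t) k x
    rw [hs.cov_eq, ht.cov_eq, h1, h2, df_add, df_add] at h3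
    simp only [zero_apply, sub_zero, map_zero] at h3
    rw [e1, e2]
    linarith
  have h1 : X x = A.tan s x := hsx.symm
  have h2 : Y x = A.tan t x := htx.symm
  have h3 : Z x = A.tan r x := hrx.symm
  have h4 : W x = A.tan w x := hwx.symm
  rw [h.affineCurv_congr h1 h2 h3, h.affineCurv_congr h1 h2 h4, h3, h4, hsk]

/-- This is the trace of the algebraic Bianchi identity: its middle term `g(R(Y,Z)X_j, X_j)`
vanishes by skew-symmetry. -/
theorem ricciTensor_symm (h : G.IsLeviCivita cov) {x : M} (Y Z : TangentSpace 𝓘(ℝ, V) x) :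
    ricciTensor cov x Y Z = ricciTensor cov x Z Y := by
  obtain ⟨f⟩ := G.nonempty_frame x
  let X : Fin (finrank ℝ V) → VField V M := fun j ↦ extSec V V (f.e j)
  have hX : ∀ j, X j x = f.e j := fun j ↦ extSec_apply V V _
  obtain ⟨Y, rfl⟩ := exists_sec_eq V V x Y
  obtain ⟨Z, rfl⟩ := exists_sec_eq V V x Z
  rw [h.ricciTensor_eq f Y Z X hX, h.ricciTensor_eq f Z Y X hX]
  refine Finset.sum_congr rfl fun j _ ↦ ?_
  congr 1
  have h1 := congrArg (fun W ↦ G.metric x W (X j x)) (h.bianchi (X j) Y Z x)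
  have h2 := h.metric_affineCurv_swap Y Z (X j) (X j) x
  have h3 := h.affineCurv_swap Z (X j) Y x
  simp only [h3, map_add, map_neg, LinearMap.add_apply, LinearMap.neg_apply, map_zero,
    LinearMap.zero_apply] at h1
  rw [hX] at h1 h2
  linarith

end IsLeviCivita

end GenMetric


/-! ### The quadratic terms of the curvature and their traces -/

namespace GenMetric

variable {A : ExactCourantAlgebroid V F E} {G : GenMetric A.toCourantAlgebroid}

namespace Frame

variable {x : M} (f : G.Frame x)

/-- The contraction of two covectors with `g` is the same in every pair of dual bases; `H²` thereby
passes to the orthogonal frame. -/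
theorem sum_tbasis_mul (L L' : TangentSpace 𝓘(ℝ, V) x →ₗ[ℝ] ℝ) :
    ∑ i, L (tbasis M x i) * L' (G.tcobasis x i) = ∑ j, (f.η j)⁻¹ * (L (f.e j) * L' (f.e j)) := by
  have h1 : ∀ v, ∑ i, G.metric x v (tbasis M x i) * L' (G.tcobasis x i) = L' v := by
    intro v
    conv_rhs => rw [← (G.tcobasis x).sum_repr v]
    rw [map_sum]
    refine Finset.sum_congr rfl fun i _ ↦ ?_
    rw [map_smul, smul_eq_mul]
    congr 1
    exact (LinearMap.BilinForm.dualBasis_repr_apply (hB := G.metric_nondeg x)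
      (b := tbasis M x) v i).symm
  have h2 : ∀ i, L (tbasis M x i) * L' (G.tcobasis x i)
      = ∑ j, (f.η j)⁻¹ * L (f.e j) * (G.metric x (f.e j) (tbasis M x i) * L' (G.tcobasis x i)) := by
    intro i
    rw [← f.sum_metric_mul L, Finset.sum_mul]
    refine Finset.sum_congr rfl fun j _ ↦ ?_
    rw [G.metric_symm x (f.e j)]
    ring
  simp only [h2]
  rw [Finset.sum_comm]
  refine Finset.sum_congr rfl fun j _ ↦ ?_
  rw [← Finset.mul_sum, h1]
  ring

theorem threeFormSq_eq (X Y : TangentSpace 𝓘(ℝ, V) x) :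
    G.threeFormSq x X Y = ∑ j, ∑ k, (f.η j)⁻¹ * ((f.η k)⁻¹ *
      (G.threeForm x X (f.e j) (f.e k) * G.threeForm x Y (f.e j) (f.e k))) := by
  have h1 : ∀ U W : TangentSpace 𝓘(ℝ, V) x,
      ∑ k, G.threeForm x X U (tbasis M x k) * G.threeForm x Y W (G.tcobasis x k)
        = ∑ k, (f.η k)⁻¹ * (G.threeForm x X U (f.e k) * G.threeForm x Y W (f.e k)) :=
    fun U W ↦ by
      simpa only [threeFormRight_apply] using
        f.sum_tbasis_mul (G.threeFormRight x X U) (G.threeFormRight x Y W)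
  rw [threeFormSq]
  simp only [h1]
  rw [Finset.sum_comm]
  conv_rhs => rw [Finset.sum_comm]
  refine Finset.sum_congr rfl fun k _ ↦ ?_
  have h2 : ∀ U Z : TangentSpace 𝓘(ℝ, V) x,
      G.threeForm x Z U (f.e k) = -G.threeFormRight x Z (f.e k) U := fun U Z ↦ by
    rw [threeFormRight_apply, ← G.threeForm_swap_right]
  have h3 := f.sum_tbasis_mul (G.threeFormRight x X (f.e k)) (G.threeFormRight x Y (f.e k))
  simp only [h2, neg_mul_neg]
  rw [← Finset.mul_sum, h3, Finset.mul_sum]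
  exact Finset.sum_congr rfl fun j _ ↦ by ring

theorem sum_metric_self : ∑ j, (f.η j)⁻¹ * G.metric x (f.e j) (f.e j) = finrank ℝ V := by
  simp [f.metric_eq, f.ne_zero]

end Frame

variable (G) in
/-- The tensor `⟨D_U V, W⟩` at a point, for sections of `E_±` with parallel anchors. -/
def connForm (x : M) (c : ℝ) (X U Y W : TangentSpace 𝓘(ℝ, V) x) : ℝ :=
  (1 / 6) * G.threeForm x U Y W
    + c * (G.metric x U Y * G.metric x X W - G.metric x X Y * G.metric x U W)

variable (G) in
/-- The terms of `2 Rm` that are quadratic in the connection form. -/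
def quadTerm (x : M) (c : ℝ) (X S T R W Z : TangentSpace 𝓘(ℝ, V) x) : ℝ :=
  -G.connForm x c X T R Z * G.connForm x c X S W Z + G.connForm x c X S R Z * G.connForm x c X T W Z
    - (1 / 2) * G.threeForm x Z S T * (G.connForm x c X Z R W - (1 / 2) * G.threeForm x Z R W)

variable (G) in
/-- The terms of the trace in `2 Rm`. -/
def traceTerm (x : M) (c : ℝ) (X S T R W Z : TangentSpace 𝓘(ℝ, V) x) : ℝ :=
  G.connForm x c X Z S T * G.connForm x c X Z R W
    - (1 / 2) * G.threeForm x Z S T * ((1 / 2) * G.threeForm x Z R W)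

namespace Frame

variable {x : M} (f : G.Frame x)

/-- The expansion is grouped so that each `k`-dependent factor is a product of two metric or `H`
terms to which Parseval's identity in `k` applies. The coefficient of `H·H` is `-1/36 - 1/6` from
each quadratic term and `1/4 - 1/36` from the trace term, in total `-1/6`. -/
theorem quadTerm_eq (c : ℝ) (X U Y : TangentSpace 𝓘(ℝ, V) x) (j k : Fin (finrank ℝ V)) :
    G.quadTerm x c X (f.e j) Y U (f.e j) (f.e k) + G.quadTerm x c X U (f.e j) (f.e j) Y (f.e k)
      + G.traceTerm x c X (f.e j) Y U (f.e j) (f.e k)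
    = -(1 / 6) * (G.threeForm x U (f.e j) (f.e k) * G.threeForm x Y (f.e j) (f.e k))
      + (c / 2) * G.metric x X (f.e j) * (G.metric x Y (f.e k) * G.threeForm x U (f.e j) (f.e k)
        + G.metric x U (f.e k) * G.threeForm x Y (f.e j) (f.e k))
      + c ^ 2 * (G.metric x X (f.e k) * G.metric x X (f.e k)
          * (2 * (G.metric x U (f.e j) * G.metric x Y (f.e j))
            - 2 * G.metric x U Y * G.metric x (f.e j) (f.e j))
        + G.metric x X (f.e k) * G.metric x U (f.e k)
          * (G.metric x X Y * G.metric x (f.e j) (f.e j)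
            - G.metric x X (f.e j) * G.metric x Y (f.e j))
        + G.metric x X (f.e k) * G.metric x Y (f.e k)
          * (G.metric x X U * G.metric x (f.e j) (f.e j)
            - G.metric x X (f.e j) * G.metric x U (f.e j))
        + G.metric x X (f.e k) * G.metric x (f.e j) (f.e k)
          * (2 * G.metric x U Y * G.metric x X (f.e j) - G.metric x X U * G.metric x Y (f.e j)
            - G.metric x X Y * G.metric x U (f.e j))
        - G.metric x U (f.e k) * G.metric x Y (f.e k)
          * (G.metric x X (f.e j) * G.metric x X (f.e j))
        + G.metric x Y (f.e k) * G.metric x (f.e j) (f.e k)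
          * (G.metric x X U * G.metric x X (f.e j))
        + G.metric x U (f.e k) * G.metric x (f.e j) (f.e k)
          * (G.metric x X Y * G.metric x X (f.e j))
        - G.metric x (f.e j) (f.e k) * G.metric x (f.e j) (f.e k)
          * (G.metric x X U * G.metric x X Y)) := by
  -- `H` vanishes for `j = k` and the metric for `j ≠ k`.
  have h0 : ∀ Z : TangentSpace 𝓘(ℝ, V) x,
      G.threeForm x Z (f.e j) (f.e k) * G.metric x (f.e j) (f.e k) = 0 := by
    intro Z
    by_cases hjk : j = k
    · subst hjk
      rw [G.threeForm_self_right, zero_mul]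
    · rw [f.metric_eq, if_neg hjk, mul_zero]
  have hU := h0 U
  have hY := h0 Y
  have a1 : G.threeForm x (f.e j) U (f.e k) = -G.threeForm x U (f.e j) (f.e k) :=
    G.threeForm_swap_left x _ _ _
  have a2 : G.threeForm x (f.e j) Y (f.e k) = -G.threeForm x Y (f.e j) (f.e k) :=
    G.threeForm_swap_left x _ _ _
  have a3 : G.threeForm x (f.e k) (f.e j) Y = -G.threeForm x Y (f.e j) (f.e k) := by
    rw [G.threeForm_swap_right, G.threeForm_rotate x (f.e k) Y (f.e j)]
  have a4 : G.threeForm x (f.e k) U (f.e j) = G.threeForm x U (f.e j) (f.e k) :=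
    G.threeForm_rotate x _ _ _
  have a5 : G.threeForm x Y U (f.e k) = -G.threeForm x U Y (f.e k) := G.threeForm_swap_left x _ _ _
  have a6 : G.threeForm x (f.e j) (f.e j) (f.e k) = 0 := G.threeForm_self_left x _ _
  simp only [quadTerm, traceTerm, connForm, a1, a2, a3, a4, a5, a6, G.metric_symm x Y U,
    G.metric_symm x (f.e j) U, G.metric_symm x (f.e j) Y, G.metric_symm x (f.e k) U,
    G.metric_symm x (f.e k) Y, G.metric_symm x (f.e k) (f.e j)]
  linear_combination (-(c / 2) * G.metric x X Y) * hU + (-(c / 2) * G.metric x X U) * hY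

theorem sum_quadTerm (c : ℝ) (X U Y : TangentSpace 𝓘(ℝ, V) x) :
    ∑ j, (f.η j)⁻¹ * ∑ k, (f.η k)⁻¹ * (G.quadTerm x c X (f.e j) Y U (f.e j) (f.e k)
      + G.quadTerm x c X U (f.e j) (f.e j) Y (f.e k)
      + G.traceTerm x c X (f.e j) Y U (f.e j) (f.e k))
    = -(1 / 6) * G.threeFormSq x U Y
      + c ^ 2 * ((3 - 2 * finrank ℝ V) * (G.metric x X X * G.metric x U Y)
        + (finrank ℝ V - 2) * (G.metric x X U * G.metric x X Y)) := by
  have hk : ∀ j, ∑ k, (f.η k)⁻¹ * (G.quadTerm x c X (f.e j) Y U (f.e j) (f.e k)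
      + G.quadTerm x c X U (f.e j) (f.e j) Y (f.e k)
      + G.traceTerm x c X (f.e j) Y U (f.e j) (f.e k))
      = -(1 / 6) * (∑ k, (f.η k)⁻¹
          * (G.threeForm x U (f.e j) (f.e k) * G.threeForm x Y (f.e j) (f.e k)))
        + c ^ 2 * ((G.metric x X U * G.metric x X Y - 2 * G.metric x X X * G.metric x U Y)
            * G.metric x (f.e j) (f.e j)
          + 2 * G.metric x X X * (G.metric x U (f.e j) * G.metric x Y (f.e j))
          + G.metric x U Y * (G.metric x X (f.e j) * G.metric x X (f.e j))
          - G.metric x X U * (G.metric x X (f.e j) * G.metric x Y (f.e j))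
          - G.metric x X Y * (G.metric x X (f.e j) * G.metric x U (f.e j))) := by
    intro j
    simp only [quadTerm_eq]
    have e1 := f.sum_metric_mul (G.threeFormRight x U (f.e j)) Y
    have e2 := f.sum_metric_mul (G.threeFormRight x Y (f.e j)) U
    -- After summation over `k` the products of `H` with `e` cancel, as `H` is skew under exchange
    -- of `U` and `Y`.
    have e3 : G.threeFormRight x U (f.e j) Y + G.threeFormRight x Y (f.e j) U = 0 := by
      rw [threeFormRight_apply, threeFormRight_apply, G.threeForm_rotate x Y,
        G.threeForm_swap_left x (f.e j), add_neg_cancel]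
    simp only [threeFormRight_apply] at e1 e2 e3
    trans -(1 / 6) * (∑ k, (f.η k)⁻¹
          * (G.threeForm x U (f.e j) (f.e k) * G.threeForm x Y (f.e j) (f.e k)))
        + (c / 2) * G.metric x X (f.e j)
          * ((∑ k, (f.η k)⁻¹ * (G.metric x Y (f.e k) * G.threeForm x U (f.e j) (f.e k)))
            + ∑ k, (f.η k)⁻¹ * (G.metric x U (f.e k) * G.threeForm x Y (f.e j) (f.e k)))
        + c ^ 2 * ((∑ k, (f.η k)⁻¹ * (G.metric x X (f.e k) * G.metric x X (f.e k)))
          * (2 * (G.metric x U (f.e j) * G.metric x Y (f.e j))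
            - 2 * G.metric x U Y * G.metric x (f.e j) (f.e j))
        + (∑ k, (f.η k)⁻¹ * (G.metric x X (f.e k) * G.metric x U (f.e k)))
          * (G.metric x X Y * G.metric x (f.e j) (f.e j)
            - G.metric x X (f.e j) * G.metric x Y (f.e j))
        + (∑ k, (f.η k)⁻¹ * (G.metric x X (f.e k) * G.metric x Y (f.e k)))
          * (G.metric x X U * G.metric x (f.e j) (f.e j)
            - G.metric x X (f.e j) * G.metric x U (f.e j))
        + (∑ k, (f.η k)⁻¹ * (G.metric x X (f.e k) * G.metric x (f.e j) (f.e k)))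
          * (2 * G.metric x U Y * G.metric x X (f.e j) - G.metric x X U * G.metric x Y (f.e j)
            - G.metric x X Y * G.metric x U (f.e j))
        - (∑ k, (f.η k)⁻¹ * (G.metric x U (f.e k) * G.metric x Y (f.e k)))
          * (G.metric x X (f.e j) * G.metric x X (f.e j))
        + (∑ k, (f.η k)⁻¹ * (G.metric x Y (f.e k) * G.metric x (f.e j) (f.e k)))
          * (G.metric x X U * G.metric x X (f.e j))
        + (∑ k, (f.η k)⁻¹ * (G.metric x U (f.e k) * G.metric x (f.e j) (f.e k)))
          * (G.metric x X Y * G.metric x X (f.e j))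
        - (∑ k, (f.η k)⁻¹ * (G.metric x (f.e j) (f.e k) * G.metric x (f.e j) (f.e k)))
          * (G.metric x X U * G.metric x X Y))
    · simp only [Finset.mul_sum, Finset.sum_mul, ← Finset.sum_add_distrib,
        ← Finset.sum_sub_distrib]
      exact Finset.sum_congr rfl fun k _ ↦ by ring
    · simp only [f.sum_metric_mul_metric, e1, e2]
      linear_combination (c / 2) * G.metric x X (f.e j) * e3
  simp only [hk]
  have hsum : ∑ j, (f.η j)⁻¹ * (-(1 / 6) * (∑ k, (f.η k)⁻¹
          * (G.threeForm x U (f.e j) (f.e k) * G.threeForm x Y (f.e j) (f.e k)))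
        + c ^ 2 * ((G.metric x X U * G.metric x X Y - 2 * G.metric x X X * G.metric x U Y)
            * G.metric x (f.e j) (f.e j)
          + 2 * G.metric x X X * (G.metric x U (f.e j) * G.metric x Y (f.e j))
          + G.metric x U Y * (G.metric x X (f.e j) * G.metric x X (f.e j))
          - G.metric x X U * (G.metric x X (f.e j) * G.metric x Y (f.e j))
          - G.metric x X Y * (G.metric x X (f.e j) * G.metric x U (f.e j))))
      = -(1 / 6) * (∑ j, ∑ k, (f.η j)⁻¹ * ((f.η k)⁻¹
          * (G.threeForm x U (f.e j) (f.e k) * G.threeForm x Y (f.e j) (f.e k))))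
        + c ^ 2 * ((G.metric x X U * G.metric x X Y - 2 * G.metric x X X * G.metric x U Y)
            * (∑ j, (f.η j)⁻¹ * G.metric x (f.e j) (f.e j))
          + 2 * G.metric x X X * (∑ j, (f.η j)⁻¹ * (G.metric x U (f.e j) * G.metric x Y (f.e j)))
          + G.metric x U Y * (∑ j, (f.η j)⁻¹ * (G.metric x X (f.e j) * G.metric x X (f.e j)))
          - G.metric x X U * (∑ j, (f.η j)⁻¹ * (G.metric x X (f.e j) * G.metric x Y (f.e j)))
          - G.metric x X Y * (∑ j, (f.η j)⁻¹ * (G.metric x X (f.e j) * G.metric x U (f.e j)))) := by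
    simp only [Finset.mul_sum, ← Finset.sum_add_distrib, ← Finset.sum_sub_distrib]
    refine Finset.sum_congr rfl fun j _ ↦ ?_
    rw [mul_add, Finset.mul_sum]
    congr 1
    · exact Finset.sum_congr rfl fun k _ ↦ by ring
    · ring
  rw [hsum, ← f.threeFormSq_eq, f.sum_metric_self]
  simp only [f.sum_metric_mul_metric]
  ring

end Frame

end GenMetric


/-! ### Curvature on sections with parallel anchors -/

namespace GenMetric

variable {A : ExactCourantAlgebroid V F E} {G : GenMetric A.toCourantAlgebroid}
  {cov : CovariantDerivative 𝓘(ℝ, V) V (TangentSpace 𝓘(ℝ, V) : M → Type _)}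
  {D : GenConnection A.toCourantAlgebroid} {e : Sec V F E} {c : ℝ} {x : M}

namespace IsNormal

variable {s t r w : Sec V F E}

theorem cov_lft (hs : G.IsNormal cov x s) (ε : ℤˣ) : cov (A.anchorField (G.lft ε s)) x = 0 := by
  rw [anchorField_lft G hs.split]
  exact hs.cov_eq

theorem anchor_lft (hs : G.IsNormal cov x s) (ε : ℤˣ) :
    A.anchor x (G.lft ε s x) = A.anchor x (s x) := G.anchor_lft hs.split ε x

/-- With both anchors parallel at `x`, the bracket of two lifts of the same type has only an
`H`-part there. The next lemma gives the component of opposite type, obtained by moving the bracket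
onto the mixed pair. -/
theorem pairing_bracket (h : G.IsLeviCivita cov) (hs : G.IsNormal cov x s)
    (ht : G.IsNormal cov x t) {ε : ℤˣ} {q : E x} (hq : q ∈ G.eig ε x) :
    A.pairing x (A.bracket (G.lft ε s) (G.lft ε t) x) q
      = (1 / 2) * G.threeForm x (A.anchor x q) (A.anchor x (s x)) (A.anchor x (t x)) := by
  obtain ⟨r, hr, rfl⟩ := G.exists_split_lft_eq hq
  have h1 : G.lft ε s = G.lft (-ε) s + (2 * sgn ε) • G.endoSec s := by
    ext y
    change G.lft ε s y = G.lft (-ε) s y + (2 * sgn ε) • G.endo y (s y)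
    rw [lft_apply, lft_apply, sgn_neg]
    module
  have h2 : A.bracket (G.lft ε s) (G.lft ε t) x = A.bracket (G.lft (-ε) s) (G.lft ε t) x
      + (2 * sgn ε) • A.bracket (G.endoSec s) (G.lft ε t) x := by
    conv_lhs => rw [h1]
    simp
  have hs' : cov (A.anchorField s) x = 0 := hs.cov_eq
  have ht' : cov (A.anchorField t) x = 0 := ht.cov_eq
  rw [h2, map_add, LinearMap.add_apply, map_smul, LinearMap.smul_apply,
    pairing_bracket_lft h ε hs.split ht.split hr, pairing_bracket_endo_left h hs.split, hs', ht',
    G.anchor_lft hr, G.threeForm_rotate x (A.anchor x (r x))]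
  simp

theorem pairing_bracket_neg (h : G.IsLeviCivita cov) (hs : G.IsNormal cov x s)
    (ht : G.IsNormal cov x t) {ε : ℤˣ} {q : E x} (hq : q ∈ G.eig (-ε) x) :
    A.pairing x (A.bracket (G.lft ε s) (G.lft ε t) x) q
      = (1 / 2) * G.threeForm x (A.anchor x q) (A.anchor x (s x)) (A.anchor x (t x)) := by
  obtain ⟨w, hw, rfl⟩ := G.exists_isSec_eq hq
  have h1 := G.pairing_bracket_of_isSec (G.lft ε s) (G.isSec_lft ε t) hw x
  have h2 := G.pairing_bracket_swap_of_isSec hw (G.isSec_lft ε s) x (G.lft ε t x)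
  have h3 := pairing_bracket_eq h hw (G.isSec_lft ε s) (G.isSec_lft ε t x)
  rw [hs.cov_lft, hs.anchor_lft, ht.anchor_lft] at h3
  rw [A.pairing_symm x (G.lft ε t x)] at h1
  rw [h1, ← h2, h3]
  simp

end IsNormal

namespace HasForm

variable {s t r w : Sec V F E} {ε : ℤˣ}

theorem pairing_normal (hf : G.HasForm cov D e c) (hr : G.IsNormal cov x r) {p q : E x}
    (hp : p ∈ G.eig ε x) (hq : q ∈ G.eig ε x) :
    A.pairing x (D.toFun (G.lft ε r) x p) q
      = G.connForm x c (A.anchor x (G.proj ε e x)) (A.anchor x p) (A.anchor x (r x))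
        (A.anchor x q) := by
  have he : ∀ {v}, v ∈ G.eig ε x → A.pairing x (e x) v
      = sgn ε * G.metric x (A.anchor x (G.proj ε e x)) (A.anchor x v) := fun {v} hv ↦ by
    rw [← G.pairing_eq_metric (G.isSec_proj ε e x) hv, proj_apply, G.pairing_projAt_left _ hv]
  rw [hf.pairing_of_mem (G.isSec_lft ε r) hp hq, hr.cov_lft, he hq, he (G.isSec_lft ε r x),
    G.pairing_eq_metric hp (G.isSec_lft ε r x), G.pairing_eq_metric hp hq, hr.anchor_lft, connForm]
  simp only [zero_apply, map_zero, LinearMap.zero_apply]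
  linear_combination c * (G.metric x (A.anchor x p) (A.anchor x (r x))
      * G.metric x (A.anchor x (G.proj ε e x)) (A.anchor x q)
    - G.metric x (A.anchor x (G.proj ε e x)) (A.anchor x (r x))
      * G.metric x (A.anchor x p) (A.anchor x q)) * sgn_mul_self ε

theorem pairing_normal_neg (hf : G.HasForm cov D e c) (hr : G.IsNormal cov x r) {p q : E x}
    (hp : p ∈ G.eig (-ε) x) (hq : q ∈ G.eig ε x) :
    A.pairing x (D.toFun (G.lft ε r) x p) q
      = (1 / 2) * G.threeForm x (A.anchor x p) (A.anchor x (r x)) (A.anchor x q) := by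
  rw [hf.pairing_of_mem_neg (G.isSec_lft ε r) hp hq, hr.cov_lft, hr.anchor_lft]
  simp

/-- The formula of `HasForm` holds at all points, so it may be differentiated before evaluating at
`x`; parallel anchors then leave only the second derivative, the derivative of `H` and that of
`e_±`. The term `H/6` is kept in the form `⟨[t,r],w⟩/3`, a smooth function. -/
theorem df_pair_normal (hf : G.HasForm cov D e c) (h : G.IsLeviCivita cov)
    (ht : G.IsNormal cov x t) (hr : G.IsNormal cov x r) (hw : G.IsNormal cov x w)
    (Z : TangentSpace 𝓘(ℝ, V) x) :
    df (A.pair (D.cov (G.lft ε t) (G.lft ε r)) (G.lft ε w)) x Z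
      = sgn ε * G.metric x (cov (h.nabla (A.tan t) (A.tan r)) x Z) (A.anchor x (w x))
        + (1 / 3) * df (A.pair (A.bracket t r) w) x Z
        + c * (G.metric x (A.anchor x (t x)) (A.anchor x (r x))
            * G.metric x (cov (A.anchorField (G.proj ε e)) x Z) (A.anchor x (w x))
          - G.metric x (cov (A.anchorField (G.proj ε e)) x Z) (A.anchor x (r x))
            * G.metric x (A.anchor x (t x)) (A.anchor x (w x))) := by
  obtain ⟨φ, hφ, hφ'⟩ := h.exists_fun_metric_nabla ht.split hr.split hw.split
  have hF : A.pair (D.cov (G.lft ε t) (G.lft ε r)) (G.lft ε w)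
      = sgn ε • φ + (1 / 3 : ℝ) • A.pair (A.bracket t r) w
        + c • (A.pair (G.lft ε t) (G.lft ε r) * A.pair (G.proj ε e) (G.lft ε w)
          - A.pair (G.proj ε e) (G.lft ε r) * A.pair (G.lft ε t) (G.lft ε w)) := by
    ext y
    have h1 := hf.pairing_of_mem (G.isSec_lft ε r) (G.isSec_lft ε t y) (G.isSec_lft ε w y)
    rw [anchorField_lft G hr.split, G.anchor_lft ht.split, G.anchor_lft hr.split,
      G.anchor_lft hw.split, G.threeForm_eq ht.split hr.split hw.split] at h1
    refine h1.trans ?_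
    change _ = sgn ε * φ y + (1 / 3) * A.pairing y (A.bracket t r y) (w y)
      + c * (A.pairing y (G.lft ε t y) (G.lft ε r y) * A.pairing y (G.proj ε e y) (G.lft ε w y)
        - A.pairing y (G.proj ε e y) (G.lft ε r y) * A.pairing y (G.lft ε t y) (G.lft ε w y))
    rw [hφ, proj_apply, G.pairing_projAt_left _ (G.isSec_lft ε w y),
      G.pairing_projAt_left _ (G.isSec_lft ε r y)]
    change sgn ε * G.metric y (cov (A.tan r) y (A.tan t y)) (A.tan w y) + _ + _ = _
    ring
  have hS := fun s ↦ G.isSec_lft ε s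
  have hE := G.isSec_proj ε e
  rw [hF, df_add, df_add, df_const_smul, df_const_smul, df_const_smul, df_sub, df_mul, df_mul,
    hφ', h.df_pair (hS t) (hS r), h.df_pair hE (hS w), h.df_pair hE (hS r),
    h.df_pair (hS t) (hS w), hr.cov_eq, hw.cov_eq]
  simp only [G.pairing_eq_metric (hS t x) (hS r x), ht.cov_lft, hr.cov_lft, hw.cov_lft,
    G.pairing_eq_metric (hS t x) (hS w x), ht.anchor_lft, hr.anchor_lft, hw.anchor_lft,
    zero_apply, map_zero, LinearMap.zero_apply, CourantAlgebroid.pair_apply, A.tan_apply]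
  linear_combination c * (G.metric x (A.anchor x (t x)) (A.anchor x (r x))
            * G.metric x (cov (A.anchorField (G.proj ε e)) x Z) (A.anchor x (w x))
          - G.metric x (cov (A.anchorField (G.proj ε e)) x Z) (A.anchor x (r x))
            * G.metric x (A.anchor x (t x)) (A.anchor x (w x))) * sgn_mul_self ε

theorem pairing_cov_cov (hf : G.HasForm cov D e c) (f : G.Frame x) (hs : G.IsNormal cov x s)
    (ht : G.IsNormal cov x t) (hr : G.IsNormal cov x r) (hw : G.IsNormal cov x w) :
    A.pairing x (D.toFun (G.lft ε r) x (G.lft ε t x)) (D.toFun (G.lft ε w) x (G.lft ε s x))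
      = sgn ε * ∑ k, (f.η k)⁻¹ *
        (G.connForm x c (A.anchor x (G.proj ε e x)) (A.anchor x (t x)) (A.anchor x (r x)) (f.e k)
        * G.connForm x c (A.anchor x (G.proj ε e x)) (A.anchor x (s x)) (A.anchor x (w x))
          (f.e k)) := by
  rw [← f.sum_pairing_smul_of_mem (hf.mem (G.isSec_lft ε w) x (G.lft ε s x)), map_sum,
    Finset.mul_sum]
  refine Finset.sum_congr rfl fun k _ ↦ ?_
  rw [map_smul, smul_eq_mul, hf.pairing_normal hr (G.isSec_lft ε t x) (f.p_mem ε k),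
    hf.pairing_normal hw (G.isSec_lft ε s x) (f.p_mem ε k), f.anchor_p, ht.anchor_lft,
    hs.anchor_lft, Frame.N]
  ring

/-- The bracket has components in both eigenbundles. The `E_±` part meets the pure connection form
and the `E_∓` part meets `H/2`, with opposite signs in the frame. -/
theorem pairing_cov_bracket (hf : G.HasForm cov D e c) (h : G.IsLeviCivita cov) (f : G.Frame x)
    (hs : G.IsNormal cov x s) (ht : G.IsNormal cov x t) (hr : G.IsNormal cov x r)
    (hw : G.IsNormal cov x w) :
    A.pairing x (D.toFun (G.lft ε r) x (A.bracket (G.lft ε s) (G.lft ε t) x)) (G.lft ε w x)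
      = sgn ε * ∑ k, (f.η k)⁻¹ * ((1 / 2) *
        G.threeForm x (f.e k) (A.anchor x (s x)) (A.anchor x (t x))
        * (G.connForm x c (A.anchor x (G.proj ε e x)) (f.e k) (A.anchor x (r x)) (A.anchor x (w x))
          - (1 / 2) * G.threeForm x (f.e k) (A.anchor x (r x)) (A.anchor x (w x)))) := by
  rw [← f.sum_pairing_smul ε (A.bracket (G.lft ε s) (G.lft ε t) x), map_sub, map_sub, map_sum,
    map_sum, map_sum, map_sum, LinearMap.sub_apply, LinearMap.sum_apply, LinearMap.sum_apply,
    ← Finset.sum_sub_distrib, Finset.mul_sum]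
  refine Finset.sum_congr rfl fun k _ ↦ ?_
  simp only [map_smul, LinearMap.smul_apply, smul_eq_mul]
  rw [hs.pairing_bracket h ht (f.p_mem ε k), hs.pairing_bracket_neg h ht (f.p_mem (-ε) k),
    hf.pairing_normal hr (f.p_mem ε k) (G.isSec_lft ε w x),
    hf.pairing_normal_neg hr (f.p_mem (-ε) k) (G.isSec_lft ε w x), f.anchor_p, f.anchor_p,
    hw.anchor_lft, Frame.N]
  ring

/-- The naive curvature on sections with parallel anchors. -/
theorem naiveCurv_normal (hf : G.HasForm cov D e c) (h : G.IsLeviCivita cov) (f : G.Frame x)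
    (hs : G.IsNormal cov x s) (ht : G.IsNormal cov x t) (hr : G.IsNormal cov x r)
    (hw : G.IsNormal cov x w) :
    D.naiveCurv (G.lft ε w) (G.lft ε r) (G.lft ε s) (G.lft ε t) x
      = sgn ε * G.metric x (affineCurv cov (A.tan s) (A.tan t) (A.tan r) x) (A.anchor x (w x))
        + (1 / 3) * (df (A.pair (A.bracket t r) w) x (A.anchor x (s x))
          - df (A.pair (A.bracket s r) w) x (A.anchor x (t x)))
        + c * (G.metric x (A.anchor x (t x)) (A.anchor x (r x))
            * G.metric x (cov (A.anchorField (G.proj ε e)) x (A.anchor x (s x))) (A.anchor x (w x))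
          - G.metric x (cov (A.anchorField (G.proj ε e)) x (A.anchor x (s x))) (A.anchor x (r x))
            * G.metric x (A.anchor x (t x)) (A.anchor x (w x))
          - G.metric x (A.anchor x (s x)) (A.anchor x (r x))
            * G.metric x (cov (A.anchorField (G.proj ε e)) x (A.anchor x (t x))) (A.anchor x (w x))
          + G.metric x (cov (A.anchorField (G.proj ε e)) x (A.anchor x (t x))) (A.anchor x (r x))
            * G.metric x (A.anchor x (s x)) (A.anchor x (w x)))
        + sgn ε * ∑ k, (f.η k)⁻¹ * G.quadTerm x c (A.anchor x (G.proj ε e x)) (A.anchor x (s x))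
          (A.anchor x (t x)) (A.anchor x (r x)) (A.anchor x (w x)) (f.e k) := by
  -- Metric compatibility: `⟨D_s D_t r, w⟩` is the derivative of `⟨D_t r, w⟩` along `s` minus `⟨D_t
  -- r, D_s w⟩`.
  have h1 := D.df_pair (D.cov (G.lft ε t) (G.lft ε r)) (G.lft ε w) x (G.lft ε s x)
  have h2 := D.df_pair (D.cov (G.lft ε s) (G.lft ε r)) (G.lft ε w) x (G.lft ε t x)
  rw [hf.df_pair_normal h ht hr hw, hs.anchor_lft, D.cov_apply,
    hf.pairing_cov_cov f hs ht hr hw] at h1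
  rw [hf.df_pair_normal h hs hr hw, ht.anchor_lft, D.cov_apply,
    hf.pairing_cov_cov f ht hs hr hw] at h2
  have h3 := hf.pairing_cov_bracket (ε := ε) h f hs ht hr hw
  have h4 : affineCurv cov (A.tan s) (A.tan t) (A.tan r) x
      = cov (h.nabla (A.tan t) (A.tan r)) x (A.anchor x (s x))
        - cov (h.nabla (A.tan s) (A.tan r)) x (A.anchor x (t x)) := by
    rw [h.affineCurv_eq, hr.cov_eq]
    simp
  rw [GenConnection.naiveCurv, map_sub, map_sub, LinearMap.sub_apply, LinearMap.sub_apply,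
    D.cov_apply, D.cov_apply, D.cov_apply, h3, h4, map_sub, LinearMap.sub_apply]
  have h6 : ∑ k, (f.η k)⁻¹ * G.quadTerm x c (A.anchor x (G.proj ε e x)) (A.anchor x (s x))
      (A.anchor x (t x)) (A.anchor x (r x)) (A.anchor x (w x)) (f.e k)
      = -(∑ k, (f.η k)⁻¹ *
        (G.connForm x c (A.anchor x (G.proj ε e x)) (A.anchor x (t x)) (A.anchor x (r x)) (f.e k)
        * G.connForm x c (A.anchor x (G.proj ε e x)) (A.anchor x (s x)) (A.anchor x (w x))
          (f.e k)))
      + (∑ k, (f.η k)⁻¹ *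
        (G.connForm x c (A.anchor x (G.proj ε e x)) (A.anchor x (s x)) (A.anchor x (r x)) (f.e k)
        * G.connForm x c (A.anchor x (G.proj ε e x)) (A.anchor x (t x)) (A.anchor x (w x))
          (f.e k)))
      - ∑ k, (f.η k)⁻¹ * ((1 / 2) *
        G.threeForm x (f.e k) (A.anchor x (s x)) (A.anchor x (t x))
        * (G.connForm x c (A.anchor x (G.proj ε e x)) (f.e k) (A.anchor x (r x)) (A.anchor x (w x))
          - (1 / 2) * G.threeForm x (f.e k) (A.anchor x (r x)) (A.anchor x (w x)))) := by
    rw [← Finset.sum_neg_distrib, ← Finset.sum_add_distrib, ← Finset.sum_sub_distrib]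
    refine Finset.sum_congr rfl fun k _ ↦ ?_
    rw [quadTerm]
    ring
  rw [h6]
  linear_combination h2 - h1

/-- The trace term of the generalised Riemann tensor on sections with parallel anchors. -/
theorem trE_normal (hf : G.HasForm cov D e c) (f : G.Frame x)
    (hs : G.IsNormal cov x s) (ht : G.IsNormal cov x t) (hr : G.IsNormal cov x r)
    (hw : G.IsNormal cov x w) :
    A.trE x (fun p q ↦ A.pairing x (D.toFun (G.lft ε s) x p) (G.lft ε t x)
        * A.pairing x (D.toFun (G.lft ε r) x q) (G.lft ε w x))
      = sgn ε * ∑ k, (f.η k)⁻¹ * G.traceTerm x c (A.anchor x (G.proj ε e x)) (A.anchor x (s x))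
          (A.anchor x (t x)) (A.anchor x (r x)) (A.anchor x (w x)) (f.e k) := by
  have h1 := f.trE_eq ε ((LinearMap.mul ℝ ℝ).compl₁₂
    (((A.pairing x).flip (G.lft ε t x)).comp (D.toFun (G.lft ε s) x))
    (((A.pairing x).flip (G.lft ε w x)).comp (D.toFun (G.lft ε r) x)))
  refine h1.trans ?_
  rw [← Finset.sum_sub_distrib, Finset.mul_sum]
  refine Finset.sum_congr rfl fun k _ ↦ ?_
  change f.N ε k * (A.pairing x (D.toFun (G.lft ε s) x (f.p ε k)) (G.lft ε t x)
      * A.pairing x (D.toFun (G.lft ε r) x (f.p ε k)) (G.lft ε w x))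
    - f.N ε k * (A.pairing x (D.toFun (G.lft ε s) x (f.p (-ε) k)) (G.lft ε t x)
      * A.pairing x (D.toFun (G.lft ε r) x (f.p (-ε) k)) (G.lft ε w x)) = _
  rw [hf.pairing_normal hs (f.p_mem ε k) (G.isSec_lft ε t x),
    hf.pairing_normal hr (f.p_mem ε k) (G.isSec_lft ε w x),
    hf.pairing_normal_neg hs (f.p_mem (-ε) k) (G.isSec_lft ε t x),
    hf.pairing_normal_neg hr (f.p_mem (-ε) k) (G.isSec_lft ε w x), f.anchor_p, f.anchor_p,
    ht.anchor_lft, hw.anchor_lft, Frame.N, traceTerm]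
  ring

/-- The generalised Riemann tensor `Rm(P, a, P, b)` on sections with parallel anchors. -/
theorem riem_normal (hf : G.HasForm cov D e c) (h : G.IsLeviCivita cov) (f : G.Frame x)
    {p a b : Sec V F E} (hp : G.IsNormal cov x p) (ha : G.IsNormal cov x a)
    (hb : G.IsNormal cov x b) {j : Fin (finrank ℝ V)} (hpj : A.anchor x (p x) = f.e j) :
    2 * D.riem (G.lft ε p) (G.lft ε a) (G.lft ε p) (G.lft ε b) x
      = sgn ε * (G.metric x (affineCurv cov (A.tan p) (A.tan b) (A.tan a) x) (f.e j)
          + G.metric x (affineCurv cov (A.tan p) (A.tan a) (A.tan b) x) (f.e j))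
        + c * (2 * G.metric x (A.anchor x (a x)) (A.anchor x (b x))
            * G.metric x (cov (A.anchorField (G.proj ε e)) x (f.e j)) (f.e j)
          - G.metric x (A.anchor x (b x)) (f.e j)
            * G.metric x (cov (A.anchorField (G.proj ε e)) x (f.e j)) (A.anchor x (a x))
          - G.metric x (A.anchor x (a x)) (f.e j)
            * G.metric x (cov (A.anchorField (G.proj ε e)) x (f.e j)) (A.anchor x (b x))
          - G.metric x (A.anchor x (a x)) (f.e j)
            * G.metric x (cov (A.anchorField (G.proj ε e)) x (A.anchor x (b x))) (f.e j)
          - G.metric x (A.anchor x (b x)) (f.e j)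
            * G.metric x (cov (A.anchorField (G.proj ε e)) x (A.anchor x (a x))) (f.e j)
          + G.metric x (f.e j) (f.e j)
            * (G.metric x (cov (A.anchorField (G.proj ε e)) x (A.anchor x (b x))) (A.anchor x (a x))
            + G.metric x (cov (A.anchorField (G.proj ε e)) x (A.anchor x (a x)))
              (A.anchor x (b x))))
        + sgn ε * ∑ k, (f.η k)⁻¹ *
          (G.quadTerm x c (A.anchor x (G.proj ε e x)) (f.e j) (A.anchor x (b x))
            (A.anchor x (a x)) (f.e j) (f.e k)
          + G.quadTerm x c (A.anchor x (G.proj ε e x)) (A.anchor x (a x)) (f.e j) (f.e j)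
            (A.anchor x (b x)) (f.e k)
          + G.traceTerm x c (A.anchor x (G.proj ε e x)) (f.e j) (A.anchor x (b x))
            (A.anchor x (a x)) (f.e j) (f.e k)) := by
  have hH : ∀ {s t r : Sec V F E}, G.IsSplit s → G.IsSplit t → G.IsSplit r → ∀ y,
      A.pair (A.bracket s t) r y = (1 / 2) * G.threeForm y (A.anchor y (s y)) (A.anchor y (t y))
        (A.anchor y (r y)) := fun hs ht hr y ↦ by
    rw [G.threeForm_eq hs ht hr, A.pair_apply]
    ring
  -- These identities remove the derivatives of `H`: a repeated argument kills two of the functions,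
  -- and cyclicity makes the other two equal. They are differentiated along the same vector with
  -- opposite signs.
  have z1 : A.pair (A.bracket p a) p = 0 := by
    ext y
    rw [hH hp.split ha.split hp.split, G.threeForm_rotate, G.threeForm_self_right, mul_zero]
    rfl
  have z2 : A.pair (A.bracket p p) b = 0 := by
    ext y
    rw [hH hp.split hp.split hb.split, G.threeForm_self_left, mul_zero]
    rfl
  have z3 : A.pair (A.bracket b a) p = A.pair (A.bracket a p) b := by
    ext y
    rw [hH hb.split ha.split hp.split, hH ha.split hp.split hb.split,
      G.threeForm_rotate y (A.anchor y (b y))]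
  have c1 := hf.naiveCurv_normal (ε := ε) h f hp hb ha hp
  have c2 := hf.naiveCurv_normal (ε := ε) h f ha hp hp hb
  have c3 := hf.trE_normal (ε := ε) f hp hb ha hp
  -- The pair skew-symmetries of `∇`'s curvature bring the second curvature into the form of a Ricci
  -- summand.
  have c4 := h.metric_affineCurv_swap (A.tan a) (A.tan p) (A.tan p) (A.tan b) x
  have c5 := h.affineCurv_swap (A.tan a) (A.tan p) (A.tan b) x
  rw [c5, map_neg, LinearMap.neg_apply, neg_neg] at c4
  simp only [A.tan_apply, hpj] at c4
  rw [hpj, z1, z3, df_zero] at c1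
  rw [hpj, z2, df_zero, c4] at c2
  rw [hpj] at c3
  rw [GenConnection.riem, c1, c2, c3]
  simp only [mul_add, Finset.sum_add_distrib, G.metric_symm x (f.e j) (A.anchor x (a x)),
    G.metric_symm x (f.e j) (A.anchor x (b x)),
    G.metric_symm x (A.anchor x (b x)) (A.anchor x (a x))]
  ring

end HasForm

end GenMetric


/-! ### The trace over the frame and the final formula -/

namespace GenMetric

variable {A : ExactCourantAlgebroid V F E} {G : GenMetric A.toCourantAlgebroid}
  {cov : CovariantDerivative 𝓘(ℝ, V) V (TangentSpace 𝓘(ℝ, V) : M → Type _)}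
  {D : GenConnection A.toCourantAlgebroid} {e : Sec V F E} {c : ℝ}

/-- The full generalised Ricci tensor on sections of `E_±`. -/
theorem HasForm.ricci_eq (hf : G.HasForm cov D e c) (h : G.IsLeviCivita cov) {ε : ℤˣ}
    {a b : Sec V F E} (ha : G.IsSec ε a) (hb : G.IsSec ε b) (x : M) :
    D.ricci a b x
      = ricciTensor cov x (A.anchor x (a x)) (A.anchor x (b x))
        - (1 / 12) * G.threeFormSq x (A.anchor x (a x)) (A.anchor x (b x))
        + sgn ε * (c * divergence cov (A.anchorField (G.proj ε e)) x)
          * G.metric x (A.anchor x (a x)) (A.anchor x (b x))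
        + sgn ε * (c * ((finrank ℝ V - 2) / 2))
          * (G.metric x (cov (A.anchorField (G.proj ε e)) x (A.anchor x (a x))) (A.anchor x (b x))
          + G.metric x (cov (A.anchorField (G.proj ε e)) x (A.anchor x (b x))) (A.anchor x (a x)))
        + c ^ 2 * ((3 - 2 * finrank ℝ V) / 2)
          * (G.metric x (A.anchor x (G.proj ε e x)) (A.anchor x (G.proj ε e x))
            * G.metric x (A.anchor x (a x)) (A.anchor x (b x)))
        + c ^ 2 * ((finrank ℝ V - 2) / 2)
          * (G.metric x (A.anchor x (G.proj ε e x)) (A.anchor x (a x))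
            * G.metric x (A.anchor x (G.proj ε e x)) (A.anchor x (b x))) := by
  obtain ⟨f⟩ := G.nonempty_frame x
  obtain ⟨s, hs, hsa⟩ := G.exists_normal cov x (A.anchor x (a x))
  obtain ⟨t, ht, htb⟩ := G.exists_normal cov x (A.anchor x (b x))
  choose p hp hpe using fun j ↦ G.exists_normal cov x (f.e j)
  have has : a x = G.lft ε s x :=
    G.eq_of_mem_eig (ha x) (G.isSec_lft ε s x) (by rw [hs.anchor_lft, hsa])
  have hbt : b x = G.lft ε t x :=
    G.eq_of_mem_eig (hb x) (G.isSec_lft ε t x) (by rw [ht.anchor_lft, htb])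
  have hP : ∀ j, G.lft ε (p j) x = f.p ε j := fun j ↦ by
    rw [G.lft_eq_lift (hp j).split, hpe, Frame.p]
  rw [G.ricci_eq_sum hf.mem f ha hb has hbt _ hP, ← hsa, ← htb]
  have r1 := h.ricciTensor_eq f (A.tan s) (A.tan t) (fun j ↦ A.tan (p j)) hpe
  have r2 := h.ricciTensor_eq f (A.tan t) (A.tan s) (fun j ↦ A.tan (p j)) hpe
  -- The two curvature sums are `Rc(v,u)` and `Rc(u,v)`; symmetry makes their half-sum the Ricci
  -- tensor.
  rw [h.ricciTensor_symm] at r2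
  simp only [A.tan_apply] at r1 r2
  generalize hU : A.anchor x (s x) = U at *
  generalize hW : A.anchor x (t x) = W at *
  generalize hX : A.anchor x (G.proj ε e x) = X
  generalize hΞ : A.anchorField (G.proj ε e) = Ξ
  have hq := f.sum_quadTerm c X U W
  have hdiv := f.divergence_eq (cov := cov) Ξ
  have l1 := f.sum_metric_mul (((G.metric x).flip U).comp (cov Ξ x).toLinearMap) W
  have l2 := f.sum_metric_mul (((G.metric x).flip W).comp (cov Ξ x).toLinearMap) U
  have m1 := f.sum_metric_mul_metric U (cov Ξ x W)
  have m2 := f.sum_metric_mul_metric W (cov Ξ x U)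
  change ∑ j, (f.η j)⁻¹ * (G.metric x W (f.e j) * G.metric x (cov Ξ x (f.e j)) U)
    = G.metric x (cov Ξ x W) U at l1
  change ∑ j, (f.η j)⁻¹ * (G.metric x U (f.e j) * G.metric x (cov Ξ x (f.e j)) W)
    = G.metric x (cov Ξ x U) W at l2
  have key : ∀ j, f.N ε j * D.riem (G.lft ε (p j)) (G.lft ε s) (G.lft ε (p j)) (G.lft ε t) x
      = (1 / 2) * ((f.η j)⁻¹ * G.metric x (affineCurv cov (A.tan (p j)) (A.tan t) (A.tan s) x)
            (f.e j)
          + (f.η j)⁻¹ * G.metric x (affineCurv cov (A.tan (p j)) (A.tan s) (A.tan t) x) (f.e j))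
        + sgn ε * (c / 2) * (2 * G.metric x U W
            * ((f.η j)⁻¹ * G.metric x (cov Ξ x (f.e j)) (f.e j))
          - (f.η j)⁻¹ * (G.metric x W (f.e j) * G.metric x (cov Ξ x (f.e j)) U)
          - (f.η j)⁻¹ * (G.metric x U (f.e j) * G.metric x (cov Ξ x (f.e j)) W)
          - (f.η j)⁻¹ * (G.metric x U (f.e j) * G.metric x (cov Ξ x W) (f.e j))
          - (f.η j)⁻¹ * (G.metric x W (f.e j) * G.metric x (cov Ξ x U) (f.e j))
          + (G.metric x (cov Ξ x W) U + G.metric x (cov Ξ x U) W)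
            * ((f.η j)⁻¹ * G.metric x (f.e j) (f.e j)))
        + (1 / 2) * ((f.η j)⁻¹ * ∑ k, (f.η k)⁻¹ *
          (G.quadTerm x c X (f.e j) W U (f.e j) (f.e k)
          + G.quadTerm x c X U (f.e j) (f.e j) W (f.e k)
          + G.traceTerm x c X (f.e j) W U (f.e j) (f.e k))) := by
    intro j
    have h1 := hf.riem_normal (ε := ε) h f (hp j) hs ht (hpe j)
    rw [hU, hW, hX, hΞ] at h1
    have h2 := sgn_mul_self ε
    rw [Frame.N]
    -- The sign in `N` squares away against the one in front of the curvature and quadratic terms,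
    -- and remains on the terms linear in `e_±`.
    linear_combination (sgn ε * (f.η j)⁻¹ / 2) * h1
      + (1 / 2) * ((f.η j)⁻¹ * (G.metric x (affineCurv cov (A.tan (p j)) (A.tan t) (A.tan s) x)
            (f.e j)
          + G.metric x (affineCurv cov (A.tan (p j)) (A.tan s) (A.tan t) x) (f.e j))
        + (f.η j)⁻¹ * ∑ k, (f.η k)⁻¹ *
          (G.quadTerm x c X (f.e j) W U (f.e j) (f.e k)
          + G.quadTerm x c X U (f.e j) (f.e j) W (f.e k)
          + G.traceTerm x c X (f.e j) W U (f.e j) (f.e k))) * h2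
  simp only [key, Finset.sum_add_distrib, Finset.sum_sub_distrib, ← Finset.mul_sum]
  have m1' : ∑ j, (f.η j)⁻¹ * (G.metric x U (f.e j) * G.metric x (cov Ξ x W) (f.e j))
      = G.metric x (cov Ξ x W) U := by rw [m1, G.metric_symm]
  have m2' : ∑ j, (f.η j)⁻¹ * (G.metric x W (f.e j) * G.metric x (cov Ξ x U) (f.e j))
      = G.metric x (cov Ξ x U) W := by rw [m2, G.metric_symm]
  -- Each symmetrised derivative of `X` occurs `d` times from the trace of `g` and is subtracted
  -- twice by contraction, whence the factor `d - 2`.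
  rw [← r1, ← r2, ← hdiv, l1, l2, m1', m2', f.sum_metric_self, hq]
  ring

end GenMetric

end GenGeom

end

theorem mainTheorem5
    {V : Type*} [NormedAddCommGroup V] [NormedSpace ℝ V] [FiniteDimensional ℝ V]
    {M : Type*} [TopologicalSpace M] [ChartedSpace V M] [IsManifold 𝓘(ℝ, V) ∞ M] [T2Space M]
    {F : Type*} [NormedAddCommGroup F] [NormedSpace ℝ F] [FiniteDimensional ℝ F]
    {E : M → Type*} [∀ x, AddCommGroup (E x)] [∀ x, Module ℝ (E x)]
    [∀ x, TopologicalSpace (E x)] [TopologicalSpace (TotalSpace F E)]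
    [FiberBundle F E] [VectorBundle ℝ F E] [ContMDiffVectorBundle ∞ F E 𝓘(ℝ, V)]
    (A : GenGeom.ExactCourantAlgebroid V F E)
    (G : GenGeom.GenMetric A.toCourantAlgebroid)
    -- the dimension of `M`
    (d : ℕ) (hd : d = finrank ℝ V) (hd2 : 2 ≤ d)
    -- the Levi-Civita connection `∇` of the metric `g` induced by `𝒢`
    (cov : CovariantDerivative 𝓘(ℝ, V) V (TangentSpace 𝓘(ℝ, V) : M → Type _))
    (hcov : G.IsLeviCivita cov)
    -- the divergence operator `div = div^𝒢 - ⟨e, ·⟩`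
    (dv : GenGeom.DivergenceOperator A.toCourantAlgebroid) (e : GenGeom.Sec V F E)
    (he : ∀ (u : GenGeom.Sec V F E) (x : M),
      dv.toFun u x = GenGeom.metricDiv A.toCourantAlgebroid cov u x - A.pairing x (e x) (u x))
    -- the canonical generalised Levi-Civita connection `D = D^{𝒢,div}`
    (D : GenGeom.GenConnection A.toCourantAlgebroid) (hD : G.IsCanonical cov dv D)
    -- the sign `±` and sections `a`, `b` of `E_±`
    (ε : ℤˣ) (a b : GenGeom.Sec V F E) (ha : G.IsSec ε a) (hb : G.IsSec ε b) (x : M) :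
    -- `s = ±1`, `eε = e_±`, `X = π e_±`, `u = π a` and `v = π b` at `x`
    let s : ℝ := ((ε : ℤ) : ℝ)
    let eε : GenGeom.Sec V F E := G.proj ε e
    let X : Π y : M, TangentSpace 𝓘(ℝ, V) y := A.anchorField eε
    let g := G.metric x
    let u : TangentSpace 𝓘(ℝ, V) x := A.anchor x (a x)
    let v : TangentSpace 𝓘(ℝ, V) x := A.anchor x (b x)
    D.ricci a b x
      = GenGeom.ricciTensor cov x u v
        - (1 / 12) * G.threeFormSq x u v
        + s * (GenGeom.divergence cov X x / (d - 1)) * g u v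
        + s * ((d - 2) / (d - 1)) * ((1 / 2) * (g (cov X x u) v + g (cov X x v) u))
        + (3 - 2 * d) / (2 * (d - 1) ^ 2) * A.pairing x (G.endo x (eε x)) (eε x) * g u v
        + (d - 2) / (2 * (d - 1) ^ 2) * (g (X x) u * g (X x) v) := by
  intro s eε X g u v
  subst hd
  have h1 : (finrank ℝ V : ℝ) - 1 ≠ 0 := by
    have : (2 : ℝ) ≤ finrank ℝ V := by exact_mod_cast hd2
    linarith
  -- On `E_±` both `𝒢^end` and the comparison of `⟨·,·⟩` with `g` contribute the sign, so the
  -- `𝒢`-norm is the `g`-norm of the anchor.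
  have h2 : A.pairing x (G.endo x (eε x)) (eε x)
      = G.metric x (A.anchor x (eε x)) (A.anchor x (eε x)) := by
    have hE : eε x ∈ G.eig ε x := G.isSec_proj ε e x
    rw [G.mem_eig_iff.1 hE, map_smul, LinearMap.smul_apply, smul_eq_mul, G.pairing_eq_metric hE hE]
    linear_combination G.metric x (A.anchor x (eε x)) (A.anchor x (eε x)) * GenGeom.sgn_mul_self ε
  rw [(hD.hasForm hcov he hd2).ricci_eq hcov ha hb x, h2]
  simp only [s, eε, X, g, u, v, GenGeom.sgn, GenGeom.CourantAlgebroid.anchorField]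
  field_simp
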